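/- Let $\Omega$ be $\mathbb{R}^2$ with Lebesgue measure or the torus $\mathbb{T}^2=(\mathbb{R}/\mathbb{Z})^2$ with its Haar measure of total mass $1$. Functions $f:\Omega\to\mathbb{R}$ are measurable, and $Q$ denotes a cube in $\Omega$ with sides parallel to the coordinate axes. *Definitions.* For a measurable function $g$ on $\Omega$ with values in $\mathbb{R}$ or $[0,\infty]$ let $$g^*(t)=\inf\{s\ge 0: |\{|g|>s\}|\le t\},\qquad g^{**}(t)=\frac1t\int_0^t g^*(s)\,ds .$$ For a parameter $\alpha>0$ let $$M_\Omega^{\#}f(x)=\sup_{Q\ni x}\ \inf_{c\in\mathbb{R}}\ ((f-c)\chi_Q)^*(\alpha|Q|)$$ be the Strömberg–Jawerth–Torchinsky maximal function, and let $\|f\|_{(L^p)^{\#}(\Omega)}=\|M^{\#}_\Omega f\|_{L^p(\Omega)}$. A growth function is a map $\Theta:(1,\infty)\to(0,\infty)$ that is non-decreasing and doubling: $\Theta(2p)\le D\,\Theta(p)$ for all $p>1$, with some constant $D$. For $p_0\in[1,\infty)$ put $$\|f\|_{Y^{\#\Theta}_{p_0}(\Omega)}=\sup_{p>p_0}\frac{\|f\|_{(L^p)^{\#}(\Omega)}}{\Theta(p)},\qquad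 y_\Theta(r)=\inf_{p>p_0}\Theta(p)\,r^{1/p}\quad(r>0).$$ Let $\mathrm{BMO}(\Omega)$ be the space of locally integrable functions with $\|f\|_{\mathrm{BMO}}=\sup_Q\frac1{|Q|}\int_Q|f-f_Q|<\infty$, where $f_Q=\frac{1}{|Q|}\int_Q f$, and let $$K(t,f;L^{p_0},\mathrm{BMO})=\inf\{\|f_0\|_{L^{p_0}(\Omega)}+t\|f_1\|_{\mathrm{BMO}(\Omega)}: f=f_0+f_1,\ f_0\in L^{p_0}(\Omega),\ f_1\in\mathrm{BMO}(\Omega)\},$$ with $\inf\emptyset=\infty$. For quantities in $[0,\infty]$ depending on $f$, $A\approx B$ means that $A\le CB$ and $B\le CA$ with a finite constant $C$ independent of $f$. **Theorem.** There is $\alpha_0>0$ such that, whenever $M^{\#}_\Omega$ is formed with a fixed parameter $\alpha\in(0,\alpha_0)$, the following holds for every $p_0\in[1,\infty)$, every growth function $\Theta$, $\Omega=\mathbb{R}^2$ or $\mathbb{T}^2$, and all measurable $f:\Omega\to\mathbb{R}$. (i) With constants that depend only on $\alpha$, $p_0$ and the doubling constant $D$ of $\Theta$, $$\|f\|_{Y^{\#\Theta}_{p_0}(\Omega)}\approx\sup_{t\in(0,\infty)}\frac{K(t^{1/p_0},f;L^{p_0}(\Omega),\mathrm{BMO}(\Omega))}{t^{1/p_0}\,y_\Theta(1/t)}\approx\sup_{t\in(0,\infty)}\frac{[(M^{\#}_\Omega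 f)^{p_0}]^{**}(t)^{1/p_0}}{y_\Theta(1/t)} .$$ (ii) With constants that depend only on $\alpha$, $p_0$ and $\Theta$, $$\|f\|_{Y^{\#\Theta}_{p_0}(\Omega)}\approx\|f\|_{(L^{p_0})^{\#}(\Omega)}+\sup_{t\in(0,e^{-1})}\frac{K(t,f;L^{p_0}(\Omega),\mathrm{BMO}(\Omega))}{t\,\Theta(-\log t)}$$ $$\approx\|f\|_{(L^{p_0})^{\#}(\Omega)}+\sup_{t\in(0,e^{-1})}\frac{[(M^{\#}_\Omega f)^{p_0}]^{**}(t)^{1/p_0}}{\Theta(-\log t)} .$$ In particular (ii) holds for every growth function $\Theta$ such that $p\in(p_0,\infty)\mapsto e^{p_0/p}\Theta(p)$ is quasi-decreasing (equivalent to a decreasing function). -/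

import Mathlib

open MeasureTheory Set
open scoped ENNReal NNReal

noncomputable section

namespace SharpYudovich

/-- The plane, as pairs of real numbers with Lebesgue measure. Only cubes with sides parallel to
the axes and the measure matter, so no Euclidean norm is needed. -/
abbrev Plane : Type := Fin 2 → ℝ

/-- The two-dimensional torus `(ℝ / ℤ)²`, with its Haar measure of total mass one. -/
abbrev Torus : Type := Fin 2 → UnitAddCircle

section General

/- The coordinate space `A` is `ℝ` (for the plane) or `ℝ / ℤ` (for the torus). -/
variable {A : Type} [PseudoMetricSpace A] [MeasureSpace A]

/-- The open cube with sides parallel to the axes, centre `x` and side length `2 * r`. On the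
torus it is a product of two arcs (the whole torus as soon as `r > 1 / 2`). -/
def cube (x : Fin 2 → A) (r : ℝ) : Set (Fin 2 → A) :=
  {y | ∀ i, dist (y i) (x i) < r}

/-- Non-increasing rearrangement of a nonnegative function `g`:
`g^*(t) = inf {s : |{g > s}| ≤ t}`. For a real function `f` it is applied to `|f|`. -/
def rearrangement (g : (Fin 2 → A) → ℝ≥0∞) (t : ℝ≥0∞) : ℝ≥0∞ :=
  sInf {s : ℝ≥0∞ | volume {x | s < g x} ≤ t}

/-- The maximal average `g^{**}(t) = (1 / t) * ∫_0^t g^*(s) ds`. -/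
def maximalRearrangement (g : (Fin 2 → A) → ℝ≥0∞) (t : ℝ) : ℝ≥0∞ :=
  (∫⁻ s in Ioo (0 : ℝ) t, rearrangement g (ENNReal.ofReal s)) / ENNReal.ofReal t

/-- The Strömberg-Jawerth-Torchinsky maximal operator with parameter `α`:
`M^# f (x) = sup_{Q ∋ x} inf_{c ∈ ℝ} ((f - c) χ_Q)^* (α |Q|)`. -/
def sharpMax (α : ℝ) (f : (Fin 2 → A) → ℝ) (x : Fin 2 → A) : ℝ≥0∞ :=
  ⨆ (z : Fin 2 → A) (r : ℝ) (_ : 0 < r) (_ : x ∈ cube z r), ⨅ c : ℝ,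
    rearrangement ((cube z r).indicator fun y => ‖f y - c‖ₑ)
      (ENNReal.ofReal α * volume (cube z r))

/-- The norm of `(L^p)^#`, i.e. the `L^p` norm of `M^# f` (possibly infinite). -/
def sharpLpNorm (α p : ℝ) (f : (Fin 2 → A) → ℝ) : ℝ≥0∞ :=
  (∫⁻ x, sharpMax α f x ^ p) ^ (1 / p)

/-- The norm of the sharp Yudovich space `Y_{p₀}^{#Θ}`; the space consists of the
functions for which it is finite. -/
def sharpYudovichNorm (α p₀ : ℝ) (Θ : ℝ → ℝ) (f : (Fin 2 → A) → ℝ) : ℝ≥0∞ :=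
  ⨆ p ∈ Ioi p₀, sharpLpNorm α p f / ENNReal.ofReal (Θ p)

/-- The mean oscillation seminorm `sup_Q (1 / |Q|) ∫_Q |f - f_Q|`, where `f_Q` is the mean of `f`
over `Q`. -/
def bmoNorm (f : (Fin 2 → A) → ℝ) : ℝ≥0∞ :=
  ⨆ (z : Fin 2 → A) (r : ℝ) (_ : 0 < r),
    (∫⁻ y in cube z r, ‖f y - ⨍ w in cube z r, f w‖ₑ) / volume (cube z r)

/-- Functions of bounded mean oscillation. -/
def MemBMO (f : (Fin 2 → A) → ℝ) : Prop :=
  LocallyIntegrable f ∧ bmoNorm f < ∞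

/-- Peetre's `K`-functional `K(t, f; L^{p₀}, BMO)`. It is infinite if `f ∉ L^{p₀} + BMO`.
Since constants have `BMO` seminorm zero, this is also the `K`-functional of the
couple of the two spaces modulo constants. -/
def peetreK (p₀ t : ℝ) (f : (Fin 2 → A) → ℝ) : ℝ≥0∞ :=
  ⨅ (f₀ : (Fin 2 → A) → ℝ) (f₁ : (Fin 2 → A) → ℝ) (_ : MemLp f₀ (ENNReal.ofReal p₀))
    (_ : MemBMO f₁) (_ : f =ᵐ[volume] f₀ + f₁),
    eLpNorm f₀ (ENNReal.ofReal p₀) volume + ENNReal.ofReal t * bmoNorm f₁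

end General

/-- Growth functions: positive, non-decreasing and doubling (with constant `D`) on `(1, ∞)`.
The values of `Θ` outside `(1, ∞)` are irrelevant. -/
structure IsGrowthFunction (Θ : ℝ → ℝ) (D : ℝ) : Prop where
  pos : ∀ p, 1 < p → 0 < Θ p
  mono : ∀ p q, 1 < p → p ≤ q → Θ p ≤ Θ q
  doubling : ∀ p, 1 < p → Θ (2 * p) ≤ D * Θ p

/-- The Yudovich function `y_Θ(r) = inf_{p > p₀} Θ(p) r^{1/p}`. -/
def yudovichFun (p₀ : ℝ) (Θ : ℝ → ℝ) (r : ℝ) : ℝ :=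
  ⨅ p : Ioi p₀, Θ p * r ^ (1 / (p : ℝ))

/-- Two-sided comparability of two quantities in `[0, ∞]` with the finite constant `C`. -/
def Comparable (C : ℝ≥0) (a b : ℝ≥0∞) : Prop :=
  a ≤ C * b ∧ b ≤ C * a

end SharpYudovich

end

open SharpYudovich

namespace SharpYudovich

open Metric Filter
open scoped Topology

/-! ### Layer-cake formula -/

section LayerCake

variable {X : Type*} [MeasurableSpace X]

/-! Write `g` for the sharp maximal function of `f`. The heart is the equivalence of K(t^{1/p₀}, f;
L^{p₀}, BMO) with (∫_0^t (g^*)^{p₀})^{1/p₀}, that is, with t^{1/p₀} times the average `maxAverage p₀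
g t` (`exists_peetreK_comparable`). Once it is known, `f` disappears: what remains are statements
about one measurable function `g ≥ 0` and the growth function `Θ`.

Upper bound for K (`exists_decomposition`, `exists_peetreK_le`). Cut at the level l = g^*(t), so
that E = {g > l} has measure at most t. Every ball meeting the complement of E sees oscillation at
most about l off a small proportion of the ball. A Whitney-type construction replaces `f` inside E
by near-constants of Whitney balls (`BallRegular.exists_oscLE_extension`), giving f₁ with small
oscillation in all balls; the John-Strömberg inequality (`BallRegular.meanOsc_le`) bounds its BMO
seminorm by a multiple of l. The remainder f - f₁ lives in E, and a good-λ Fefferman-Stein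
inequality (`BallRegular.exists_lintegral_rpow_le`) bounds its L^{p₀} norm by g + l on a set of
measure O(t). If t is comparable to the measure of a compact space, f₁ is a constant.

Lower bound for K (`exists_le_peetreK`). For f = f₀ + f₁, `g` is at most a local maximal function of
f₀ plus a multiple of the BMO seminorm of f₁; the first term is bounded on every L^p by the weak
type estimate for indicators.

Extrapolation. Hölder's inequality for rearrangements bounds `maxAverage p₀ g t` by the Yudovich
norm times Θ(p) t^{-1/p}; take the infimum over p. Conversely a bound by y_Θ(1/t) gives g^*(s) ≤ S
Θ(q) s^{-1/q} for all q > p₀. Taking q = 2p makes (g^*)^p integrable near 0 at the cost of one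
doubling constant, while for s > 1 the L^{p₀} norm and the boundedness of g^* suffice
(`rpow_lintegral_le_of_maximalRearrangement`). For part (ii), p = -log t makes t^{-1/p} constant,
and Θ(w) ≤ C Θ(p) e^{w/p} for all p shows that Θ(-log t) is at most a multiple of y_Θ(1/t).

Cubes are balls of the sup metric, so the plane and the torus are treated together through
`BallRegular`. -/

theorem volume_setOf_ofReal_lt (a : ℝ≥0∞) :
    volume {σ : ℝ | σ ∈ Ioi (0 : ℝ) ∧ ENNReal.ofReal σ < a} = a := by
  rcases eq_or_ne a ∞ with rfl | ha
  · have : {σ : ℝ | σ ∈ Ioi (0 : ℝ) ∧ ENNReal.ofReal σ < ∞} = Ioi 0 := by ext; simp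
    rw [this, Real.volume_Ioi]
  · have : {σ : ℝ | σ ∈ Ioi (0 : ℝ) ∧ ENNReal.ofReal σ < a} = Ioo 0 a.toReal := by
      ext σ
      simp only [mem_Ioi, mem_ofPred_eq, mem_Ioo]
      refine and_congr_right fun h => ?_
      rw [ENNReal.ofReal_lt_iff_lt_toReal h.le ha]
    rw [this, Real.volume_Ioo, sub_zero, ENNReal.ofReal_toReal ha]

theorem measurableSet_subgraph {h : X → ℝ≥0∞} (hh : Measurable h) :
    MeasurableSet {q : X × ℝ | ENNReal.ofReal q.2 < h q.1} :=
  measurableSet_lt (ENNReal.measurable_ofReal.comp measurable_snd) (hh.comp measurable_fst)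

theorem lintegral_eq_lintegral_measure_lt {μ : Measure X} [SFinite μ] {h : X → ℝ≥0∞}
    (hh : Measurable h) :
    ∫⁻ x, h x ∂μ = ∫⁻ σ in Ioi (0 : ℝ), μ {x | ENNReal.ofReal σ < h x} := by
  have hm := measurableSet_subgraph hh
  have h1 : ∀ x, h x = ∫⁻ σ in Ioi (0 : ℝ),
      {q : X × ℝ | ENNReal.ofReal q.2 < h q.1}.indicator (fun _ => (1 : ℝ≥0∞)) (x, σ) := by
    intro x
    have e : ∀ σ : ℝ, {q : X × ℝ | ENNReal.ofReal q.2 < h q.1}.indicator (fun _ => (1 : ℝ≥0∞))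
        (x, σ) = {σ : ℝ | ENNReal.ofReal σ < h x}.indicator (fun _ => (1 : ℝ≥0∞)) σ := fun σ => rfl
    have hm' : MeasurableSet {σ : ℝ | ENNReal.ofReal σ < h x} :=
      measurableSet_lt ENNReal.measurable_ofReal measurable_const
    simp_rw [e]
    rw [lintegral_indicator hm', setLIntegral_const, one_mul, Measure.restrict_apply hm',
      inter_comm]
    exact (volume_setOf_ofReal_lt (h x)).symm
  calc ∫⁻ x, h x ∂μ = ∫⁻ x, (∫⁻ σ in Ioi (0 : ℝ),
      {q : X × ℝ | ENNReal.ofReal q.2 < h q.1}.indicator (fun _ => (1 : ℝ≥0∞)) (x, σ)) ∂μ :=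
        lintegral_congr h1
    _ = ∫⁻ σ in Ioi (0 : ℝ), ∫⁻ x,
      {q : X × ℝ | ENNReal.ofReal q.2 < h q.1}.indicator (fun _ => (1 : ℝ≥0∞)) (x, σ) ∂μ := by
        apply lintegral_lintegral_swap
        exact ((measurable_const.indicator hm)).aemeasurable
    _ = _ := by
        refine lintegral_congr fun σ => ?_
        have e : ∀ x, {q : X × ℝ | ENNReal.ofReal q.2 < h q.1}.indicator (fun _ => (1 : ℝ≥0∞))
          (x, σ) = {x | ENNReal.ofReal σ < h x}.indicator (fun _ => (1 : ℝ≥0∞)) x := fun x => rfl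
        simp_rw [e]
        rw [lintegral_indicator (measurableSet_lt measurable_const hh), setLIntegral_const, one_mul]

theorem measurable_measure_lt {μ : Measure X} (h : X → ℝ≥0∞) :
    Measurable fun σ : ℝ => μ {x | ENNReal.ofReal σ < h x} := by
  apply Antitone.measurable
  intro a b hab
  exact measure_mono fun x hx => lt_of_le_of_lt (ENNReal.ofReal_le_ofReal hab) hx

end LayerCake

/-! ### Decreasing rearrangements and their truncated integrals -/

section Rearrangement

variable {A : Type} [MeasureSpace A] {g h : (Fin 2 → A) → ℝ≥0∞}

/-- The distribution function is right-continuous, by continuity of the measure along increasing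
unions. This needs neither finiteness nor measurability of `h`, and makes the rearrangement an exact
generalised inverse. -/
theorem lt_rearrangement_iff {s t : ℝ≥0∞} :
    s < rearrangement h t ↔ t < volume {x | s < h x} := by
  constructor
  · intro hs
    by_contra! hc
    exact absurd (sInf_le hc : rearrangement h t ≤ s) (not_le.2 hs)
  · intro ht
    have hs : s < ∞ := by
      by_contra! hc
      rw [top_le_iff] at hc
      simp [hc] at ht
    obtain ⟨u, ua, us, ut⟩ := exists_seq_strictAnti_tendsto' hs
    have hU : {x | s < h x} = ⋃ n, {x | u n < h x} := by
      ext x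
      simp only [mem_ofPred_eq, mem_iUnion]
      constructor
      · intro hx
        exact (ut.eventually (gt_mem_nhds hx)).exists
      · rintro ⟨n, hn⟩
        exact (us n).1.trans hn
    have hmono : Monotone fun n => {x | u n < h x} := fun m n hmn x hx =>
      lt_of_le_of_lt (ua.antitone hmn) hx
    rw [hU, hmono.measure_iUnion, lt_iSup_iff] at ht
    obtain ⟨n, hn⟩ := ht
    refine (us n).1.trans_le (le_sInf fun σ hσ => ?_)
    by_contra! hlt
    exact absurd (hn.trans_le (measure_mono fun x hx => hlt.trans hx)) (not_lt.2 hσ)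

theorem rearrangement_le_iff {s t : ℝ≥0∞} :
    rearrangement h t ≤ s ↔ volume {x | s < h x} ≤ t := by
  simpa only [not_lt] using not_congr (lt_rearrangement_iff (h := h) (s := s) (t := t))

theorem rearrangement_antitone : Antitone (rearrangement h) := fun _ _ hab =>
  rearrangement_le_iff.2 ((rearrangement_le_iff.1 le_rfl).trans hab)

theorem measurable_rearrangement : Measurable fun s : ℝ => rearrangement h (ENNReal.ofReal s) :=
  Antitone.measurable fun _ _ hab => rearrangement_antitone (ENNReal.ofReal_le_ofReal hab)

theorem rearrangement_rpow {q : ℝ} (hq : 0 < q) (t : ℝ≥0∞) :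
    rearrangement (fun x => h x ^ q) t = rearrangement h t ^ q := by
  refine eq_of_forall_lt_iff fun s => ?_
  have key : ∀ b : ℝ≥0∞, s < b ^ q ↔ s ^ (1 / q) < b := by
    intro b
    rw [← ENNReal.rpow_lt_rpow_iff (x := s ^ (1 / q)) hq, ← ENNReal.rpow_mul, one_div,
      inv_mul_cancel₀ hq.ne', ENNReal.rpow_one]
  rw [lt_rearrangement_iff, key, lt_rearrangement_iff]
  simp_rw [key]

/-- The truncated integral `∫_0^t h^*(s) ds`. -/
noncomputable def rearrIntegral (h : (Fin 2 → A) → ℝ≥0∞) (t : ℝ) : ℝ≥0∞ :=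
  ∫⁻ s in Ioo (0 : ℝ) t, rearrangement h (ENNReal.ofReal s)

/-- Since h^* and h are equimeasurable, restricting to (0, t) just caps the distribution function at
t. The estimates below are read off from this form. -/
theorem rearrIntegral_eq (h : (Fin 2 → A) → ℝ≥0∞) (t : ℝ) :
    rearrIntegral h t = ∫⁻ σ in Ioi (0 : ℝ),
      min (ENNReal.ofReal t) (volume {x | ENNReal.ofReal σ < h x}) := by
  rw [rearrIntegral, lintegral_eq_lintegral_measure_lt measurable_rearrangement]
  refine lintegral_congr fun σ => ?_
  have hm : MeasurableSet {s : ℝ | ENNReal.ofReal σ < rearrangement h (ENNReal.ofReal s)} :=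
    measurableSet_lt measurable_const measurable_rearrangement
  rw [Measure.restrict_apply hm]
  simp_rw [lt_rearrangement_iff]
  rw [← volume_setOf_ofReal_lt (min (ENNReal.ofReal t) (volume {x | ENNReal.ofReal σ < h x}))]
  congr 1
  ext s
  simp only [mem_inter_iff, mem_ofPred_eq, mem_Ioo, mem_Ioi, lt_min_iff]
  constructor
  · rintro ⟨h1, h2, h3⟩
    exact ⟨h2, (ENNReal.ofReal_lt_ofReal_iff (h2.trans h3)).2 h3, h1⟩
  · rintro ⟨h1, h2, h3⟩
    exact ⟨h3, h1, (ENNReal.ofReal_lt_ofReal_iff_of_nonneg h1.le).1 h2⟩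

theorem lintegral_rearrangement [SFinite (volume : Measure (Fin 2 → A))] (hh : Measurable h) :
    ∫⁻ s in Ioi (0 : ℝ), rearrangement h (ENNReal.ofReal s) = ∫⁻ x, h x := by
  rw [lintegral_eq_lintegral_measure_lt hh,
    lintegral_eq_lintegral_measure_lt measurable_rearrangement]
  refine lintegral_congr fun σ => ?_
  have hm : MeasurableSet {s : ℝ | ENNReal.ofReal σ < rearrangement h (ENNReal.ofReal s)} :=
    measurableSet_lt measurable_const measurable_rearrangement
  rw [Measure.restrict_apply hm]
  simp_rw [lt_rearrangement_iff]
  rw [inter_comm]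
  exact volume_setOf_ofReal_lt (volume {x | ENNReal.ofReal σ < h x})

theorem rearrIntegral_le_lintegral [SFinite (volume : Measure (Fin 2 → A))] (hh : Measurable h)
    (t : ℝ) : rearrIntegral h t ≤ ∫⁻ x, h x := by
  rw [← lintegral_rearrangement hh]
  exact lintegral_mono_set fun x hx => hx.1

/-- Hardy-Littlewood: the distribution function of `h` on E is at most both |E| and that of `h`. -/
theorem setLIntegral_le_rearrIntegral [SFinite (volume : Measure (Fin 2 → A))]
    (hh : Measurable h) {E : Set (Fin 2 → A)} {t : ℝ} (hE : volume E ≤ ENNReal.ofReal t) :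
    ∫⁻ x in E, h x ≤ rearrIntegral h t := by
  rw [rearrIntegral_eq, lintegral_eq_lintegral_measure_lt hh]
  refine lintegral_mono fun σ => le_min ?_ (Measure.restrict_apply_le _ _)
  exact (measure_mono (subset_univ _)).trans (by simpa using hE)

theorem rearrIntegral_mul_le {C t : ℝ} (hC : 1 ≤ C) :
    rearrIntegral h (C * t) ≤ ENNReal.ofReal C * rearrIntegral h t := by
  have hC0 : 0 ≤ C := zero_le_one.trans hC
  rw [rearrIntegral_eq, rearrIntegral_eq, ← lintegral_const_mul']
  · refine lintegral_mono fun σ => ?_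
    rw [ENNReal.ofReal_mul hC0]
    rcases le_total (ENNReal.ofReal t) (volume {x | ENNReal.ofReal σ < h x}) with h1 | h1
    · rw [min_eq_left h1]
      exact min_le_left _ _
    · rw [min_eq_right h1]
      refine (min_le_right _ _).trans ?_
      exact le_mul_of_one_le_left zero_le (by simpa using hC)
  · exact ENNReal.ofReal_ne_top

theorem mul_rearrangement_le_rearrIntegral (t : ℝ) :
    ENNReal.ofReal t * rearrangement h (ENNReal.ofReal t) ≤ rearrIntegral h t := by
  have : ∫⁻ _ in Ioo (0 : ℝ) t, rearrangement h (ENNReal.ofReal t) ≤ rearrIntegral h t := by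
    refine setLIntegral_mono measurable_rearrangement fun s hs => ?_
    exact rearrangement_antitone (ENNReal.ofReal_le_ofReal hs.2.le)
  simpa [mul_comm] using this

/-- The easy direction of the K-functional for the couple (L^1, L^∞). -/
theorem rearrIntegral_le_add [SFinite (volume : Measure (Fin 2 → A))] (hg : Measurable g)
    {B : ℝ≥0∞} (hB : ∀ x, h x ≤ g x + B) (t : ℝ) :
    rearrIntegral h t ≤ (∫⁻ x, g x) + ENNReal.ofReal t * B := by
  have h1 : ∀ s, rearrangement h s ≤ rearrangement g s + B := by
    intro s
    rw [rearrangement_le_iff]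
    refine (measure_mono fun x hx => ?_).trans
      (rearrangement_le_iff.1 (le_refl (rearrangement g s)))
    exact lt_of_add_lt_add_right (lt_of_lt_of_le hx (hB x))
  calc rearrIntegral h t ≤ ∫⁻ s in Ioo (0 : ℝ) t, (rearrangement g (ENNReal.ofReal s) + B) :=
        lintegral_mono fun s => h1 _
    _ = rearrIntegral g t + ENNReal.ofReal t * B := by
        rw [lintegral_add_left measurable_rearrangement, rearrIntegral]
        simp [mul_comm]
    _ ≤ _ := by gcongr; exact rearrIntegral_le_lintegral hg t

theorem lintegral_le_of_rearrIntegral_le [SFinite (volume : Measure (Fin 2 → A))]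
    (hh : Measurable h) {M : ℝ≥0∞} (hM : ∀ t, 0 < t → rearrIntegral h t ≤ M) :
    ∫⁻ x, h x ≤ M := by
  rw [← lintegral_rearrangement hh]
  have hU : Ioi (0 : ℝ) = ⋃ n : ℕ, Ioo (0 : ℝ) (n + 1) := by
    ext x
    simp only [mem_Ioi, mem_iUnion, mem_Ioo]
    constructor
    · intro hx
      obtain ⟨n, hn⟩ := exists_nat_gt x
      exact ⟨n, hx, hn.trans (by linarith)⟩
    · rintro ⟨n, hn⟩; exact hn.1
  rw [hU, setLIntegral_iUnion_of_directed]
  · exact iSup_le fun n => hM _ (by positivity)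
  · refine Monotone.directed_le fun m n hmn => Ioo_subset_Ioo_right ?_
    have : (m : ℝ) ≤ n := by exact_mod_cast hmn
    linarith

theorem rearrIntegral_le_rpow [SFinite (volume : Measure (Fin 2 → A))] (hh : Measurable h)
    {q t : ℝ} (hq : 1 < q) :
    rearrIntegral h t ≤ ENNReal.ofReal t ^ (1 - 1 / q) * (∫⁻ x, h x ^ q) ^ (1 / q) := by
  have hq0 : 0 < q := by linarith
  have hpq : (q.conjExponent).HolderConjugate q := (Real.HolderConjugate.conjExponent hq).symm
  have H := ENNReal.lintegral_mul_le_Lp_mul_Lq (volume.restrict (Ioo 0 t)) hpq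
    (f := fun _ => 1) (g := fun s => rearrangement h (ENNReal.ofReal s))
    aemeasurable_const measurable_rearrangement.aemeasurable
  simp only [Pi.mul_apply, one_mul, ENNReal.one_rpow, lintegral_const, Measure.restrict_apply,
    MeasurableSet.univ, univ_inter, Real.volume_Ioo, sub_zero] at H
  refine H.trans ?_
  have e : 1 / q.conjExponent = 1 - 1 / q := by
    have := hpq.inv_add_inv_eq_one
    rw [one_div, one_div]; linarith
  rw [e]
  gcongr
  simp_rw [← rearrangement_rpow hq0]
  exact rearrIntegral_le_lintegral (hh.pow_const q) t

end Rearrangement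

/-! ### Vitali coverings in spaces with uniform ball measure -/

section Covering

variable {X : Type*} [PseudoMetricSpace X] [MeasurableSpace X] {μ : Measure X} {V : ℝ → ℝ≥0∞}

/-- The measure `μ` gives every ball of radius `r` the measure `V r`, and `V` grows at most
quadratically. Either the space is a ball, or the balls have unbounded measure. -/
structure BallRegular (μ : Measure X) (V : ℝ → ℝ≥0∞) : Prop where
  measure_ball : ∀ x r, 0 < r → μ (ball x r) = V r
  doubling : ∀ r, 0 < r → V (2 * r) ≤ 4 * V r
  mono : ∀ r s, 0 < r → r ≤ s → V r ≤ V s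
  pos : ∀ r, 0 < r → V r ≠ 0
  ne_top : ∀ r, 0 < r → V r ≠ ∞
  bounded_or : (∃ R > 0, ∀ x : X, ball x R = univ) ∨ ∀ M : ℝ≥0∞, M ≠ ∞ → ∃ r > 0, M < V r

namespace BallRegular

theorem pow_two_mul (hV : BallRegular μ V) {r : ℝ} (hr : 0 < r) (n : ℕ) :
    V (2 ^ n * r) ≤ 4 ^ n * V r := by
  induction n with
  | zero => simp
  | succ n ih =>
    have := hV.doubling (2 ^ n * r) (by positivity)
    calc V (2 ^ (n + 1) * r) = V (2 * (2 ^ n * r)) := by ring_nf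
      _ ≤ 4 * (4 ^ n * V r) := this.trans (by gcongr)
      _ = _ := by ring

theorem le_pow_mul (hV : BallRegular μ V) {r s : ℝ} (n : ℕ) (hs : 0 < s) (hr : 0 < r)
    (h : s ≤ 2 ^ n * r) : V s ≤ 4 ^ n * V r :=
  (hV.mono _ _ hs h).trans (hV.pow_two_mul hr n)

theorem five_mul_le (hV : BallRegular μ V) {r : ℝ} (hr : 0 < r) : V (5 * r) ≤ 64 * V r := by
  have := hV.le_pow_mul (r := r) (s := 5 * r) 3 (by positivity) hr (by linarith)
  norm_num at this
  exact this

theorem lt_of_lt (hV : BallRegular μ V) {r s : ℝ} (hs : 0 < s) (h : V r < V s) : r < s := by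
  by_contra! hc
  exact absurd (hV.mono s r hs hc) (not_le.2 h)

theorem measure_univ_le (hV : BallRegular μ V) {M : ℝ≥0∞} (h : ∀ r, 0 < r → V r ≤ M) :
    μ univ ≤ M := by
  rcases isEmpty_or_nonempty X with hX | ⟨⟨x⟩⟩
  · simp [univ_eq_empty_iff.2 hX]
  · rw [← iUnion_ball_nat_succ x, Monotone.measure_iUnion]
    · refine iSup_le fun n => ?_
      have hn : (0 : ℝ) < n + 1 := by positivity
      rw [hV.measure_ball x _ hn]
      exact h _ hn
    · intro m n hmn
      refine ball_subset_ball ?_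
      have : (m : ℝ) ≤ n := by exact_mod_cast hmn
      linarith

theorem isUnifLocDoublingMeasure (hV : BallRegular μ V) : IsUnifLocDoublingMeasure μ := by
  refine ⟨16, ?_⟩
  filter_upwards [self_mem_nhdsWithin] with ε hε x
  have hε : 0 < ε := hε
  calc μ (closedBall x (2 * ε)) ≤ μ (ball x (2 ^ 2 * ε)) :=
        measure_mono (closedBall_subset_ball (by linarith))
    _ = V (2 ^ 2 * ε) := hV.measure_ball _ _ (by positivity)
    _ ≤ 4 ^ 2 * V ε := hV.pow_two_mul hε 2
    _ = 4 ^ 2 * μ (ball x ε) := by rw [hV.measure_ball _ _ hε]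
    _ ≤ (16 : ℝ≥0) * μ (closedBall x ε) := by
        norm_num
        gcongr
        exact ball_subset_closedBall

theorem isLocallyFiniteMeasure (hV : BallRegular μ V) : IsLocallyFiniteMeasure μ :=
  ⟨fun x => ⟨ball x 1, ball_mem_nhds x one_pos, by
    rw [hV.measure_ball x 1 one_pos]; exact (hV.ne_top 1 one_pos).lt_top⟩⟩

variable [BorelSpace X] [SecondCountableTopology X]

/-- By Lebesgue density, G fills more than half of small closed balls about almost all of its
points. Passing to the open ball of twice the radius costs the doubling factor 4, whence 8. -/
theorem ae_exists_density (hV : BallRegular μ V) (G : Set X) :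
    ∀ᵐ x ∂μ.restrict G, ∃ r > 0, V r ≤ 8 * μ (G ∩ ball x r) := by
  have := hV.isUnifLocDoublingMeasure
  have := hV.isLocallyFiniteMeasure
  filter_upwards [IsUnifLocDoublingMeasure.ae_tendsto_measure_inter_div μ G 1] with x hx
  have ht := hx (ι := ℝ) (l := 𝓝[>] 0) (fun _ => x) (fun δ => δ) tendsto_id (by
    filter_upwards [self_mem_nhdsWithin] with δ hδ
    have hδ : 0 < δ := hδ
    exact mem_closedBall_self (by linarith))
  have hlt : (2⁻¹ : ℝ≥0∞) < 1 := by norm_num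
  obtain ⟨δ, hδ, hδ0⟩ := ((ht.eventually (lt_mem_nhds hlt)).and self_mem_nhdsWithin).exists
  have hδ0 : 0 < δ := hδ0
  refine ⟨2 * δ, by linarith, ?_⟩
  have hsub : closedBall x δ ⊆ ball x (2 * δ) := closedBall_subset_ball (by linarith)
  have hcpos : V δ ≤ μ (closedBall x δ) := by
    rw [← hV.measure_ball x δ hδ0]
    exact measure_mono ball_subset_closedBall
  have h0 : μ (closedBall x δ) ≠ 0 := fun h => hV.pos δ hδ0 (by simpa [h] using hcpos)
  have htop : μ (closedBall x δ) ≠ ∞ := by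
    refine ne_top_of_le_ne_top (hV.ne_top (2 * δ) (by linarith)) ?_
    rw [← hV.measure_ball x (2 * δ) (by linarith)]
    exact measure_mono hsub
  have h1 : 2⁻¹ * μ (closedBall x δ) ≤ μ (G ∩ closedBall x δ) :=
    (ENNReal.le_div_iff_mul_le (Or.inl h0) (Or.inl htop)).1 hδ.le
  calc V (2 * δ) ≤ 4 * V δ := hV.doubling δ hδ0
    _ ≤ 8 * (2⁻¹ * μ (closedBall x δ)) := by
        rw [← mul_assoc]
        have : (8 * 2⁻¹ : ℝ≥0∞) = 4 := by
          rw [show (8 : ℝ≥0∞) = 4 * 2 by norm_num, mul_assoc,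
            ENNReal.mul_inv_cancel (by norm_num) (by norm_num), mul_one]
        rw [this]
        gcongr
    _ ≤ 8 * μ (G ∩ ball x (2 * δ)) := by
        gcongr
        exact h1.trans (measure_mono (inter_subset_inter_right _ hsub))

/-- If `G` has density at least `1 / 8` in disjoint balls whose dilations cover `F`, the measure
of `F` is controlled by its measure in balls where the density of `G` is small. -/
theorem measure_le_of_stopping (hV : BallRegular μ V) {ν : Measure X} (hν : ν ≪ μ) {F G : Set X}
    (hG : MeasurableSet G) (hFG : F ⊆ G) {r₀ : ℝ} (hr₀ : 0 < r₀) (hGr : 8 * μ G < V r₀)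
    {κ : ℝ≥0∞}
    (h : ∀ x ∈ F, ∀ r, 0 < r → V r ≤ 8 * μ G → 8 * μ (G ∩ ball x (5 * r)) < V (5 * r) →
      ν (F ∩ ball x (5 * r)) ≤ κ * V (5 * r)) :
    ν F ≤ κ * (512 * μ G) := by
  set F' : Set X := {x ∈ F | ∃ r > 0, V r ≤ 8 * μ (G ∩ ball x r)} with hF'
  have hnull : ν (F \ F') = 0 := by
    refine hν ?_
    have := (ae_restrict_iff' hG).1 (hV.ae_exists_density G)
    refine measure_mono_null (fun x hx => ?_) this
    intro hc
    exact hx.2 ⟨hx.1, hc (hFG hx.1)⟩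
  have hchoice : ∀ x ∈ F', ∃ r, 0 < r ∧ r ≤ r₀ ∧ V r ≤ 8 * μ (G ∩ ball x r) ∧
      8 * μ (G ∩ ball x (5 * r)) < V (5 * r) := by
    rintro x ⟨hxF, hx⟩
    -- The radii of density at least 1/8 are bounded by r₀, since 8 |G| < V r₀. Any r in S above
    -- half the supremum has 5 r beyond the supremum, so the density of G is small in the ball of
    -- radius 5 r. This replaces maximal dyadic cubes.
    set S : Set ℝ := {r | 0 < r ∧ V r ≤ 8 * μ (G ∩ ball x r)} with hS
    have hSne : S.Nonempty := hx
    have hSb : ∀ r ∈ S, r < r₀ := by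
      intro r hr
      refine hV.lt_of_lt hr₀ (lt_of_le_of_lt (hr.2.trans ?_) hGr)
      gcongr
      exact inter_subset_left
    have hbdd : BddAbove S := ⟨r₀, fun r hr => (hSb r hr).le⟩
    obtain ⟨r1, hr1⟩ := hSne
    have hsup : 0 < sSup S := hr1.1.trans_le (le_csSup hbdd hr1)
    obtain ⟨r, hrS, hr⟩ := exists_lt_of_lt_csSup ⟨r1, hr1⟩ (half_lt_self hsup)
    refine ⟨r, hrS.1, (hSb r hrS).le, hrS.2, ?_⟩
    by_contra! hc
    have : 5 * r ≤ sSup S := le_csSup hbdd ⟨by linarith [hrS.1], hc⟩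
    linarith [hrS.1]
  choose! ρ hρ0 hρr hρV hρG using hchoice
  -- The disjoint balls have total measure at most 8 |G| and the enlargement by 5 costs a factor 64,
  -- so 512 = 64 * 8.
  obtain ⟨u, huF, hudisj, hucov⟩ := Vitali.exists_disjoint_subfamily_covering_enlargement_ball F'
    (fun x => x) ρ r₀ hρr 5 (by norm_num)
  have hucount : u.Countable := hudisj.countable_of_isOpen (fun _ _ => isOpen_ball)
    (fun a ha => ⟨a, mem_ball_self (hρ0 a (huF ha))⟩)
  have hcov : F' ⊆ ⋃ b ∈ u, F ∩ ball b (5 * ρ b) := by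
    intro x hx
    obtain ⟨b, hb, hsub⟩ := hucov x hx
    exact mem_iUnion₂.2 ⟨b, hb, hx.1, hsub (mem_ball_self (hρ0 x hx))⟩
  have hsum : ∑' b : u, V (ρ b) ≤ 8 * μ G := by
    calc ∑' b : u, V (ρ b) ≤ ∑' b : u, 8 * μ (G ∩ ball (b : X) (ρ b)) :=
          ENNReal.tsum_le_tsum fun b => hρV b (huF b.2)
      _ = 8 * ∑' b : u, μ (G ∩ ball (b : X) (ρ b)) := ENNReal.tsum_mul_left
      _ = 8 * μ (⋃ b ∈ u, G ∩ ball b (ρ b)) := by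
          rw [measure_biUnion hucount _ fun b _ => hG.inter measurableSet_ball]
          exact hudisj.mono fun b => inter_subset_right
      _ ≤ 8 * μ G := by
          gcongr
          exact iUnion₂_subset fun b _ => inter_subset_left
  calc ν F ≤ ν F' + ν (F \ F') := by
        refine (measure_mono ?_).trans (measure_union_le _ _)
        intro x hx
        by_cases hx' : x ∈ F'
        · exact Or.inl hx'
        · exact Or.inr ⟨hx, hx'⟩
    _ = ν F' := by rw [hnull, add_zero]
    _ ≤ ∑' b : u, ν (F ∩ ball (b : X) (5 * ρ b)) :=
        (measure_mono hcov).trans (measure_biUnion_le ν hucount _)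
    _ ≤ ∑' b : u, κ * (64 * V (ρ b)) := by
        refine ENNReal.tsum_le_tsum fun b => ?_
        have hb := huF b.2
        refine (h b hb.1 (ρ b) (hρ0 b hb) ?_ (hρG b hb)).trans ?_
        · refine (hρV b hb).trans ?_
          gcongr
          exact inter_subset_left
        · gcongr
          exact hV.five_mul_le (hρ0 b hb)
    _ = κ * (64 * ∑' b : u, V (ρ b)) := by rw [ENNReal.tsum_mul_left, ENNReal.tsum_mul_left]
    _ ≤ κ * (64 * (8 * μ G)) := by gcongr
    _ = κ * (512 * μ G) := by rw [← mul_assoc 64 8]; norm_num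

/-- Weak type estimate for the maximal function of an indicator. -/
theorem mul_measure_exists_ball_le (hV : BallRegular μ V) {G : Set X} (hG : MeasurableSet G)
    (γ : ℝ≥0∞) :
    γ * μ {x | ∃ z r, 0 < r ∧ x ∈ ball z r ∧ γ * V r ≤ μ (G ∩ ball z r)} ≤ 64 * μ G := by
  -- The covering lemma needs bounded radii. If no such r₀ exists, every ball, hence the whole
  -- space, has measure at most |G| / γ and the estimate is trivial.
  by_cases hcase : ∃ r₀ > 0, μ G < γ * V r₀
  · obtain ⟨r₀, hr₀, hGr⟩ := hcase
    set T : Set (X × ℝ) := {q | 0 < q.2 ∧ γ * V q.2 ≤ μ (G ∩ ball q.1 q.2)} with hT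
    have hTr : ∀ q ∈ T, q.2 ≤ r₀ := by
      intro q hq
      by_contra! hc
      refine absurd (hq.2.trans (measure_mono inter_subset_left)) (not_le.2 (hGr.trans_le ?_))
      gcongr
      exact hV.mono _ _ hr₀ hc.le
    obtain ⟨u, huT, hudisj, hucov⟩ :=
      Vitali.exists_disjoint_subfamily_covering_enlargement_ball T
        (fun q => q.1) (fun q => q.2) r₀ hTr 5 (by norm_num)
    have hucount : u.Countable := hudisj.countable_of_isOpen (fun _ _ => isOpen_ball)
      (fun a ha => ⟨a.1, mem_ball_self (huT ha).1⟩)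
    have hcov : {x | ∃ z r, 0 < r ∧ x ∈ ball z r ∧ γ * V r ≤ μ (G ∩ ball z r)} ⊆
        ⋃ q ∈ u, ball q.1 (5 * q.2) := by
      rintro x ⟨z, r, hr, hx, hle⟩
      obtain ⟨b, hb, hsub⟩ := hucov (z, r) ⟨hr, hle⟩
      exact mem_iUnion₂.2 ⟨b, hb, hsub hx⟩
    calc γ * μ {x | ∃ z r, 0 < r ∧ x ∈ ball z r ∧ γ * V r ≤ μ (G ∩ ball z r)}
        ≤ γ * ∑' q : u, μ (ball (q : X × ℝ).1 (5 * (q : X × ℝ).2)) := by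
          gcongr
          exact (measure_mono hcov).trans (measure_biUnion_le μ hucount _)
      _ ≤ γ * ∑' q : u, 64 * V (q : X × ℝ).2 := by
          gcongr with q
          have hq := (huT q.2).1
          rw [hV.measure_ball _ _ (by positivity)]
          exact hV.five_mul_le hq
      _ = 64 * ∑' q : u, γ * V (q : X × ℝ).2 := by
          rw [ENNReal.tsum_mul_left, ENNReal.tsum_mul_left]
          ring
      _ ≤ 64 * ∑' q : u, μ (G ∩ ball (q : X × ℝ).1 (q : X × ℝ).2) := by
          gcongr with q
          exact (huT q.2).2
      _ = 64 * μ (⋃ q ∈ u, G ∩ ball q.1 q.2) := by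
          rw [measure_biUnion hucount _ fun b _ => hG.inter measurableSet_ball]
          exact hudisj.mono fun b => inter_subset_right
      _ ≤ 64 * μ G := by
          gcongr
          exact iUnion₂_subset fun b _ => inter_subset_left
  · push Not at hcase
    rcases eq_or_ne γ 0 with rfl | h0
    · simp
    rcases eq_or_ne γ ∞ with rfl | htop
    · have h1 : ∞ ≤ μ G := by
        have := hcase 1 one_pos
        rwa [ENNReal.top_mul (hV.pos 1 one_pos)] at this
      rw [top_le_iff.1 h1]
      simp
    have h1 : μ univ ≤ μ G / γ := hV.measure_univ_le fun r hr => by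
      rw [ENNReal.le_div_iff_mul_le (Or.inl h0) (Or.inl htop), mul_comm]
      exact hcase r hr
    calc _ ≤ γ * (μ G / γ) := by
          gcongr
          exact (measure_mono (subset_univ _)).trans h1
      _ = μ G := ENNReal.mul_div_cancel h0 htop
      _ ≤ 64 * μ G := le_mul_of_one_le_left zero_le (by norm_num)

end BallRegular

end Covering

/-! ### Good-λ inequality and the Fefferman-Stein estimate -/

section Oscillation


variable {X : Type*} [MeasurableSpace X] {μ : Measure X} {V : ℝ → ℝ≥0∞}

/-- Two exceptional sets of total proportion below one leave a common good point. This is the device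
by which values and near-constants are compared throughout. -/
theorem exists_mem_notMem_of_measure_le {a b v : ℝ≥0∞} (hv : v ≠ 0) (hv' : v ≠ ∞)
    (hab : a + b < 1) {B S T : Set X} (hB : μ B = v) (hS : μ S ≤ a * v) (hT : μ T ≤ b * v) :
    ∃ y ∈ B, y ∉ S ∧ y ∉ T := by
  by_contra! hc
  have hsub : B ⊆ S ∪ T := fun y hy => by
    by_cases h : y ∈ S
    · exact Or.inl h
    · exact Or.inr (hc y hy h)
  have h1 : v ≤ (a + b) * v := by
    rw [add_mul, ← hB]
    refine (measure_mono hsub).trans ((measure_union_le _ _).trans ?_)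
    rw [hB]
    exact add_le_add hS hT
  have h2 : (a + b) * v < 1 * v := ENNReal.mul_lt_mul_left hv hv' hab
  rw [one_mul] at h2
  exact absurd h1 (not_le.2 h2)

variable [PseudoMetricSpace X]

/-- Up to a set of proportion `α`, the function `f` stays within distance `s` of some constant on
the ball. -/
def OscLE (μ : Measure X) (α : ℝ≥0∞) (s : ℝ) (f : X → ℝ) (z : X) (r : ℝ) : Prop :=
  ∃ c : ℝ, μ {y | y ∈ ball z r ∧ s < |f y - c|} ≤ α * μ (ball z r)

namespace BallRegular

variable [SecondCountableTopology X]

theorem sigmaFinite (hV : BallRegular μ V) : SigmaFinite μ := by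
  have := hV.isLocallyFiniteMeasure
  infer_instance

variable [BorelSpace X]

/-- In a stopping ball, {|g| > s} has density below 1/8 and g stays within 2 ε s of some c off a
proportion α, so a common good point gives |c| ≤ s + 2 ε s. Hence |g| > (1 + 4 ε) s forces |g - c| >
2 ε s, which happens only on a proportion α. The small factor comes from α, not from ε. Either the
level set is small enough for the stopping argument, or M ≥ s everywhere and there is nothing to
prove. -/
theorem goodLambda (hV : BallRegular μ V) {α : ℝ≥0∞} (hα : α ≤ 2⁻¹) {g : X → ℝ}
    (hg : Measurable g) {M : X → ℝ≥0∞}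
    (hM : ∀ x s, 0 < s → M x ≤ ENNReal.ofReal s → ∀ z r, 0 < r → x ∈ ball z r →
      OscLE μ α (2 * s) g z r) {s ε : ℝ} (hs : 0 < s) (hε : 0 < ε) (hε1 : ε < 1)
    (hsmall : (∃ r₀ > 0, 8 * μ {x | s < |g x|} < V r₀) ∨ ∀ x, ENNReal.ofReal s ≤ M x) :
    μ {x | (1 + 4 * ε) * s < |g x|} ≤
      μ {x | ENNReal.ofReal (ε * s) < M x} + 512 * α * μ {x | s < |g x|} := by
  have hεs : 0 < ε * s := mul_pos hε hs
  rcases hsmall with ⟨r₀, hr₀, hr⟩ | hbig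
  · set G : Set X := {x | s < |g x|} with hG
    have hGm : MeasurableSet G := measurableSet_lt measurable_const hg.abs
    set F : Set X := {x | (1 + 4 * ε) * s < |g x| ∧ M x ≤ ENNReal.ofReal (ε * s)} with hF
    have hFG : F ⊆ G := fun x hx => by
      have := hx.1
      change s < |g x|
      nlinarith
    have key : μ F ≤ α * (512 * μ G) := by
      refine hV.measure_le_of_stopping Measure.AbsolutelyContinuous.rfl hGm hFG hr₀ hr ?_
      intro x hx ρ hρ _ hρG
      have h5 : 0 < 5 * ρ := by linarith
      obtain ⟨c, hc⟩ := hM x (ε * s) hεs hx.2 x (5 * ρ) h5 (mem_ball_self h5)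
      rw [hV.measure_ball x _ h5] at hc
      have hG' : μ (G ∩ ball x (5 * ρ)) ≤ 8⁻¹ * V (5 * ρ) := by
        rw [mul_comm 8⁻¹, ← div_eq_mul_inv, ENNReal.le_div_iff_mul_le (by simp) (by simp),
          mul_comm _ 8]
        exact hρG.le
      have hlt : (8⁻¹ : ℝ≥0∞) + α < 1 := by
        refine (add_le_add le_rfl hα).trans_lt ?_
        rw [← ENNReal.toReal_lt_toReal (by simp) (by simp), ENNReal.toReal_add (by simp) (by simp)]
        norm_num
      obtain ⟨y, hyB, hyG, hyc⟩ := exists_mem_notMem_of_measure_le (hV.pos _ h5) (hV.ne_top _ h5)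
        hlt (hV.measure_ball x _ h5) hG' hc
      have hy1 : |g y| ≤ s := by
        by_contra! h
        exact hyG ⟨h, hyB⟩
      have hy2 : |g y - c| ≤ 2 * (ε * s) := by
        by_contra! h
        exact hyc ⟨hyB, h⟩
      refine (measure_mono ?_).trans hc
      rintro w ⟨hwF, hwB⟩
      refine ⟨hwB, ?_⟩
      have h1 := hwF.1
      have h2 : |g w| ≤ |g w - c| + |g y - c| + |g y| := by
        have e : g w = (g w - c) - (g y - c) + g y := by ring
        calc |g w| = |(g w - c) - (g y - c) + g y| := by rw [← e]
          _ ≤ |(g w - c) - (g y - c)| + |g y| := abs_add_le _ _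
          _ ≤ _ := by gcongr; exact abs_sub _ _
      linarith
    calc μ {x | (1 + 4 * ε) * s < |g x|} ≤ μ ({x | ENNReal.ofReal (ε * s) < M x} ∪ F) := by
          refine measure_mono fun x hx => ?_
          by_cases h : ENNReal.ofReal (ε * s) < M x
          · exact Or.inl h
          · exact Or.inr ⟨hx, not_lt.1 h⟩
      _ ≤ _ := (measure_union_le _ _).trans (by
          gcongr
          exact key.trans_eq (by ring))
  · refine le_trans (measure_mono fun x _ => ?_) le_self_add
    refine lt_of_lt_of_le ?_ (hbig x)
    rw [ENNReal.ofReal_lt_ofReal_iff hs]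
    nlinarith

theorem rpow_lt_aux {p σ : ℝ} (hp : 0 < p) (hσ : 0 < σ) (b : ℝ≥0∞) :
    ENNReal.ofReal σ < b ^ p ↔ ENNReal.ofReal (σ ^ (1 / p)) < b := by
  rw [← ENNReal.rpow_lt_rpow_iff (x := ENNReal.ofReal (σ ^ (1 / p))) hp,
    ENNReal.ofReal_rpow_of_nonneg (by positivity) hp.le, ← Real.rpow_mul hσ.le, one_div,
    inv_mul_cancel₀ hp.ne', Real.rpow_one]

/-- A global Fefferman-Stein inequality for functions supported in a set of finite measure. -/
theorem exists_lintegral_rpow_le (hV : BallRegular μ V) {p : ℝ} (hp : 1 ≤ p) :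
    ∃ C : ℝ≥0, ∀ α : ℝ≥0∞, 2048 * α ≤ 1 → ∀ g : X → ℝ, Measurable g → ∀ M : X → ℝ≥0∞,
      Measurable M →
      (∀ x s, 0 < s → M x ≤ ENNReal.ofReal s → ∀ z r, 0 < r → x ∈ ball z r →
        OscLE μ α (2 * s) g z r) →
      (∀ s, 0 < s → (∃ r₀ > 0, 8 * μ {x | s < |g x|} < V r₀) ∨ ∀ x, ENNReal.ofReal s ≤ M x) →
      μ {x | g x ≠ 0} ≠ ∞ →
      ∫⁻ x, ‖g x‖ₑ ^ p ∂μ ≤ C * ∫⁻ x, M x ^ p ∂μ := by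
  have hp0 : 0 < p := by linarith
  have hsf := hV.sigmaFinite
  -- With 1 + 4 ε = a and a^p = 2, rescaling the level loses only a factor 2 in the integral, while
  -- 512 α ≤ 1/4; the last term of the good-λ inequality can therefore be absorbed. The constant
  -- depends on p but not on α.
  set a : ℝ := 2 ^ (1 / p) with ha
  have ha1 : 1 < a := Real.one_lt_rpow one_lt_two (by positivity)
  have ha2 : a ≤ 2 := by
    calc a ≤ (2 : ℝ) ^ (1 : ℝ) :=
          Real.rpow_le_rpow_of_exponent_le one_le_two (by rw [div_le_one hp0]; exact hp)
      _ = 2 := Real.rpow_one 2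
  have hap : a ^ p = 2 := by
    rw [ha, ← Real.rpow_mul zero_le_two, one_div, inv_mul_cancel₀ hp0.ne', Real.rpow_one]
  set ε : ℝ := (a - 1) / 4 with hε
  have hε0 : 0 < ε := by rw [hε]; linarith
  have hε1 : ε < 1 := by rw [hε]; linarith
  have haε : 1 + 4 * ε = a := by rw [hε]; ring
  refine ⟨4 * ((ε ^ p)⁻¹).toNNReal, ?_⟩
  intro α hα g hg M hMm hM hsmall hfin
  have hα2 : α ≤ 2⁻¹ := by
    rw [ENNReal.le_inv_iff_mul_le, mul_comm]
    exact le_trans (by gcongr; norm_num) hα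
  have hα4 : 512 * α ≤ 4⁻¹ := by
    rw [ENNReal.le_inv_iff_mul_le]
    calc 512 * α * 4 = 2048 * α := by ring
      _ ≤ 1 := hα
  -- Truncation at N together with the support of finite measure makes the integral finite, so that
  -- it can be subtracted; N tends to infinity at the end.
  have hN : ∀ N : ℕ, ∫⁻ x, (min ‖g x‖ₑ (N : ℝ≥0∞)) ^ p ∂μ ≤
      (4 * ((ε ^ p)⁻¹).toNNReal : ℝ≥0) * ∫⁻ x, M x ^ p ∂μ := by
    intro N
    set h : X → ℝ≥0∞ := fun x => min ‖g x‖ₑ (N : ℝ≥0∞) with hh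
    have hhm : Measurable h := hg.enorm.min measurable_const
    have hdist : ∀ σ : ℝ, σ ∈ Ioi (0 : ℝ) →
        μ {x | ENNReal.ofReal σ < (ENNReal.ofReal a⁻¹ * h x) ^ p} ≤
        μ {x | ENNReal.ofReal σ < (ENNReal.ofReal ε⁻¹ * M x) ^ p} +
          512 * α * μ {x | ENNReal.ofReal σ < h x ^ p} := by
      intro σ hσ
      have hσ : 0 < σ := hσ
      simp_rw [rpow_lt_aux hp0 hσ]
      set s : ℝ := σ ^ (1 / p) with hs
      have hs0 : 0 < s := Real.rpow_pos_of_pos hσ _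
      have hdiv : ∀ (k : ℝ), 0 < k → ∀ b : ℝ≥0∞,
          ENNReal.ofReal s < ENNReal.ofReal k⁻¹ * b ↔ ENNReal.ofReal (k * s) < b := by
        intro k hk b
        rw [ENNReal.ofReal_inv_of_pos hk, mul_comm, ← div_eq_mul_inv,
          ENNReal.lt_div_iff_mul_lt (Or.inl (by simpa using hk)) (Or.inl (by simp)),
          ENNReal.ofReal_mul hk.le, mul_comm]
      simp_rw [hdiv a (by linarith), hdiv ε hε0]
      have hnorm : ∀ x, ‖g x‖ₑ = ENNReal.ofReal |g x| := fun x => by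
        rw [Real.enorm_eq_ofReal_abs]
      by_cases hNs : (N : ℝ≥0∞) ≤ ENNReal.ofReal (a * s)
      · have : {x | ENNReal.ofReal (a * s) < h x} = ∅ := by
          ext x
          simp only [mem_ofPred_eq, mem_empty_iff_false, iff_false, not_lt]
          exact (min_le_right _ _).trans hNs
        rw [this]
        simp
      · push Not at hNs
        have h1 : {x | ENNReal.ofReal (a * s) < h x} ⊆ {x | (1 + 4 * ε) * s < |g x|} := by
          intro x hx
          have : ENNReal.ofReal (a * s) < ENNReal.ofReal |g x| := by
            rw [← hnorm]
            exact lt_of_lt_of_le hx (min_le_left _ _)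
          rw [haε]
          exact (ENNReal.ofReal_lt_ofReal_iff_of_nonneg (by positivity)).1 this
        have h2 : {x | s < |g x|} ⊆ {x | ENNReal.ofReal s < h x} := by
          intro x hx
          refine lt_min ?_ (lt_of_le_of_lt (ENNReal.ofReal_le_ofReal ?_) hNs)
          · rw [hnorm]
            exact (ENNReal.ofReal_lt_ofReal_iff_of_nonneg hs0.le).2 hx
          · nlinarith
        refine (measure_mono h1).trans ((hV.goodLambda hα2 hg hM hs0 hε0 hε1 (hsmall s hs0)).trans ?_)
        gcongr
    have hint : ∫⁻ x, (ENNReal.ofReal a⁻¹ * h x) ^ p ∂μ ≤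
        ∫⁻ x, (ENNReal.ofReal ε⁻¹ * M x) ^ p ∂μ + 512 * α * ∫⁻ x, h x ^ p ∂μ := by
      rw [lintegral_eq_lintegral_measure_lt (hhm.pow_const p),
        lintegral_eq_lintegral_measure_lt ((hhm.const_mul _).pow_const p),
        lintegral_eq_lintegral_measure_lt ((hMm.const_mul _).pow_const p),
        ← lintegral_const_mul _ (measurable_measure_lt _),
        ← lintegral_add_left (measurable_measure_lt _)]
      exact setLIntegral_mono' measurableSet_Ioi hdist
    have hfinh : ∫⁻ x, h x ^ p ∂μ ≠ ∞ := by
      have hms : MeasurableSet {x | g x ≠ 0} := hg (measurableSet_singleton 0).compl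
      have hle : ∀ x, h x ^ p ≤ {x | g x ≠ 0}.indicator (fun _ => (N : ℝ≥0∞) ^ p) x := by
        intro x
        by_cases hx : g x = 0
        · have : h x = 0 := by simp [hh, hx]
          rw [this, ENNReal.zero_rpow_of_pos hp0]
          exact zero_le
        · rw [indicator_of_mem (show x ∈ {x | g x ≠ 0} from hx)]
          exact ENNReal.rpow_le_rpow (min_le_right _ _) hp0.le
      refine ne_top_of_le_ne_top ?_ (lintegral_mono hle)
      rw [lintegral_indicator hms, setLIntegral_const]
      exact ENNReal.mul_ne_top (ENNReal.rpow_ne_top_of_nonneg hp0.le (by simp)) hfin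
    have hI : ∀ (k : ℝ) (f : X → ℝ≥0∞), 0 < k → Measurable f →
        ∫⁻ x, (ENNReal.ofReal k⁻¹ * f x) ^ p ∂μ =
          ENNReal.ofReal ((k ^ p)⁻¹) * ∫⁻ x, f x ^ p ∂μ := by
      intro k f hk hf
      rw [← lintegral_const_mul _ (hf.pow_const p)]
      refine lintegral_congr fun x => ?_
      rw [ENNReal.mul_rpow_of_nonneg _ _ hp0.le,
        ENNReal.ofReal_rpow_of_nonneg (by positivity) hp0.le, Real.inv_rpow hk.le]
    rw [hI a h (by linarith) hhm, hI ε M hε0 hMm, hap] at hint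
    set I := ∫⁻ x, h x ^ p ∂μ with hIdef
    set K := ENNReal.ofReal ((ε ^ p)⁻¹) * ∫⁻ x, M x ^ p ∂μ with hK
    have hI4 : 4⁻¹ * I ≤ K := by
      have h2 : ENNReal.ofReal 2⁻¹ * I = 4⁻¹ * I + 4⁻¹ * I := by
        rw [← add_mul]
        congr 1
        rw [ENNReal.ofReal_inv_of_pos two_pos, ← ENNReal.toReal_eq_toReal_iff' (by simp) (by simp),
          ENNReal.toReal_add (by simp) (by simp)]
        norm_num
      have h3 : 4⁻¹ * I + 4⁻¹ * I ≤ K + 4⁻¹ * I := by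
        rw [← h2]
        refine hint.trans ?_
        gcongr
      exact (ENNReal.add_le_add_iff_right (ENNReal.mul_ne_top (by simp) hfinh)).1 h3
    calc I = 4 * (4⁻¹ * I) := by
          rw [← mul_assoc, ENNReal.mul_inv_cancel (by simp) (by simp), one_mul]
      _ ≤ 4 * K := by gcongr
      _ = _ := by
          rw [hK, ENNReal.coe_mul, mul_assoc]
          rfl
  have hlim : Tendsto (fun N : ℕ => ∫⁻ x, (min ‖g x‖ₑ (N : ℝ≥0∞)) ^ p ∂μ) atTop
      (𝓝 (∫⁻ x, ‖g x‖ₑ ^ p ∂μ)) := by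
    refine lintegral_tendsto_of_tendsto_of_monotone ?_ ?_ ?_
    · intro N
      exact ((hg.enorm.min measurable_const).pow_const p).aemeasurable
    · refine ae_of_all _ fun x m n hmn => ?_
      have : (m : ℝ≥0∞) ≤ n := by exact_mod_cast hmn
      exact ENNReal.rpow_le_rpow (min_le_min le_rfl this) hp0.le
    · refine ae_of_all _ fun x => ?_
      obtain ⟨n, hn⟩ := ENNReal.exists_nat_gt (enorm_ne_top (x := g x))
      refine tendsto_const_nhds.congr' ?_
      filter_upwards [eventually_ge_atTop n] with m hm
      have : (n : ℝ≥0∞) ≤ m := by exact_mod_cast hm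
      rw [min_eq_left (hn.le.trans this)]
  exact le_of_tendsto' hlim hN

end BallRegular

end Oscillation

/-! ### John-Strömberg inequality -/

section JohnStromberg

variable {X : Type*} [PseudoMetricSpace X] [MeasurableSpace X] {μ : Measure X} {V : ℝ → ℝ≥0∞}

theorem measure_lt_abs_sub_le [BorelSpace X] {f : X → ℝ} (hf : Measurable f) {B : Set X} {a c : ℝ}
    (ha : 0 < a) {v : ℝ≥0∞} (h : ∫⁻ y in B, ‖f y - c‖ₑ ∂μ ≤ ENNReal.ofReal a * v)
    (hB : MeasurableSet B) {k : ℝ} (hk : 0 < k) :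
    μ {y | y ∈ B ∧ k * a < |f y - c|} ≤ (ENNReal.ofReal k)⁻¹ * v := by
  have h1 := mul_meas_ge_le_lintegral (μ := μ.restrict B) (f := fun y => ‖f y - c‖ₑ)
    (hf.sub_const c).enorm (ENNReal.ofReal (k * a))
  have hsub : {y | y ∈ B ∧ k * a < |f y - c|} ⊆
      {y | ENNReal.ofReal (k * a) ≤ ‖f y - c‖ₑ} ∩ B := by
    rintro y ⟨hyB, hy⟩
    refine ⟨?_, hyB⟩
    change ENNReal.ofReal (k * a) ≤ ‖f y - c‖ₑ
    rw [Real.enorm_eq_ofReal_abs]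
    exact ENNReal.ofReal_le_ofReal hy.le
  rw [Measure.restrict_apply' hB] at h1
  have h2 : ENNReal.ofReal a * (ENNReal.ofReal k * μ {y | y ∈ B ∧ k * a < |f y - c|}) ≤
      ENNReal.ofReal a * v := by
    calc _ = ENNReal.ofReal (k * a) * μ {y | y ∈ B ∧ k * a < |f y - c|} := by
          rw [ENNReal.ofReal_mul hk.le]; ring
      _ ≤ _ := (mul_le_mul_right (measure_mono hsub) _).trans (h1.trans h)
  have h3 := (ENNReal.mul_le_mul_iff_right (by simpa using ha) (by simp)).1 h2
  rw [mul_comm _ v, ← div_eq_mul_inv, ENNReal.le_div_iff_mul_le (Or.inl (by simpa using hk))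
    (Or.inl (by simp)), mul_comm _ (ENNReal.ofReal k)]
  exact h3

namespace BallRegular

variable [BorelSpace X] [SecondCountableTopology X]

/-- One step of a bootstrap: a uniform bound a for the mean oscillation improves to l + (5 a + l) /
16. Off the set G where |f - c| > l the integrand is at most l. The rest is covered by stopping
balls, where a common good point puts the near-mean c' within 4 a + l of c, so |f - c| has average
at most 5 a + l. Their total measure is at most 512 |G| ≤ V r / 16, which is where 2^19 α ≤ 1 is
used. The dilation by 8 keeps all stopping balls inside the ball on which c is controlled. -/
theorem meanOsc_step (hV : BallRegular μ V) {α : ℝ≥0∞} (hα : 2 ^ 19 * α ≤ 1) {f : X → ℝ}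
    (hf : Measurable f) {l a : ℝ} (hl : 0 < l) (ha : 0 < a)
    (hP : ∀ z r, 0 < r → ∃ c, ∫⁻ y in ball z r, ‖f y - c‖ₑ ∂μ ≤ ENNReal.ofReal a * V r)
    {z : X} {r c : ℝ} (hr : 0 < r)
    (hc : μ {y | y ∈ ball z (8 * r) ∧ l < |f y - c|} ≤ α * V (8 * r)) :
    ∫⁻ y in ball z r, ‖f y - c‖ₑ ∂μ ≤ ENNReal.ofReal (l + (5 * a + l) / 16) * V r := by
  -- The stopping estimate is applied to the measure |f - c| dμ rather than to μ.
  set φ : X → ℝ≥0∞ := fun y => ‖f y - c‖ₑ with hφ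
  have hφm : Measurable φ := (hf.sub_const c).enorm
  set ν := μ.withDensity φ with hν
  set G : Set X := {y | y ∈ ball z (8 * r) ∧ l < |f y - c|} with hG
  have hlm : MeasurableSet {y | l < |f y - c|} :=
    measurableSet_lt measurable_const (hf.sub_const c).abs
  have hGm : MeasurableSet G := measurableSet_ball.inter hlm
  have hV8 : V (8 * r) ≤ 64 * V r := by
    have := hV.pow_two_mul hr 3
    norm_num at this
    exact this
  have hμG : μ G ≤ 64 * α * V r := by
    refine hc.trans ?_
    calc α * V (8 * r) ≤ α * (64 * V r) := by gcongr
      _ = _ := by ring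
  have h8 : 8 * μ G < V r := by
    calc 8 * μ G ≤ 8 * (64 * α * V r) := by gcongr
      _ = (512 * α) * V r := by ring
      _ < 1 * V r := by
        refine ENNReal.mul_lt_mul_left (hV.pos r hr) (hV.ne_top r hr) ?_
        have hα0 : α ≠ ∞ := by
          rintro rfl
          norm_num at hα
        by_contra! hge
        have : 1024 * 1 ≤ (1 : ℝ≥0∞) := by
          refine le_trans ?_ hα
          calc 1024 * 1 ≤ 1024 * (512 * α) := by gcongr
            _ = 2 ^ 19 * α := by rw [← mul_assoc]; norm_num
        norm_num at this
      _ = V r := one_mul _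
  set F : Set X := G ∩ ball z r with hF
  have key : ν F ≤ ENNReal.ofReal (5 * a + l) * (512 * μ G) := by
    refine hV.measure_le_of_stopping (withDensity_absolutelyContinuous μ φ) hGm inter_subset_left
      hr h8 ?_
    intro x hx ρ hρ hVρ hρG
    have h5 : 0 < 5 * ρ := by linarith
    have hρr : ρ < r := hV.lt_of_lt hr (hVρ.trans_lt h8)
    have hsub : ball x (5 * ρ) ⊆ ball z (8 * r) := by
      refine ball_subset_ball' ?_
      have : dist x z < r := hx.2
      linarith
    obtain ⟨c', hc'⟩ := hP x (5 * ρ) h5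
    have hcheb := measure_lt_abs_sub_le hf ha hc' measurableSet_ball (k := 4) (by norm_num)
    have hG' : μ (G ∩ ball x (5 * ρ)) ≤ 8⁻¹ * V (5 * ρ) := by
      rw [mul_comm 8⁻¹, ← div_eq_mul_inv, ENNReal.le_div_iff_mul_le (by simp) (by simp),
        mul_comm _ 8]
      exact hρG.le
    have hlt : (8⁻¹ : ℝ≥0∞) + (ENNReal.ofReal 4)⁻¹ < 1 := by
      rw [← ENNReal.toReal_lt_toReal (by simp) (by simp), ENNReal.toReal_add (by simp) (by simp)]
      norm_num
    obtain ⟨y, hyB, hyG, hyc⟩ := exists_mem_notMem_of_measure_le (hV.pos _ h5) (hV.ne_top _ h5)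
      hlt (hV.measure_ball x _ h5) hG' hcheb
    have hy1 : |f y - c| ≤ l := by
      by_contra! h
      exact hyG ⟨⟨hsub hyB, h⟩, hyB⟩
    have hy2 : |f y - c'| ≤ 4 * a := by
      by_contra! h
      exact hyc ⟨hyB, h⟩
    have hcc : |c' - c| ≤ 4 * a + l := by
      have e : c' - c = (f y - c) - (f y - c') := by ring
      rw [e]
      exact (abs_sub _ _).trans (by linarith)
    have hFm : MeasurableSet (F ∩ ball x (5 * ρ)) :=
      (hGm.inter measurableSet_ball).inter measurableSet_ball
    change (μ.withDensity φ) (F ∩ ball x (5 * ρ)) ≤ _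
    rw [withDensity_apply _ hFm]
    calc ∫⁻ y in F ∩ ball x (5 * ρ), φ y ∂μ ≤ ∫⁻ y in ball x (5 * ρ), φ y ∂μ :=
          lintegral_mono_set inter_subset_right
      _ ≤ ∫⁻ y in ball x (5 * ρ), (‖f y - c'‖ₑ + ENNReal.ofReal (4 * a + l)) ∂μ := by
          refine lintegral_mono fun y => ?_
          have e : f y - c = (f y - c') + (c' - c) := by ring
          calc φ y = ‖(f y - c') + (c' - c)‖ₑ := by rw [hφ, ← e]
            _ ≤ ‖f y - c'‖ₑ + ‖c' - c‖ₑ := enorm_add_le _ _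
            _ ≤ _ := by
              gcongr
              rw [Real.enorm_eq_ofReal_abs]
              exact ENNReal.ofReal_le_ofReal hcc
      _ = (∫⁻ y in ball x (5 * ρ), ‖f y - c'‖ₑ ∂μ) + ENNReal.ofReal (4 * a + l) * V (5 * ρ) := by
          rw [lintegral_add_right _ measurable_const, setLIntegral_const, hV.measure_ball x _ h5]
      _ ≤ ENNReal.ofReal a * V (5 * ρ) + ENNReal.ofReal (4 * a + l) * V (5 * ρ) := by gcongr
      _ = ENNReal.ofReal (5 * a + l) * V (5 * ρ) := by
          rw [← add_mul, ← ENNReal.ofReal_add ha.le (by positivity)]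
          ring_nf
  have hFm : MeasurableSet F := hGm.inter measurableSet_ball
  rw [hν, withDensity_apply _ hFm] at key
  have hsplit : ∫⁻ y in ball z r, φ y ∂μ ≤
      ∫⁻ y in ball z r, ENNReal.ofReal l ∂μ + ∫⁻ y in F, φ y ∂μ := by
    have hd : ball z r ⊆ (ball z r \ G) ∪ F := fun y hy => by
      by_cases h : y ∈ G
      · exact Or.inr ⟨h, hy⟩
      · exact Or.inl ⟨hy, h⟩
    refine (lintegral_mono_set hd).trans ((lintegral_union_le _ _ _).trans ?_)
    gcongr ?_ + _
    refine (setLIntegral_mono' (measurableSet_ball.diff hGm) (g := fun _ => ENNReal.ofReal l)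
      fun y hy => ?_).trans (lintegral_mono_set sdiff_subset)
    rw [hφ]
    simp only [Real.enorm_eq_ofReal_abs]
    refine ENNReal.ofReal_le_ofReal ?_
    by_contra! h
    exact hy.2 ⟨ball_subset_ball (by linarith) hy.1, h⟩
  rw [setLIntegral_const, hV.measure_ball z r hr] at hsplit
  refine hsplit.trans ?_
  have h6 : 512 * μ G ≤ 16⁻¹ * V r := by
    calc 512 * μ G ≤ 512 * (64 * α * V r) := by gcongr
      _ = (2 ^ 15 * α) * V r := by
        rw [← mul_assoc, ← mul_assoc]; norm_num
      _ ≤ _ := by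
        gcongr
        rw [ENNReal.le_inv_iff_mul_le]
        calc 2 ^ 15 * α * 16 = 2 ^ 19 * α := by
              rw [mul_comm _ (16 : ℝ≥0∞), ← mul_assoc]; norm_num
          _ ≤ 1 := hα
  calc ENNReal.ofReal l * V r + ∫⁻ y in F, φ y ∂μ
      ≤ ENNReal.ofReal l * V r + ENNReal.ofReal (5 * a + l) * (16⁻¹ * V r) := by
        gcongr
        exact key.trans (by gcongr)
    _ = _ := by
      rw [ENNReal.ofReal_add hl.le (by positivity), add_mul, ENNReal.ofReal_div_of_pos (by norm_num),
        div_eq_mul_inv]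
      norm_num
      ring

/-- Boundedness supplies a first finite bound for the bootstrap. A bound 2 l + δ improves to 27 l /
16 + 5 δ / 16 ≤ 2 l + δ / 2, so the excess halves at each step. -/
theorem meanOsc_le_of_bounded (hV : BallRegular μ V) {α : ℝ≥0∞} (hα : 2 ^ 19 * α ≤ 1) {f : X → ℝ}
    (hf : Measurable f) {l N : ℝ} (hl : 0 < l) (hN : ∀ x, |f x| ≤ N)
    (h : ∀ z r, 0 < r → OscLE μ α l f z r) {z : X} {r c : ℝ} (hr : 0 < r)
    (hc : μ {y | y ∈ ball z (8 * r) ∧ l < |f y - c|} ≤ α * V (8 * r)) :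
    ∫⁻ y in ball z r, ‖f y - c‖ₑ ∂μ ≤ ENNReal.ofReal (2 * l) * V r := by
  have hN0 : 0 ≤ N := (abs_nonneg _).trans (hN z)
  have hP : ∀ n : ℕ, ∀ z r, 0 < r → ∃ c, ∫⁻ y in ball z r, ‖f y - c‖ₑ ∂μ ≤
      ENNReal.ofReal (2 * l + N / 2 ^ n) * V r := by
    intro n
    induction n with
    | zero =>
      intro z r hr
      refine ⟨0, ?_⟩
      calc ∫⁻ y in ball z r, ‖f y - 0‖ₑ ∂μ ≤ ∫⁻ y in ball z r, ENNReal.ofReal (2 * l + N) ∂μ := by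
            refine lintegral_mono fun y => ?_
            rw [sub_zero, Real.enorm_eq_ofReal_abs]
            exact ENNReal.ofReal_le_ofReal (by linarith [hN y])
        _ = _ := by rw [setLIntegral_const, hV.measure_ball z r hr, pow_zero, div_one]
    | succ n ih =>
      intro z r hr
      obtain ⟨c, hc⟩ := h z (8 * r) (by linarith)
      rw [hV.measure_ball z _ (by linarith)] at hc
      refine ⟨c, (hV.meanOsc_step hα hf hl (by positivity) ih hr hc).trans ?_⟩
      have : N / 2 ^ (n + 1) = N / 2 ^ n / 2 := by rw [pow_succ]; field_simp
      rw [this]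
      refine mul_le_mul_left (ENNReal.ofReal_le_ofReal ?_) _
      have : 0 ≤ N / 2 ^ n := by positivity
      linarith
  -- An excess of at most l is enough: from a ≤ 3 l one more step, now with the prescribed c, gives
  -- l + (15 l + l) / 16 = 2 l.
  obtain ⟨n, hn⟩ := exists_nat_gt (N / l)
  have hn2 : (n : ℝ) < 2 ^ n := by exact_mod_cast Nat.lt_two_pow_self
  have hNl : N / 2 ^ n ≤ l := by
    rw [div_le_iff₀ (by positivity)]
    rw [div_lt_iff₀ hl] at hn
    nlinarith
  refine (hV.meanOsc_step hα hf hl (by positivity) (hP n) hr hc).trans ?_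
  gcongr
  linarith

/-- John-Strömberg: if `f` has small oscillation in all balls up to sets of small proportion, then
its mean oscillation is bounded. -/
theorem meanOsc_le (hV : BallRegular μ V) {α : ℝ≥0∞} (hα : 2 ^ 19 * α ≤ 1) {f : X → ℝ}
    (hf : Measurable f) {l : ℝ} (hl : 0 < l) (h : ∀ z r, 0 < r → OscLE μ α l f z r) (z : X)
    {r : ℝ} (hr : 0 < r) :
    ∃ c, ∫⁻ y in ball z r, ‖f y - c‖ₑ ∂μ ≤ ENNReal.ofReal (2 * l) * V r := by
  -- Truncation is 1-Lipschitz, so it preserves the oscillation hypothesis. The bound for bounded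
  -- functions does not involve N, and for N ≥ |c| the same c serves all truncations; Fatou's lemma
  -- concludes.
  set T : ℕ → ℝ → ℝ := fun N u => max (-N) (min u N) with hT
  have hTm : ∀ N, Measurable (T N) := fun N => measurable_const.max (measurable_id.min measurable_const)
  have hTl : ∀ N u v, |T N u - T N v| ≤ |u - v| := by
    intro N u v
    have h1 := abs_max_sub_max_le_abs (min u N) (min v N) (-N : ℝ)
    have h2 := abs_min_sub_min_le_max u (N : ℝ) v N
    rw [max_comm, max_comm _ (-N : ℝ)] at h1
    simp only [sub_self, abs_zero] at h2
    rw [max_eq_left (abs_nonneg _)] at h2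
    exact h1.trans h2
  have hTid : ∀ N : ℕ, ∀ u : ℝ, |u| ≤ N → T N u = u := by
    intro N u hu
    rw [abs_le] at hu
    simp only [hT]
    rw [min_eq_left hu.2, max_eq_right hu.1]
  have hTosc : ∀ N : ℕ, ∀ z r, 0 < r → OscLE μ α l (fun x => T N (f x)) z r := by
    intro N z r hr
    obtain ⟨c, hc⟩ := h z r hr
    have hsub : {y | y ∈ ball z r ∧ l < |T N (f y) - T N c|} ⊆ {y | y ∈ ball z r ∧ l < |f y - c|} :=
      fun y hy => ⟨hy.1, hy.2.trans_le (hTl N _ _)⟩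
    exact ⟨T N c, (measure_mono hsub).trans hc⟩
  have hTb : ∀ N : ℕ, ∀ x, |T N (f x)| ≤ N := by
    intro N x
    have h0 : (0 : ℝ) ≤ N := by positivity
    rw [abs_le]
    exact ⟨le_max_left _ _, max_le (by linarith) (min_le_right _ _)⟩
  obtain ⟨c, hc⟩ := h z (8 * r) (by linarith)
  rw [hV.measure_ball z _ (by linarith)] at hc
  refine ⟨c, ?_⟩
  obtain ⟨n₀, hn₀⟩ := exists_nat_ge |c|
  have hb : ∀ N : ℕ, n₀ ≤ N → ∫⁻ y in ball z r, ‖T N (f y) - c‖ₑ ∂μ ≤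
      ENNReal.ofReal (2 * l) * V r := by
    intro N hN
    have hcN : |c| ≤ N := hn₀.trans (by exact_mod_cast hN)
    refine hV.meanOsc_le_of_bounded hα ((hTm N).comp hf) hl (hTb N) (hTosc N) hr ?_
    have hsub : {y | y ∈ ball z (8 * r) ∧ l < |T N (f y) - c|} ⊆
        {y | y ∈ ball z (8 * r) ∧ l < |f y - c|} := by
      intro y hy
      have := hTl N (f y) c
      rw [hTid N c hcN] at this
      exact ⟨hy.1, hy.2.trans_le this⟩
    exact (measure_mono hsub).trans hc
  have hlim : ∀ y, ‖f y - c‖ₑ = liminf (fun N : ℕ => ‖T N (f y) - c‖ₑ) atTop := by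
    intro y
    obtain ⟨n, hn⟩ := exists_nat_ge |f y|
    have : Tendsto (fun N : ℕ => ‖T N (f y) - c‖ₑ) atTop (𝓝 ‖f y - c‖ₑ) := by
      refine tendsto_const_nhds.congr' ?_
      filter_upwards [eventually_ge_atTop n] with N hN
      rw [hTid N (f y) (hn.trans (by exact_mod_cast hN))]
    exact this.liminf_eq.symm
  calc ∫⁻ y in ball z r, ‖f y - c‖ₑ ∂μ
      = ∫⁻ y in ball z r, liminf (fun N : ℕ => ‖T N (f y) - c‖ₑ) atTop ∂μ :=
        lintegral_congr hlim
    _ ≤ liminf (fun N : ℕ => ∫⁻ y in ball z r, ‖T N (f y) - c‖ₑ ∂μ) atTop :=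
        lintegral_liminf_le fun N => (((hTm N).comp hf).sub_const c).enorm
    _ ≤ _ := by
        refine liminf_le_of_frequently_le' (Eventually.frequently ?_)
        filter_upwards [eventually_ge_atTop n₀] with N hN using hb N hN

end BallRegular

end JohnStromberg

/-! ### Whitney-type extension from the complement of an open set -/

section Extension

variable {X : Type*} [PseudoMetricSpace X] [MeasurableSpace X] {μ : Measure X} {V : ℝ → ℝ≥0∞}

theorem OscLE.mono {α β : ℝ≥0∞} {s t : ℝ} {f : X → ℝ} {z : X} {r : ℝ} (h : OscLE μ α s f z r)
    (hαβ : α ≤ β) (hst : s ≤ t) : OscLE μ β t f z r := by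
  obtain ⟨c, hc⟩ := h
  have hsub : {y | y ∈ ball z r ∧ t < |f y - c|} ⊆ {y | y ∈ ball z r ∧ s < |f y - c|} :=
    fun y hy => ⟨hy.1, hst.trans_lt hy.2⟩
  exact ⟨c, (measure_mono hsub).trans (hc.trans (by gcongr))⟩

namespace BallRegular

theorem abs_sub_le_of_measure_le (hV : BallRegular μ V) {f : X → ℝ} {l c c' ρ : ℝ} {b : X}
    (hρ : 0 < ρ) {B B' : Set X} (hB : ball b ρ ⊆ B) (hB' : ball b ρ ⊆ B') {k k' : ℝ≥0∞}
    (hk : μ {y | y ∈ B ∧ l < |f y - c|} ≤ k * V ρ)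
    (hk' : μ {y | y ∈ B' ∧ l < |f y - c'|} ≤ k' * V ρ) (hkk : k + k' < 1) : |c - c'| ≤ 2 * l := by
  obtain ⟨y, hy, h1, h2⟩ := exists_mem_notMem_of_measure_le (hV.pos ρ hρ) (hV.ne_top ρ hρ) hkk
    (hV.measure_ball b ρ hρ) hk hk'
  have h1 : |f y - c| ≤ l := by
    by_contra! h
    exact h1 ⟨hB hy, h⟩
  have h2 : |f y - c'| ≤ l := by
    by_contra! h
    exact h2 ⟨hB' hy, h⟩
  have e : c - c' = (f y - c') - (f y - c) := by ring
  rw [e]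
  exact (abs_sub _ _).trans (by linarith)

variable [BorelSpace X] [SecondCountableTopology X]

/-- A function with small oscillation in the balls that meet the complement of the open set `E` can
be modified inside `E` to have small oscillation in all balls. -/
theorem exists_oscLE_extension (hV : BallRegular μ V) {α : ℝ≥0∞} (hα : 2 ^ 15 * α ≤ 1) {f : X → ℝ}
    (hf : Measurable f) {E : Set X} (hE : IsOpen E) (hEc : Eᶜ.Nonempty) {R : ℝ}
    (hR : ∀ x ∈ E, infDist x Eᶜ ≤ R) {l : ℝ} (hl : 0 < l)
    (h : ∀ z r, 0 < r → (∃ y ∉ E, y ∈ ball z r) → OscLE μ α l f z r) :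
    ∃ f₁ : X → ℝ, Measurable f₁ ∧ (∀ x ∉ E, f₁ x = f x) ∧
      ∀ z r, 0 < r → OscLE μ (2 ^ 20 * α) (2 * l) f₁ z r := by
  classical
  set d : X → ℝ := fun x => infDist x Eᶜ with hd
  have hdpos : ∀ x ∈ E, 0 < d x := fun x hx =>
    (hE.isClosed_compl.notMem_iff_infDist_pos hEc).1 (by simpa using hx)
  have hdE : ∀ x, 0 < d x → x ∈ E := by
    intro x hx
    by_contra hc
    have : infDist x Eᶜ = 0 := infDist_zero_of_mem hc
    exact hx.ne' this
  have hdd : ∀ x y, d x ≤ d y + dist x y := fun x y => infDist_le_infDist_add_dist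
  have hmeet : ∀ z r, d z < r → ∃ y ∉ E, y ∈ ball z r := by
    intro z r hr
    obtain ⟨y, hy, hyr⟩ := (infDist_lt_iff hEc).1 hr
    exact ⟨y, hy, by rwa [mem_ball, dist_comm]⟩
  rcases E.eq_empty_or_nonempty with rfl | hEne
  · refine ⟨f, hf, fun _ _ => rfl, fun z r hr => ?_⟩
    refine (h z r hr ⟨z, by simp, mem_ball_self hr⟩).mono ?_ (by linarith)
    exact le_mul_of_one_le_left zero_le (by norm_num)
  -- Whitney balls: radii proportional to the distance from the complement. Those of radius d / 40
  -- are disjoint, and their enlargements of radius d / 8 cover E.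
  obtain ⟨u, huE, hudisj, hucov⟩ := Vitali.exists_disjoint_subfamily_covering_enlargement_ball E
    (fun x => x) (fun x => d x / 40) (R / 40) (fun x hx => by
      have := hR x hx
      change infDist x Eᶜ / 40 ≤ R / 40
      linarith) 5 (by norm_num)
  have hucount : u.Countable := hudisj.countable_of_isOpen (fun _ _ => isOpen_ball)
    (fun a ha => ⟨a, mem_ball_self (by have := hdpos a (huE ha); linarith)⟩)
  have hcov : ∀ x ∈ E, ∃ b ∈ u, x ∈ ball b (d b / 8) := by
    intro x hx
    obtain ⟨b, hb, hsub⟩ := hucov x hx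
    refine ⟨b, hb, ?_⟩
    have := hsub (mem_ball_self (by have := hdpos x hx; linarith))
    rw [show d b / 8 = 5 * (d b / 40) by ring]
    exact this
  have hune : u.Nonempty := by
    obtain ⟨x, hx⟩ := hEne
    obtain ⟨b, hb, -⟩ := hcov x hx
    exact ⟨b, hb⟩
  obtain ⟨e, he⟩ := hucount.exists_eq_range hune
  have hosc : ∀ b ∈ E, ∃ c : ℝ, μ {y | y ∈ ball b (2 * d b) ∧ l < |f y - c|} ≤ α * V (2 * d b) := by
    intro b hb
    have hb0 := hdpos b hb
    obtain ⟨c, hc⟩ := h b (2 * d b) (by linarith) (hmeet b _ (by linarith))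
    rw [hV.measure_ball b _ (by linarith)] at hc
    exact ⟨c, hc⟩
  choose! c hc using hosc
  have hex : ∀ x, ∃ n, x ∉ E ∨ x ∈ ball (e n) (d (e n) / 8) := by
    intro x
    by_cases hx : x ∈ E
    · obtain ⟨b, hb, hxb⟩ := hcov x hx
      rw [he] at hb
      obtain ⟨n, rfl⟩ := hb
      exact ⟨n, Or.inr hxb⟩
    · exact ⟨0, Or.inl hx⟩
  -- On E the new value is the near-constant of the first covering Whitney ball in the enumeration;
  -- no partition of unity is needed and measurability is immediate.
  set f₁ : X → ℝ := fun x => if x ∈ E then c (e (Nat.find (hex x))) else f x with hf₁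
  have hf₁m : Measurable f₁ := by
    refine Measurable.ite hE.measurableSet ?_ hf
    have hn : Measurable fun x => Nat.find (hex x) :=
      measurable_find hex fun k => (hE.measurableSet.compl).union measurableSet_ball
    exact (measurable_from_nat (f := fun n => c (e n))).comp hn
  have hf₁E : ∀ x ∈ E, ∃ b ∈ u, x ∈ ball b (d b / 8) ∧ f₁ x = c b := by
    intro x hx
    refine ⟨e (Nat.find (hex x)), he ▸ mem_range_self _, ?_, if_pos hx⟩
    rcases Nat.find_spec (hex x) with h1 | h1
    · exact absurd hx h1
    · exact h1
  refine ⟨f₁, hf₁m, fun x hx => if_neg hx, fun z r hr => ?_⟩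
  -- A ball small compared with its distance from the complement meets only Whitney balls of
  -- comparable size. Their near-constants are within 2 l of a single cz, so the exceptional set is
  -- empty.
  by_cases hzr : 16 * r ≤ d z
  · have hz0 : 0 < d z := by linarith
    obtain ⟨cz, hcz⟩ := h z (4 * d z) (by linarith) (hmeet z _ (by linarith))
    rw [hV.measure_ball z _ (by linarith)] at hcz
    refine ⟨cz, ?_⟩
    have : {y | y ∈ ball z r ∧ 2 * l < |f₁ y - cz|} = ∅ := by
      rw [eq_empty_iff_forall_notMem]
      rintro x ⟨hxz, hx⟩
      have hxz : dist x z < r := hxz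
      have h1 := hdd z x
      rw [dist_comm] at h1
      have h2 := hdd x z
      obtain ⟨b, hb, hxb, hfx⟩ := hf₁E x (hdE x (by linarith))
      have hxb : dist x b < d b / 8 := hxb
      have h3 := hdd x b
      have h4 := hdd b x
      rw [dist_comm] at h4
      have hb0 := hdpos b (huE hb)
      refine absurd hx (not_lt.2 ?_)
      rw [hfx]
      refine hV.abs_sub_le_of_measure_le (b := b) hb0 (ball_subset_ball (by linarith))
        (ball_subset_ball' (ε₁ := d b) (ε₂ := 4 * d z) ?_) (k := 4 * α) (k' := 64 * α)
        ((hc b (huE hb)).trans ?_) (hcz.trans ?_) ?_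
      · have h5 : dist b z ≤ dist x b + dist x z := by
          rw [dist_comm x b]; exact dist_triangle _ _ _
        linarith
      · calc α * V (2 * d b) ≤ α * (4 * V (d b)) := by gcongr; exact hV.doubling _ hb0
          _ = _ := by ring
      · calc α * V (4 * d z) ≤ α * (4 ^ 3 * V (d b)) := by
              gcongr
              exact hV.le_pow_mul 3 (by linarith) hb0 (by linarith)
          _ = _ := by norm_num; ring
      · rw [← add_mul]
        norm_num
        have hα0 : α ≠ ∞ := by
          rintro rfl
          norm_num at hα
        by_contra! hge
        have : 400 * 1 ≤ (1 : ℝ≥0∞) := by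
          refine le_trans ?_ hα
          calc 400 * 1 ≤ 400 * (68 * α) := by gcongr
            _ = 27200 * α := by rw [← mul_assoc]; norm_num
            _ ≤ 2 ^ 15 * α := by gcongr; norm_num
        norm_num at this
    rw [this, measure_empty]
    exact zero_le
  · push Not at hzr
    -- Here d z < 16 r, so every Whitney ball covering a point of E in the given ball lies in the
    -- dilate by 64. That dilate meets the complement and has a near-constant cz.
    obtain ⟨cz, hcz⟩ := h z (64 * r) (by linarith) (hmeet z _ (by linarith))
    rw [hV.measure_ball z _ (by linarith)] at hcz
    set N : Set X := {y | y ∈ ball z (64 * r) ∧ l < |f y - cz|} with hN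
    have hNm : MeasurableSet N := measurableSet_ball.inter
      (measurableSet_lt measurable_const (hf.sub_const cz).abs)
    set u' : Set X := {b | b ∈ u ∧ ball b (d b) ⊆ ball z (64 * r) ∧ 2 * l < |c b - cz|} with hu'
    have hu'u : u' ⊆ u := fun b hb => hb.1
    have hsub : {y | y ∈ ball z r ∧ 2 * l < |f₁ y - cz|} ⊆ N ∪ ⋃ b ∈ u', ball b (5 * (d b / 40)) := by
      rintro x ⟨hxz, hx⟩
      by_cases hxE : x ∈ E
      · obtain ⟨b, hb, hxb, hfx⟩ := hf₁E x hxE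
        refine Or.inr (mem_iUnion₂.2 ⟨b, ⟨hb, ball_subset_ball' ?_, hfx ▸ hx⟩, ?_⟩)
        · have hxz : dist x z < r := hxz
          have hxb : dist x b < d b / 8 := hxb
          have h2 := hdd x z
          have h4 := hdd b x
          rw [dist_comm] at h4
          have h5 : dist b z ≤ dist x b + dist x z := by
            rw [dist_comm x b]; exact dist_triangle _ _ _
          linarith
        · rw [show 5 * (d b / 40) = d b / 8 by ring]
          exact hxb
      · refine Or.inl ⟨ball_subset_ball (by linarith) hxz, ?_⟩
        have : f₁ x = f x := if_neg hxE
        rw [this] at hx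
        linarith
    -- If c b differs from cz by more than 2 l, each point of the small ball has f far from c b or
    -- far from cz. The first happens on at most half of it, since 4^7 α ≤ 1/2, so N fills at least
    -- half. By disjointness the enlarged bad balls have measure at most 64 * 2 * |N|, and 129 * 4^6
    -- ≤ 2^20.
    have hbad : ∀ b ∈ u', V (d b / 40) ≤ 2 * μ (N ∩ ball b (d b / 40)) := by
      rintro b ⟨hbu, hbsub, hbc⟩
      have hb0 := hdpos b (huE hbu)
      have hs0 : 0 < d b / 40 := by linarith
      have hcov2 : ball b (d b / 40) ⊆ (N ∩ ball b (d b / 40)) ∪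
          {y | y ∈ ball b (2 * d b) ∧ l < |f y - c b|} := by
        intro y hy
        by_cases h1 : l < |f y - c b|
        · exact Or.inr ⟨ball_subset_ball (by linarith) hy, h1⟩
        · refine Or.inl ⟨⟨hbsub (ball_subset_ball (by linarith) hy), ?_⟩, hy⟩
          by_contra! h2
          push Not at h1
          have e : c b - cz = (f y - cz) - (f y - c b) := by ring
          rw [e] at hbc
          have := abs_sub (f y - cz) (f y - c b)
          linarith
      have h1 : V (d b / 40) ≤ μ (N ∩ ball b (d b / 40)) + 2⁻¹ * V (d b / 40) := by
        calc V (d b / 40) = μ (ball b (d b / 40)) := (hV.measure_ball b _ hs0).symm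
          _ ≤ _ := (measure_mono hcov2).trans (measure_union_le _ _)
          _ ≤ μ (N ∩ ball b (d b / 40)) + 2⁻¹ * V (d b / 40) := by
            gcongr
            refine (hc b (huE hbu)).trans ?_
            calc α * V (2 * d b) ≤ α * (4 ^ 7 * V (d b / 40)) := by
                  gcongr
                  exact hV.le_pow_mul 7 (by linarith) hs0 (by linarith)
              _ = (4 ^ 7 * α) * V (d b / 40) := by ring
              _ ≤ _ := by
                gcongr
                rw [ENNReal.le_inv_iff_mul_le]
                refine le_trans (le_of_eq ?_) hα
                rw [mul_comm _ (2 : ℝ≥0∞), ← mul_assoc]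
                norm_num
      have h2 : 2⁻¹ * V (d b / 40) + 2⁻¹ * V (d b / 40) = V (d b / 40) := by
        rw [← add_mul, ENNReal.inv_two_add_inv_two, one_mul]
      have h3 := (ENNReal.add_le_add_iff_right
        (ENNReal.mul_ne_top (by simp) (hV.ne_top _ hs0))).1 (h2.trans_le h1)
      calc V (d b / 40) = 2 * (2⁻¹ * V (d b / 40)) := by
            rw [← mul_assoc, ENNReal.mul_inv_cancel (by simp) (by simp), one_mul]
        _ ≤ _ := by gcongr
    have hu'count : u'.Countable := hucount.mono hu'u
    refine ⟨cz, ?_⟩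
    rw [hV.measure_ball z r hr]
    calc _ ≤ μ N + μ (⋃ b ∈ u', ball b (5 * (d b / 40))) :=
          (measure_mono hsub).trans (measure_union_le _ _)
      _ ≤ μ N + ∑' b : u', μ (ball (b : X) (5 * (d b / 40))) := by
          gcongr
          exact measure_biUnion_le μ hu'count _
      _ ≤ μ N + ∑' b : u', 64 * (2 * μ (N ∩ ball (b : X) (d b / 40))) := by
          gcongr with b
          have hs0 : 0 < d b / 40 := by
            have := hdpos b (huE (hu'u b.2))
            linarith
          rw [hV.measure_ball _ _ (by linarith)]
          refine (hV.five_mul_le hs0).trans ?_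
          gcongr
          exact hbad b b.2
      _ = μ N + 128 * μ (⋃ b ∈ u', N ∩ ball b (d b / 40)) := by
          rw [ENNReal.tsum_mul_left, ENNReal.tsum_mul_left, ← mul_assoc,
            measure_biUnion hu'count _ fun b _ => hNm.inter measurableSet_ball]
          · norm_num
          · exact (hudisj.subset hu'u).mono fun b => inter_subset_right
      _ ≤ μ N + 128 * μ N := by
          gcongr
          exact iUnion₂_subset fun b _ => inter_subset_left
      _ = 129 * μ N := by ring
      _ ≤ 129 * (α * (4 ^ 6 * V r)) := by
          gcongr
          refine hcz.trans ?_
          gcongr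
          exact hV.le_pow_mul 6 (by linarith) hr (by linarith)
      _ = (129 * 4 ^ 6) * α * V r := by ring
      _ ≤ 2 ^ 20 * α * V r := by
          gcongr
          norm_num

end BallRegular

end Extension

/-! ### Basic properties of the sharp maximal function -/

section SharpMaximal

variable {A : Type}

theorem setOf_lt_indicator (B : Set (Fin 2 → A)) (g : (Fin 2 → A) → ℝ≥0∞) (s : ℝ≥0∞) :
    {y | s < B.indicator g y} = {y | y ∈ B ∧ s < g y} := by
  ext y
  by_cases h : y ∈ B <;> simp [h]

theorem setOf_ofReal_lt_enorm {B : Set (Fin 2 → A)} {f : (Fin 2 → A) → ℝ} {c s : ℝ} (hs : 0 ≤ s) :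
    {y | y ∈ B ∧ ENNReal.ofReal s < ‖f y - c‖ₑ} = {y | y ∈ B ∧ s < |f y - c|} := by
  ext y
  simp only [mem_ofPred_eq, Real.enorm_eq_ofReal_abs, ENNReal.ofReal_lt_ofReal_iff_of_nonneg hs]

variable [PseudoMetricSpace A]

theorem cube_eq_ball (z : Fin 2 → A) {r : ℝ} (hr : 0 < r) : cube z r = ball z r := by
  ext y
  simp [cube, dist_pi_lt_iff hr]

theorem mem_cube_iff {y z : Fin 2 → A} {r : ℝ} (hr : 0 < r) : y ∈ cube z r ↔ y ∈ ball z r := by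
  rw [cube_eq_ball z hr]

/-- Uncentred maximal functions over open balls are lower semicontinuous, hence measurable, whatever
`f` is. -/
theorem isOpen_setOf_exists_ball (P : (Fin 2 → A) → ℝ → Prop) :
    IsOpen {x : Fin 2 → A | ∃ z r, 0 < r ∧ x ∈ ball z r ∧ P z r} := by
  have : {x : Fin 2 → A | ∃ z r, 0 < r ∧ x ∈ ball z r ∧ P z r} =
      ⋃ (z : Fin 2 → A) (r : ℝ) (_ : 0 < r) (_ : P z r), ball z r := by
    ext x
    simp only [mem_iUnion, mem_ofPred_eq, exists_prop]
    constructor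
    · rintro ⟨z, r, h1, h2, h3⟩; exact ⟨z, r, h1, h3, h2⟩
    · rintro ⟨z, r, h1, h3, h2⟩; exact ⟨z, r, h1, h2, h3⟩
  rw [this]
  exact isOpen_iUnion fun z => isOpen_iUnion fun r => isOpen_iUnion fun _ => isOpen_iUnion
    fun _ => isOpen_ball

theorem setOf_lt_iSup_cube (F : (Fin 2 → A) → ℝ → ℝ≥0∞) (s : ℝ≥0∞) :
    {x | s < ⨆ (z : Fin 2 → A) (r : ℝ) (_ : 0 < r) (_ : x ∈ cube z r), F z r} =
      {x | ∃ z r, 0 < r ∧ x ∈ ball z r ∧ s < F z r} := by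
  ext x
  simp only [mem_ofPred_eq, lt_iSup_iff, exists_prop]
  constructor
  · rintro ⟨z, r, h1, h2, h3⟩; exact ⟨z, r, h1, (mem_cube_iff h1).1 h2, h3⟩
  · rintro ⟨z, r, h1, h2, h3⟩; exact ⟨z, r, h1, (mem_cube_iff h1).2 h2, h3⟩

variable [MeasureSpace A]

theorem rearrangement_le_sharpMax (α : ℝ) (f : (Fin 2 → A) → ℝ) {x z : Fin 2 → A} {r : ℝ}
    (hr : 0 < r) (hx : x ∈ ball z r) :
    ⨅ c : ℝ, rearrangement ((ball z r).indicator fun y => ‖f y - c‖ₑ)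
      (ENNReal.ofReal α * volume (ball z r)) ≤ sharpMax α f x := by
  rw [← cube_eq_ball z hr] at hx ⊢
  exact le_iSup_of_le z (le_iSup_of_le r (le_iSup_of_le hr (le_iSup_of_le hx le_rfl)))

/-- The infimum over c need not be attained, hence the strictly larger level t; the factors 2 in
front of s and l below come from here. -/
theorem oscLE_of_sharpMax_le {α : ℝ} {f : (Fin 2 → A) → ℝ} {x z : Fin 2 → A} {r s t : ℝ}
    (hs : 0 ≤ s) (hst : s < t) (h : sharpMax α f x ≤ ENNReal.ofReal s) (hr : 0 < r)
    (hx : x ∈ ball z r) : OscLE volume (ENNReal.ofReal α) t f z r := by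
  have h1 := (rearrangement_le_sharpMax α f hr hx).trans_lt (h.trans_lt
    ((ENNReal.ofReal_lt_ofReal_iff_of_nonneg hs).2 hst))
  obtain ⟨c, hc⟩ := iInf_lt_iff.1 h1
  refine ⟨c, ?_⟩
  have := rearrangement_le_iff.1 hc.le
  rwa [setOf_lt_indicator, setOf_ofReal_lt_enorm (hs.trans hst.le)] at this

theorem isOpen_lt_sharpMax (α : ℝ) (f : (Fin 2 → A) → ℝ) (s : ℝ≥0∞) :
    IsOpen {x | s < sharpMax α f x} := by
  unfold sharpMax
  rw [setOf_lt_iSup_cube]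
  exact isOpen_setOf_exists_ball _

theorem sharpMax_congr_ae {α : ℝ} {f g : (Fin 2 → A) → ℝ} (h : f =ᵐ[volume] g) :
    sharpMax α f = sharpMax α g := by
  have hr : ∀ (B : Set (Fin 2 → A)) (c : ℝ) (t : ℝ≥0∞),
      rearrangement (B.indicator fun y => ‖f y - c‖ₑ) t =
        rearrangement (B.indicator fun y => ‖g y - c‖ₑ) t := by
    intro B c t
    have hm : ∀ s, volume {y | s < B.indicator (fun y => ‖f y - c‖ₑ) y} =
        volume {y | s < B.indicator (fun y => ‖g y - c‖ₑ) y} := by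
      intro s
      refine measure_congr ?_
      filter_upwards [h] with y hy
      change (s < _) = (s < _)
      by_cases hyc : y ∈ B <;> simp [hyc, hy]
    unfold rearrangement
    simp_rw [hm]
  funext x
  unfold sharpMax
  simp_rw [hr]

variable [BorelSpace A] [SecondCountableTopology A]

theorem measurable_sharpMax (α : ℝ) (f : (Fin 2 → A) → ℝ) : Measurable (sharpMax α f) :=
  measurable_of_Ioi fun s => (isOpen_lt_sharpMax α f s).measurableSet

end SharpMaximal

/-! ### Splitting at a level of the sharp maximal function -/

section Decomposition

variable {A : Type} [PseudoMetricSpace A] [MeasureSpace A] {V : ℝ → ℝ≥0∞}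

theorem OscLE.sub {X : Type*} [PseudoMetricSpace X] [MeasurableSpace X] {μ : Measure X}
    {α β : ℝ≥0∞} {s t : ℝ} {f g : X → ℝ} {z : X} {r : ℝ} (hf : OscLE μ α s f z r)
    (hg : OscLE μ β t g z r) : OscLE μ (α + β) (s + t) (fun x => f x - g x) z r := by
  obtain ⟨c, hc⟩ := hf
  obtain ⟨c', hc'⟩ := hg
  refine ⟨c - c', ?_⟩
  have hsub : {y | y ∈ ball z r ∧ s + t < |f y - g y - (c - c')|} ⊆
      {y | y ∈ ball z r ∧ s < |f y - c|} ∪ {y | y ∈ ball z r ∧ t < |g y - c'|} := by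
    rintro y ⟨hy, hlt⟩
    by_cases h : s < |f y - c|
    · exact Or.inl ⟨hy, h⟩
    · refine Or.inr ⟨hy, ?_⟩
      have e : f y - g y - (c - c') = (f y - c) - (g y - c') := by ring
      rw [e] at hlt
      have := abs_sub (f y - c) (g y - c')
      linarith
  rw [add_mul]
  exact (measure_mono hsub).trans ((measure_union_le _ _).trans (add_le_add hc hc'))

theorem OscLE.const {X : Type*} [PseudoMetricSpace X] [MeasurableSpace X] {μ : Measure X}
    (α : ℝ≥0∞) {s : ℝ} (hs : 0 ≤ s) (c : ℝ) (z : X) (r : ℝ) : OscLE μ α s (fun _ => c) z r := by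
  refine ⟨c, ?_⟩
  have : {y | y ∈ ball z r ∧ s < |c - c|} = ∅ := by
    ext y
    simp [hs]
  rw [this, measure_empty]
  exact zero_le

/-- Every ball has measure at most 8 t only when the whole space is a single ball. There a nearly
optimal c is subtracted: its infimum I is at most the sharp maximal function at every point, so
levels s ≤ I + l are below the majorant everywhere, while for s > I + l the set {|f - c| > s} has
proportion at most α. -/
theorem exists_sub_const (hV : BallRegular (volume : Measure (Fin 2 → A)) V) {α : ℝ}
    (hα' : 2 ^ 40 * α ≤ 1) {f : (Fin 2 → A) → ℝ} {t l : ℝ} (hl : 0 < l)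
    (htr : ∀ r, 0 < r → V r ≤ 8 * ENNReal.ofReal t) [Nonempty A] :
    ∃ c : ℝ,
      (∀ x s, 0 < s → sharpMax α f x + ENNReal.ofReal l ≤ ENNReal.ofReal s → ∀ z r, 0 < r →
        x ∈ ball z r → OscLE volume (ENNReal.ofReal α) (2 * s) (fun x => f x - c) z r) ∧
      (∀ s, 0 < s → (∃ r₀ > 0, 8 * volume {x | s < |f x - c|} < V r₀) ∨
        ∀ x, ENNReal.ofReal s ≤ sharpMax α f x + ENNReal.ofReal l) ∧
      volume (univ : Set (Fin 2 → A)) ≤ ENNReal.ofReal (8 * t) := by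
  have huniv : volume (univ : Set (Fin 2 → A)) ≤ ENNReal.ofReal (8 * t) := by
    rw [ENNReal.ofReal_mul (by norm_num), ENNReal.ofReal_ofNat]
    exact hV.measure_univ_le htr
  obtain ⟨R, hR0, hR⟩ : ∃ R > 0, ∀ x : Fin 2 → A, ball x R = univ := by
    rcases hV.bounded_or with h | h
    · exact h
    · obtain ⟨r, hr, hlt⟩ := h (8 * ENNReal.ofReal t) (ENNReal.mul_ne_top (by simp) (by simp))
      exact absurd (htr r hr) (not_le.2 hlt)
  obtain ⟨x₀⟩ : Nonempty (Fin 2 → A) := inferInstance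
  set I : ℝ≥0∞ := ⨅ c : ℝ, rearrangement ((ball x₀ R).indicator fun y => ‖f y - c‖ₑ)
      (ENNReal.ofReal α * volume (ball x₀ R)) with hI
  have hIle : ∀ x, I ≤ sharpMax α f x := fun x =>
    rearrangement_le_sharpMax α f hR0 (by rw [hR]; trivial)
  have hosc : ∀ c : ℝ, ∀ x s, 0 < s → sharpMax α f x + ENNReal.ofReal l ≤ ENNReal.ofReal s →
      ∀ z r, 0 < r → x ∈ ball z r →
      OscLE volume (ENNReal.ofReal α) (2 * s) (fun x => f x - c) z r := by
    intro c x s hs hle z r hr hx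
    have h1 := oscLE_of_sharpMax_le hs.le (by linarith : s < 2 * s) (le_self_add.trans hle) hr hx
    exact (h1.sub (OscLE.const 0 le_rfl c z r)).mono (by simp) (by simp)
  by_cases hItop : I = ∞
  · refine ⟨0, hosc 0, fun s hs => Or.inr fun x => ?_, huniv⟩
    have : sharpMax α f x = ∞ := top_le_iff.1 (hItop ▸ hIle x)
    simp [this]
  · have hlt : I < I + ENNReal.ofReal l := ENNReal.lt_add_right hItop (by simpa using hl)
    nth_rw 1 [hI] at hlt
    obtain ⟨c, hc⟩ := iInf_lt_iff.1 hlt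
    refine ⟨c, hosc c, fun s hs => ?_, huniv⟩
    rcases le_or_gt (ENNReal.ofReal s) (I + ENNReal.ofReal l) with h1 | h1
    · exact Or.inr fun x => h1.trans (by gcongr; exact hIle x)
    · refine Or.inl ⟨R, hR0, ?_⟩
      have h2 := rearrangement_le_iff.1 (hc.le.trans h1.le)
      rw [setOf_lt_indicator, setOf_ofReal_lt_enorm hs.le, hV.measure_ball _ _ hR0] at h2
      have h3 : {x | s < |f x - c|} = {y | y ∈ ball x₀ R ∧ s < |f y - c|} := by
        ext y; simp [hR]
      rw [h3]
      calc 8 * volume {y | y ∈ ball x₀ R ∧ s < |f y - c|} ≤ 8 * (ENNReal.ofReal α * V R) := by gcongr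
        _ = ENNReal.ofReal (8 * α) * V R := by
          rw [ENNReal.ofReal_mul (by norm_num), ENNReal.ofReal_ofNat, mul_assoc]
        _ < 1 * V R := by
          refine ENNReal.mul_lt_mul_left (hV.pos R hR0) (hV.ne_top R hR0) ?_
          rw [← ENNReal.ofReal_one, ENNReal.ofReal_lt_ofReal_iff one_pos]
          linarith
        _ = V R := one_mul _

variable [BorelSpace A] [SecondCountableTopology A]

/-- The majorant M for the oscillation of f - f₁ vanishes outside the set E' of points lying in some
ball where E has proportion at least 2^21 α. Outside E' the difference, supported in E, is already
zero up to that proportion of every ball. On E' the oscillations of f and f₁ are simply added. The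
weak type estimate gives |E'| ≤ 64 t / (2^21 α). -/
theorem exists_sub_extension (hV : BallRegular (volume : Measure (Fin 2 → A)) V) {α : ℝ}
    (hα : 0 < α) (hα' : 2 ^ 40 * α ≤ 1) {C p : ℝ} (hp : 1 ≤ p) (hC : C = 64 / (2 ^ 21 * α))
    {f : (Fin 2 → A) → ℝ} (hf : Measurable f) {t l r₀ : ℝ} (hl : 0 < l) (hr₀ : 0 < r₀)
    (htr : 8 * ENNReal.ofReal t < V r₀) [Nonempty A]
    (hE : volume {x | ENNReal.ofReal l < sharpMax α f x} ≤ ENNReal.ofReal t) :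
    ∃ f₁ : (Fin 2 → A) → ℝ, Measurable f₁ ∧
      (∀ z r, 0 < r → OscLE volume (2 ^ 20 * ENNReal.ofReal α) (4 * l) f₁ z r) ∧
      ∃ M : (Fin 2 → A) → ℝ≥0∞, Measurable M ∧
      (∀ x s, 0 < s → M x ≤ ENNReal.ofReal s → ∀ z r, 0 < r → x ∈ ball z r →
        OscLE volume (2 ^ 21 * ENNReal.ofReal α) (2 * s) (fun x => f x - f₁ x) z r) ∧
      (∀ s, 0 < s → (∃ r₀ > 0, 8 * volume {x | s < |f x - f₁ x|} < V r₀) ∨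
        ∀ x, ENNReal.ofReal s ≤ M x) ∧
      volume {x | f x - f₁ x ≠ 0} ≠ ∞ ∧
      ∃ E' : Set (Fin 2 → A), MeasurableSet E' ∧ volume E' ≤ ENNReal.ofReal (C * t) ∧
        ∫⁻ x, M x ^ p ≤ ∫⁻ x in E', (sharpMax α f x + ENNReal.ofReal (4 * l)) ^ p := by
  classical
  set a := ENNReal.ofReal α with ha
  have ha40 : 2 ^ 40 * a ≤ 1 := by
    have := ENNReal.ofReal_le_ofReal hα'
    rw [ENNReal.ofReal_mul (by norm_num), ENNReal.ofReal_one] at this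
    refine le_trans (le_of_eq ?_) this
    rw [ha, ENNReal.ofReal_pow (by norm_num), ENNReal.ofReal_ofNat]
  set E : Set (Fin 2 → A) := {x | ENNReal.ofReal l < sharpMax α f x} with hEdef
  have hEo : IsOpen E := isOpen_lt_sharpMax α f _
  -- Since |E| ≤ t, no ball of radius r₀ fits in E, so the Whitney radii are bounded.
  have hnot : ∀ x, ¬ ball x r₀ ⊆ E := by
    intro x hx
    have h1 : V r₀ ≤ ENNReal.ofReal t := by
      rw [← hV.measure_ball x r₀ hr₀]
      exact (measure_mono hx).trans hE
    refine absurd (htr.trans_le h1) (not_lt.2 ?_)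
    exact le_mul_of_one_le_left zero_le (by norm_num)
  have hEc : Eᶜ.Nonempty := by
    obtain ⟨x₀⟩ : Nonempty (Fin 2 → A) := inferInstance
    obtain ⟨y, -, hy⟩ := not_subset.1 (hnot x₀)
    exact ⟨y, hy⟩
  have hR : ∀ x ∈ E, infDist x Eᶜ ≤ r₀ := by
    intro x _
    obtain ⟨y, hy, hyE⟩ := not_subset.1 (hnot x)
    refine (infDist_le_dist_of_mem (show y ∈ Eᶜ from hyE)).trans ?_
    rw [dist_comm]
    exact (mem_ball.1 hy).le
  have hosc : ∀ z r, 0 < r → (∃ y ∉ E, y ∈ ball z r) → OscLE volume a (2 * l) f z r := by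
    rintro z r hr ⟨y, hy, hyz⟩
    exact oscLE_of_sharpMax_le hl.le (by linarith) (not_lt.1 hy) hr hyz
  obtain ⟨f₁, hf₁m, hf₁E, hf₁⟩ := hV.exists_oscLE_extension
    (le_trans (by gcongr <;> norm_num) ha40) hf hEo hEc hR (by linarith) hosc
  have hf₁' : ∀ z r, 0 < r → OscLE volume (2 ^ 20 * a) (4 * l) f₁ z r := fun z r hr =>
    (hf₁ z r hr).mono le_rfl (by linarith)
  set b := 2 ^ 21 * a with hb
  set E' : Set (Fin 2 → A) := {x | ∃ z r, 0 < r ∧ x ∈ ball z r ∧ b * V r ≤ volume (E ∩ ball z r)}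
    with hE'
  have hE'm : MeasurableSet E' := (isOpen_setOf_exists_ball _).measurableSet
  have hE'v : volume E' ≤ ENNReal.ofReal (C * t) := by
    have h1 := hV.mul_measure_exists_ball_le hEo.measurableSet b
    have hb' : b = ENNReal.ofReal (2 ^ 21 * α) := by
      rw [ENNReal.ofReal_mul (by norm_num), ENNReal.ofReal_pow (by norm_num), ENNReal.ofReal_ofNat]
    have hbt : b ≠ ∞ := by rw [hb']; exact ENNReal.ofReal_ne_top
    have hb0 : b ≠ 0 := by
      rw [hb', Ne, ENNReal.ofReal_eq_zero, not_le]
      positivity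
    have h2 : volume E' ≤ 64 * ENNReal.ofReal t / b := by
      rw [ENNReal.le_div_iff_mul_le (Or.inl hb0) (Or.inl hbt), mul_comm]
      exact h1.trans (by gcongr)
    refine h2.trans (le_of_eq ?_)
    rw [hC, ENNReal.ofReal_mul (by positivity), ENNReal.ofReal_div_of_pos (by positivity), ← hb',
      ENNReal.ofReal_ofNat, div_eq_mul_inv, div_eq_mul_inv]
    ring
  have hf₀ : ∀ x ∉ E, f x - f₁ x = 0 := fun x hx => by rw [hf₁E x hx, sub_self]
  have hsupp : {x | f x - f₁ x ≠ 0} ⊆ E := fun x hx => by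
    by_contra h
    exact hx (hf₀ x h)
  have hMm : Measurable fun x => sharpMax α f x + ENNReal.ofReal (4 * l) :=
    (measurable_sharpMax α f).add_const _
  refine ⟨f₁, hf₁m, hf₁', E'.indicator fun x => sharpMax α f x + ENNReal.ofReal (4 * l),
    hMm.indicator hE'm, ?_, ?_, ?_, E', hE'm, hE'v, ?_⟩
  · intro x s hs hMx z r hr hxz
    by_cases hx : x ∈ E'
    · rw [indicator_of_mem hx] at hMx
      have h4 : 4 * l ≤ s := by
        rw [← ENNReal.ofReal_le_ofReal_iff hs.le]
        exact le_add_self.trans hMx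
      have h5 : sharpMax α f x ≤ ENNReal.ofReal (s - 4 * l) := by
        rw [ENNReal.ofReal_sub _ (by linarith)]
        exact ENNReal.le_sub_of_add_le_right ENNReal.ofReal_ne_top hMx
      have h6 : OscLE volume a (2 * s - 4 * l) f z r :=
        oscLE_of_sharpMax_le (by linarith) (by linarith) h5 hr hxz
      refine (h6.sub (hf₁' z r hr)).mono ?_ (by linarith)
      calc a + 2 ^ 20 * a = (1 + 2 ^ 20) * a := by ring
        _ ≤ 2 ^ 21 * a := by gcongr; norm_num
    · refine ⟨0, ?_⟩
      have hlt : volume (E ∩ ball z r) < b * V r := by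
        by_contra! h
        exact hx ⟨z, r, hr, hxz, h⟩
      rw [hV.measure_ball z r hr]
      refine (measure_mono ?_).trans hlt.le
      rintro y ⟨hy, hlt⟩
      refine ⟨hsupp fun h0 => ?_, hy⟩
      simp only [h0, sub_zero, abs_zero] at hlt
      linarith
  · intro s hs
    refine Or.inl ⟨r₀, hr₀, lt_of_le_of_lt ?_ htr⟩
    gcongr
    refine (measure_mono fun x hx => ?_).trans hE
    refine hsupp fun h0 => ?_
    have hx : s < |f x - f₁ x| := hx
    rw [h0, abs_zero] at hx
    linarith
  · exact ne_top_of_le_ne_top ENNReal.ofReal_ne_top ((measure_mono hsupp).trans hE)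
  · rw [← lintegral_indicator hE'm]
    refine lintegral_mono fun x => ?_
    by_cases hx : x ∈ E'
    · simp [hx]
    · simp [hx, ENNReal.zero_rpow_of_pos (show 0 < p by linarith)]

/-- Splitting of `f` at the level `l` of its sharp maximal function. -/
theorem exists_decomposition (hV : BallRegular (volume : Measure (Fin 2 → A)) V) [Nonempty A]
    {α : ℝ} (hα : 0 < α) (hα' : 2 ^ 40 * α ≤ 1) {p : ℝ} (hp : 1 ≤ p) :
    ∃ C : ℝ≥0, ∀ f : (Fin 2 → A) → ℝ, Measurable f → ∀ t l : ℝ, 0 < l →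
      volume {x | ENNReal.ofReal l < sharpMax α f x} ≤ ENNReal.ofReal t →
      ∃ f₁ : (Fin 2 → A) → ℝ, Measurable f₁ ∧
        (∀ z r, 0 < r → OscLE volume (2 ^ 20 * ENNReal.ofReal α) (4 * l) f₁ z r) ∧
        ∫⁻ x, ‖f x - f₁ x‖ₑ ^ p ≤ C * (rearrIntegral (fun x => sharpMax α f x ^ p) t +
          ENNReal.ofReal l ^ p * ENNReal.ofReal t) := by
  have hsf := hV.sigmaFinite
  have hp0 : 0 ≤ p := by linarith
  obtain ⟨C₀, hC₀⟩ := hV.exists_lintegral_rpow_le hp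
  -- The ratio |E'| / t. It is at least 8, so the same constant also covers the compact case, where
  -- the measure of the space is at most 8 t.
  set κ : ℝ := 64 / (2 ^ 21 * α) with hκ
  have hκ8 : 8 ≤ κ := by
    rw [hκ, le_div_iff₀ (by positivity)]
    linarith
  set a := ENNReal.ofReal α with ha
  have ha40 : 2 ^ 40 * a ≤ 1 := by
    have := ENNReal.ofReal_le_ofReal hα'
    rw [ENNReal.ofReal_mul (by norm_num), ENNReal.ofReal_one] at this
    refine le_trans (le_of_eq ?_) this
    rw [ha, ENNReal.ofReal_pow (by norm_num), ENNReal.ofReal_ofNat]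
  have ha21 : 2048 * (2 ^ 21 * a) ≤ 1 := by
    refine le_trans ?_ ha40
    rw [← mul_assoc]
    gcongr
    norm_num
  refine ⟨C₀ * ((2 : ℝ≥0) ^ (p - 1) * (4 ^ p * κ.toNNReal)), fun f hf t l hl hE => ?_⟩
  have hhm : Measurable fun x => sharpMax α f x ^ p := (measurable_sharpMax α f).pow_const p
  have hfin : ∀ (E' : Set (Fin 2 → A)) (k : ℝ), 1 ≤ k → k ≤ κ → ∀ j : ℝ, 0 ≤ j → j ≤ 4 * l →
      volume E' ≤ ENNReal.ofReal (k * t) →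
      ∫⁻ x in E', (sharpMax α f x + ENNReal.ofReal j) ^ p ≤
      ((2 : ℝ≥0) ^ (p - 1) * (4 ^ p * κ.toNNReal) : ℝ≥0) *
        (rearrIntegral (fun x => sharpMax α f x ^ p) t +
          ENNReal.ofReal l ^ p * ENNReal.ofReal t) := by
    intro E' k hk1 hk j hj0 hj hE'
    have h4 : (1 : ℝ≥0∞) ≤ 4 ^ p := ENNReal.one_le_rpow (by norm_num) (by linarith)
    have hκ0 : 0 ≤ κ := by linarith
    calc ∫⁻ x in E', (sharpMax α f x + ENNReal.ofReal j) ^ p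
        ≤ ∫⁻ x in E', 2 ^ (p - 1) * (sharpMax α f x ^ p + ENNReal.ofReal j ^ p) :=
          lintegral_mono fun x => ENNReal.rpow_add_le_mul_rpow_add_rpow _ _ hp
      _ = 2 ^ (p - 1) * ((∫⁻ x in E', sharpMax α f x ^ p) + ENNReal.ofReal j ^ p * volume E') := by
          rw [lintegral_const_mul _ (hhm.add_const _), lintegral_add_right _ measurable_const,
            setLIntegral_const]
      _ ≤ 2 ^ (p - 1) * (ENNReal.ofReal κ * rearrIntegral (fun x => sharpMax α f x ^ p) t +
            (4 ^ p * ENNReal.ofReal l ^ p) * (ENNReal.ofReal κ * ENNReal.ofReal t)) := by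
          gcongr
          · exact (setLIntegral_le_rearrIntegral hhm hE').trans ((rearrIntegral_mul_le hk1).trans
              (by gcongr))
          · rw [← ENNReal.mul_rpow_of_nonneg _ _ hp0]
            refine ENNReal.rpow_le_rpow ((ENNReal.ofReal_le_ofReal hj).trans ?_) hp0
            rw [ENNReal.ofReal_mul (by norm_num), ENNReal.ofReal_ofNat]
          · rw [← ENNReal.ofReal_mul hκ0]
            rcases le_total 0 t with ht | ht
            · exact hE'.trans (ENNReal.ofReal_le_ofReal (by gcongr))
            · refine hE'.trans ?_
              rw [ENNReal.ofReal_of_nonpos (by nlinarith)]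
              exact zero_le
      _ ≤ 2 ^ (p - 1) * ((4 ^ p * ENNReal.ofReal κ) *
            rearrIntegral (fun x => sharpMax α f x ^ p) t +
            (4 ^ p * ENNReal.ofReal l ^ p) * (ENNReal.ofReal κ * ENNReal.ofReal t)) := by
          gcongr
          exact le_mul_of_one_le_left zero_le h4
      _ = _ := by
          push_cast
          rw [ENNReal.coe_rpow_of_nonneg _ (by linarith), ENNReal.coe_rpow_of_nonneg _ hp0]
          rw [show ((κ.toNNReal : ℝ≥0) : ℝ≥0∞) = ENNReal.ofReal κ from rfl]
          push_cast
          ring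
  by_cases hcase : ∃ r₀ > 0, 8 * ENNReal.ofReal t < V r₀
  · obtain ⟨r₀, hr₀, htr⟩ := hcase
    obtain ⟨f₁, hf₁m, hf₁, M, hMm, hM, hsmall, hsupp, E', hE'm, hE'v, hint⟩ :=
      exists_sub_extension hV hα hα' hp hκ hf hl hr₀ htr hE
    refine ⟨f₁, hf₁m, hf₁, ?_⟩
    refine (hC₀ _ ha21 _ (hf.sub hf₁m) M hMm hM hsmall hsupp).trans ?_
    rw [ENNReal.coe_mul, mul_assoc]
    gcongr
    exact hint.trans (hfin E' κ (by linarith) le_rfl (4 * l) (by linarith) le_rfl hE'v)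
  · push Not at hcase
    obtain ⟨c, hM, hsmall, huniv⟩ := exists_sub_const hV (f := f) hα' hl hcase
    refine ⟨fun _ => c, measurable_const, fun z r hr => OscLE.const _ (by linarith) c z r, ?_⟩
    refine (hC₀ a (le_trans ?_ ha40) _ (hf.sub_const c) _
      ((measurable_sharpMax α f).add_const (ENNReal.ofReal l)) hM hsmall
      (ne_top_of_le_ne_top ENNReal.ofReal_ne_top ((measure_mono (subset_univ _)).trans huniv))).trans
      ?_
    · gcongr
      norm_num
    · rw [ENNReal.coe_mul, mul_assoc, ← setLIntegral_univ]
      gcongr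
      exact hfin univ 8 (by norm_num) hκ8 l hl.le (by linarith) huniv

end Decomposition

/-! ### Upper bound for the K-functional -/

section KFunctional

variable {A : Type} [PseudoMetricSpace A] [MeasureSpace A] {V : ℝ → ℝ≥0∞}

theorem eLpNorm_ofReal {X : Type*} [MeasurableSpace X] {μ : Measure X} {p : ℝ} (hp : 0 < p)
    (f : X → ℝ) :
    eLpNorm f (ENNReal.ofReal p) μ = (∫⁻ x, ‖f x‖ₑ ^ p ∂μ) ^ (1 / p) := by
  rw [eLpNorm_eq_lintegral_rpow_enorm_toReal (by simpa using hp) ENNReal.ofReal_ne_top,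
    ENNReal.toReal_ofReal hp.le]

/-- The mean is optimal up to a factor 2: it differs from c by at most the average of |f - c|. -/
theorem lintegral_enorm_sub_average_le {X : Type*} [MeasurableSpace X] {μ : Measure X} {B : Set X}
    (h0 : μ B ≠ 0) (htop : μ B ≠ ∞) {f : X → ℝ} (hf : IntegrableOn f B μ) (c : ℝ) :
    ∫⁻ y in B, ‖f y - ⨍ w in B, f w ∂μ‖ₑ ∂μ ≤ 2 * ∫⁻ y in B, ‖f y - c‖ₑ ∂μ := by
  set m := ⨍ w in B, f w ∂μ with hm
  have hv0 : (μ B).toReal ≠ 0 := ENNReal.toReal_ne_zero.2 ⟨h0, htop⟩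
  have hmul : (μ B).toReal * (c - m) = - ∫ y in B, (f y - c) ∂μ := by
    rw [integral_sub hf (integrableOn_const htop), setIntegral_const, hm, setAverage_eq,
      smul_eq_mul, smul_eq_mul, measureReal_def]
    field_simp
    ring
  have hcm : ‖c - m‖ₑ * μ B ≤ ∫⁻ y in B, ‖f y - c‖ₑ ∂μ := by
    calc ‖c - m‖ₑ * μ B = ‖(μ B).toReal * (c - m)‖ₑ := by
          rw [enorm_mul, Real.enorm_eq_ofReal ENNReal.toReal_nonneg, ENNReal.ofReal_toReal htop,
            mul_comm]
      _ = ‖∫ y in B, (f y - c) ∂μ‖ₑ := by rw [hmul, enorm_neg]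
      _ ≤ _ := enorm_integral_le_lintegral_enorm _
  calc ∫⁻ y in B, ‖f y - m‖ₑ ∂μ ≤ ∫⁻ y in B, (‖f y - c‖ₑ + ‖c - m‖ₑ) ∂μ := by
        refine lintegral_mono fun y => ?_
        rw [show f y - m = (f y - c) + (c - m) by ring]
        exact enorm_add_le _ _
    _ = ∫⁻ y in B, ‖f y - c‖ₑ ∂μ + ‖c - m‖ₑ * μ B := by
        rw [lintegral_add_right _ measurable_const, setLIntegral_const]
    _ ≤ _ := by
        rw [two_mul]
        gcongr

variable [BorelSpace A] [SecondCountableTopology A]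

theorem memBMO_of_oscLE (hV : BallRegular (volume : Measure (Fin 2 → A)) V) {b : ℝ≥0∞}
    (hb : 2 ^ 19 * b ≤ 1) {f : (Fin 2 → A) → ℝ} (hf : Measurable f) {l : ℝ} (hl : 0 < l)
    (h : ∀ z r, 0 < r → OscLE volume b l f z r) :
    MemBMO f ∧ bmoNorm f ≤ ENNReal.ofReal (4 * l) := by
  have hint : ∀ z r, 0 < r → IntegrableOn f (ball z r) := by
    intro z r hr
    obtain ⟨c, hc⟩ := hV.meanOsc_le hb hf hl h z hr
    have h1 : IntegrableOn (fun y => f y - c) (ball z r) := by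
      refine ⟨(hf.sub_const c).aestronglyMeasurable, ?_⟩
      exact hc.trans_lt (ENNReal.mul_lt_top ENNReal.ofReal_lt_top (hV.ne_top r hr).lt_top)
    have h2 : IntegrableOn (fun _ : Fin 2 → A => c) (ball z r) :=
      integrableOn_const (by rw [hV.measure_ball z r hr]; exact hV.ne_top r hr)
    have h3 := h1.add h2
    refine h3.congr_fun (fun y _ => ?_) measurableSet_ball
    simp
  have hloc : LocallyIntegrable f := fun x => ⟨ball x 1, ball_mem_nhds x one_pos, hint x 1 one_pos⟩
  have hle : bmoNorm f ≤ ENNReal.ofReal (4 * l) := by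
    refine iSup_le fun z => iSup_le fun r => iSup_le fun hr => ?_
    rw [cube_eq_ball z hr, hV.measure_ball z r hr]
    obtain ⟨c, hc⟩ := hV.meanOsc_le hb hf hl h z hr
    refine ENNReal.div_le_of_le_mul ?_
    refine (lintegral_enorm_sub_average_le ?_ ?_ (hint z r hr) c).trans ?_
    · rw [hV.measure_ball z r hr]; exact hV.pos r hr
    · rw [hV.measure_ball z r hr]; exact hV.ne_top r hr
    · calc 2 * ∫⁻ y in ball z r, ‖f y - c‖ₑ ≤ 2 * (ENNReal.ofReal (2 * l) * V r) := by gcongr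
        _ = _ := by
          have : ENNReal.ofReal (4 * l) = 2 * ENNReal.ofReal (2 * l) := by
            rw [← ENNReal.ofReal_ofNat 2, ← ENNReal.ofReal_mul (by norm_num)]
            ring_nf
          rw [this, mul_assoc]
  exact ⟨⟨hloc, hle.trans_lt ENNReal.ofReal_lt_top⟩, hle⟩

/-- Split at a level l just above ρ = g^*(t), with g the sharp maximal function. Then |{g > l}| ≤ t,
and t^{1/p} ρ is itself at most (∫_0^t (g^*)^p)^{1/p} by monotonicity, so both pieces are
controlled. -/
theorem exists_peetreK_le (hV : BallRegular (volume : Measure (Fin 2 → A)) V) [Nonempty A]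
    {α : ℝ} (hα : 0 < α) (hα' : 2 ^ 40 * α ≤ 1) {p : ℝ} (hp : 1 ≤ p) :
    ∃ C : ℝ≥0, ∀ f : (Fin 2 → A) → ℝ, Measurable f → ∀ t : ℝ, 0 < t →
      peetreK p (t ^ (1 / p)) f ≤ C * rearrIntegral (fun x => sharpMax α f x ^ p) t ^ (1 / p) := by
  have hp0 : 0 < p := by linarith
  have hp1 : 1 / p ≤ 1 := by rw [div_le_one hp0]; exact hp
  have hp1' : 0 ≤ 1 / p := by positivity
  obtain ⟨C₀, hC₀⟩ := exists_decomposition hV hα hα' hp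
  set C₁ : ℝ≥0 := C₀ ^ (1 / p) + 16 with hC₁
  refine ⟨C₁ * 2, fun f hf t ht => ?_⟩
  set J := rearrIntegral (fun x => sharpMax α f x ^ p) t with hJ
  rcases eq_or_ne J ∞ with hJt | hJt
  · rw [hJt, ENNReal.top_rpow_of_pos (by positivity), ENNReal.mul_top]
    · exact le_top
    · simp [hC₁]
  have h20 : 2 ^ 19 * (2 ^ 20 * ENNReal.ofReal α) ≤ 1 := by
    have := ENNReal.ofReal_le_ofReal hα'
    rw [ENNReal.ofReal_mul (by norm_num), ENNReal.ofReal_one, ENNReal.ofReal_pow (by norm_num),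
      ENNReal.ofReal_ofNat] at this
    refine le_trans ?_ this
    rw [← mul_assoc]
    gcongr
    norm_num
  have hstep : ∀ l : ℝ, 0 < l → volume {x | ENNReal.ofReal l < sharpMax α f x} ≤ ENNReal.ofReal t →
      peetreK p (t ^ (1 / p)) f ≤
        C₁ * (J ^ (1 / p) + ENNReal.ofReal t ^ (1 / p) * ENNReal.ofReal l) := by
    intro l hl hlt
    obtain ⟨f₁, hf₁m, hf₁, hint⟩ := hC₀ f hf t l hl hlt
    obtain ⟨hmem, hbmo⟩ := memBMO_of_oscLE hV h20 hf₁m (by linarith : 0 < 4 * l) hf₁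
    have hnorm : eLpNorm (fun x => f x - f₁ x) (ENNReal.ofReal p) volume ≤
        (C₀ : ℝ≥0∞) ^ (1 / p) * (J ^ (1 / p) + ENNReal.ofReal t ^ (1 / p) * ENNReal.ofReal l) := by
      rw [eLpNorm_ofReal hp0]
      calc _ ≤ ((C₀ : ℝ≥0∞) * (J + ENNReal.ofReal l ^ p * ENNReal.ofReal t)) ^ (1 / p) :=
            ENNReal.rpow_le_rpow hint hp1'
        _ = (C₀ : ℝ≥0∞) ^ (1 / p) * (J + ENNReal.ofReal l ^ p * ENNReal.ofReal t) ^ (1 / p) :=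
            ENNReal.mul_rpow_of_nonneg _ _ hp1'
        _ ≤ (C₀ : ℝ≥0∞) ^ (1 / p) *
              (J ^ (1 / p) + (ENNReal.ofReal l ^ p * ENNReal.ofReal t) ^ (1 / p)) := by
            gcongr
            exact ENNReal.rpow_add_le_add_rpow _ _ hp1' hp1
        _ = _ := by
            rw [ENNReal.mul_rpow_of_nonneg _ _ hp1', ← ENNReal.rpow_mul, mul_one_div_cancel hp0.ne',
              ENNReal.rpow_one, mul_comm (ENNReal.ofReal l)]
    have hLp : MemLp (fun x => f x - f₁ x) (ENNReal.ofReal p) := by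
      refine ⟨(hf.sub hf₁m).aestronglyMeasurable, hnorm.trans_lt ?_⟩
      refine ENNReal.mul_lt_top (ENNReal.rpow_lt_top_of_nonneg hp1' ENNReal.coe_ne_top) ?_
      refine ENNReal.add_lt_top.2 ⟨ENNReal.rpow_lt_top_of_nonneg hp1' hJt, ?_⟩
      exact ENNReal.mul_lt_top (ENNReal.rpow_lt_top_of_nonneg hp1' ENNReal.ofReal_ne_top)
        ENNReal.ofReal_lt_top
    have hsum : f =ᵐ[volume] (fun x => f x - f₁ x) + f₁ := ae_of_all _ fun x => by simp
    have hK : peetreK p (t ^ (1 / p)) f ≤ eLpNorm (fun x => f x - f₁ x) (ENNReal.ofReal p) volume +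
        ENNReal.ofReal (t ^ (1 / p)) * bmoNorm f₁ := by
      unfold peetreK
      exact iInf₂_le_of_le _ f₁ (iInf₂_le_of_le hLp hmem (iInf_le _ hsum))
    refine hK.trans ?_
    · rw [← ENNReal.ofReal_rpow_of_pos ht]
      calc _ ≤ (C₀ : ℝ≥0∞) ^ (1 / p) *
            (J ^ (1 / p) + ENNReal.ofReal t ^ (1 / p) * ENNReal.ofReal l) +
            16 * (J ^ (1 / p) + ENNReal.ofReal t ^ (1 / p) * ENNReal.ofReal l) := by
            refine add_le_add hnorm ?_
            calc ENNReal.ofReal t ^ (1 / p) * bmoNorm f₁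
                ≤ ENNReal.ofReal t ^ (1 / p) * ENNReal.ofReal (4 * (4 * l)) := by gcongr
              _ = 16 * (ENNReal.ofReal t ^ (1 / p) * ENNReal.ofReal l) := by
                rw [← mul_assoc, show (4 : ℝ) * 4 = 16 by norm_num,
                  ENNReal.ofReal_mul (by norm_num), ENNReal.ofReal_ofNat]
                ring
              _ ≤ _ := by gcongr; exact le_add_self
        _ = _ := by
            rw [hC₁, ENNReal.coe_add, ENNReal.coe_rpow_of_nonneg _ hp1', add_mul]
            rfl
  have hρJ : ENNReal.ofReal t ^ (1 / p) * rearrangement (sharpMax α f) (ENNReal.ofReal t) ≤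
      J ^ (1 / p) := by
    have h1 := mul_rearrangement_le_rearrIntegral (h := fun x => sharpMax α f x ^ p) t
    rw [rearrangement_rpow hp0] at h1
    have h2 := ENNReal.rpow_le_rpow h1 hp1'
    rwa [ENNReal.mul_rpow_of_nonneg _ _ hp1', ← ENNReal.rpow_mul, mul_one_div_cancel hp0.ne',
      ENNReal.rpow_one] at h2
  have ht0 : ENNReal.ofReal t ^ (1 / p) ≠ 0 := by
    have : ENNReal.ofReal t ≠ 0 := by simpa using ht
    simp [this, ENNReal.rpow_eq_zero_iff]
  have hρ : rearrangement (sharpMax α f) (ENNReal.ofReal t) ≠ ∞ := by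
    intro h
    rw [h, ENNReal.mul_top ht0, top_le_iff, ENNReal.rpow_eq_top_iff] at hρJ
    rcases hρJ with h1 | h1
    · linarith [h1.2]
    · exact hJt h1.1
  set ρ := rearrangement (sharpMax α f) (ENNReal.ofReal t) with hρdef
  refine ENNReal.le_of_forall_pos_le_add fun ε hε _ => ?_
  -- The splitting needs l > 0 whereas ρ may vanish; δ makes the extra cost at most ε.
  set δ : ℝ := ε / ((C₁ + 1) * t ^ (1 / p)) with hδ
  have htp : 0 < t ^ (1 / p) := Real.rpow_pos_of_pos ht _
  have hε' : (0 : ℝ) < ε := hε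
  have hδ0 : 0 < δ := by positivity
  have hl : ENNReal.ofReal (ρ.toReal + δ) = ρ + ENNReal.ofReal δ := by
    rw [ENNReal.ofReal_add ENNReal.toReal_nonneg hδ0.le, ENNReal.ofReal_toReal hρ]
  refine (hstep (ρ.toReal + δ) (by positivity) ?_).trans ?_
  · rw [hl]
    exact rearrangement_le_iff.1 le_self_add
  · rw [hl, mul_add (ENNReal.ofReal t ^ (1 / p)), ← add_assoc, mul_add]
    refine add_le_add ?_ ?_
    · calc (C₁ : ℝ≥0∞) * (J ^ (1 / p) + ENNReal.ofReal t ^ (1 / p) * ρ)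
          ≤ C₁ * (J ^ (1 / p) + J ^ (1 / p)) := by gcongr
        _ = _ := by push_cast; ring
    · rw [ENNReal.ofReal_rpow_of_pos ht, ← ENNReal.ofReal_mul htp.le, ← ENNReal.ofReal_coe_nnreal,
        ← ENNReal.ofReal_mul (NNReal.coe_nonneg C₁), ← ENNReal.ofReal_coe_nnreal]
      refine ENNReal.ofReal_le_ofReal ?_
      rw [hδ]
      have hC₁0 : (0 : ℝ) ≤ C₁ := C₁.2
      have : (C₁ : ℝ) * (t ^ (1 / p) * (ε / ((C₁ + 1) * t ^ (1 / p)))) = C₁ / (C₁ + 1) * ε := by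
        field_simp
      rw [this]
      have h1 : (C₁ : ℝ) / (C₁ + 1) ≤ 1 := by
        rw [div_le_one (by positivity)]; linarith
      nlinarith

end KFunctional

/-! ### Lower bound for the K-functional -/

section LowerBound


variable {A : Type} [MeasureSpace A] {V : ℝ → ℝ≥0∞}

theorem rearrangement_add_le {g h k : (Fin 2 → A) → ℝ≥0∞} (hk : ∀ x, k x ≤ g x + h x)
    (s t : ℝ≥0∞) : rearrangement k (s + t) ≤ rearrangement g s + rearrangement h t := by
  rw [rearrangement_le_iff]
  have hsub : {x | rearrangement g s + rearrangement h t < k x} ⊆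
      {x | rearrangement g s < g x} ∪ {x | rearrangement h t < h x} := by
    intro x hx
    by_contra hc
    simp only [mem_union, mem_ofPred_eq, not_or, not_lt] at hc
    exact absurd (hx.trans_le (hk x)) (not_lt.2 (add_le_add hc.1 hc.2))
  refine (measure_mono hsub).trans ((measure_union_le _ _).trans (add_le_add ?_ ?_))
  · exact rearrangement_le_iff.1 le_rfl
  · exact rearrangement_le_iff.1 le_rfl

variable [PseudoMetricSpace A]

/-- The local maximal function with parameter `b`: the analogue of `sharpMax` without subtraction of
constants. -/
noncomputable def localMax (b : ℝ≥0∞) (g : (Fin 2 → A) → ℝ≥0∞) (x : Fin 2 → A) : ℝ≥0∞ :=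
  ⨆ (z : Fin 2 → A) (r : ℝ) (_ : 0 < r) (_ : x ∈ cube z r),
    rearrangement ((cube z r).indicator g) (b * volume (cube z r))

variable [BorelSpace A] [SecondCountableTopology A]

theorem measurable_localMax (b : ℝ≥0∞) (g : (Fin 2 → A) → ℝ≥0∞) : Measurable (localMax b g) :=
  measurable_of_Ioi fun s => by
    have : {x | s < localMax b g x} = _ := setOf_lt_iSup_cube _ s
    change MeasurableSet {x | s < localMax b g x}
    rw [this]
    exact (isOpen_setOf_exists_ball _).measurableSet

/-- Where the local maximal function exceeds s, some ball meets {g > s} in proportion at least b.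
The weak type estimate therefore compares the two distribution functions at the same level, which
gives strong bounds for all p > 0 at once. -/
theorem mul_lintegral_localMax_rpow_le (hV : BallRegular (volume : Measure (Fin 2 → A)) V)
    (b : ℝ≥0∞) (hb : b ≠ ∞) {g : (Fin 2 → A) → ℝ≥0∞} (hg : Measurable g) {p : ℝ} (hp : 0 < p) :
    b * ∫⁻ x, localMax b g x ^ p ≤ 64 * ∫⁻ x, g x ^ p := by
  have hsf := hV.sigmaFinite
  rw [lintegral_eq_lintegral_measure_lt ((measurable_localMax b g).pow_const p),
    lintegral_eq_lintegral_measure_lt (hg.pow_const p), ← lintegral_const_mul' _ _ hb,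
    ← lintegral_const_mul' _ _ (by simp)]
  refine setLIntegral_mono' measurableSet_Ioi fun σ hσ => ?_
  simp_rw [BallRegular.rpow_lt_aux hp hσ]
  set s := ENNReal.ofReal (σ ^ (1 / p))
  have hG : MeasurableSet {x | s < g x} := measurableSet_lt measurable_const hg
  refine le_trans ?_ (hV.mul_measure_exists_ball_le hG b)
  gcongr
  have hset : {x | s < localMax b g x} = _ := setOf_lt_iSup_cube _ s
  intro hx
  obtain ⟨z, r, hr, hx, hlt⟩ := hset.subset hx
  refine ⟨z, r, hr, hx, ?_⟩
  rw [lt_rearrangement_iff, setOf_lt_indicator, cube_eq_ball z hr, hV.measure_ball z r hr] at hlt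
  exact hlt.le.trans (measure_mono fun y hy => ⟨hy.2, hy.1⟩)

theorem rearrangement_sub_average_le (hV : BallRegular (volume : Measure (Fin 2 → A)) V)
    {b : ℝ≥0∞} (hb0 : b ≠ 0) (hb : b ≠ ∞) {f : (Fin 2 → A) → ℝ} (hf : AEMeasurable f)
    (z : Fin 2 → A) {r : ℝ} (hr : 0 < r) :
    rearrangement ((ball z r).indicator fun y => ‖f y - ⨍ w in ball z r, f w‖ₑ)
      (b * volume (ball z r)) ≤ b⁻¹ * bmoNorm f := by
  set m := ⨍ w in ball z r, f w with hm
  have hbmo : ∫⁻ y in ball z r, ‖f y - m‖ₑ ≤ bmoNorm f * V r := by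
    have h1 : (∫⁻ y in cube z r, ‖f y - ⨍ w in cube z r, f w‖ₑ) / volume (cube z r) ≤ bmoNorm f :=
      le_iSup_of_le z (le_iSup_of_le r (le_iSup_of_le hr le_rfl))
    rw [cube_eq_ball z hr, hV.measure_ball z r hr] at h1
    exact (ENNReal.div_le_iff (hV.pos r hr) (hV.ne_top r hr)).1 h1
  refine le_of_forall_gt fun s hs => ?_
  -- A level strictly in between is positive and finite, so it can be cancelled in Chebyshev's
  -- inequality.
  obtain ⟨s', hs', hs's⟩ := exists_between hs
  refine lt_of_le_of_lt ?_ hs's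
  rw [rearrangement_le_iff, setOf_lt_indicator, hV.measure_ball z r hr]
  have hs0 : s' ≠ 0 := (zero_le.trans_lt hs').ne'
  have hst : s' ≠ ∞ := (hs's.trans_le le_top).ne
  have h2 := mul_meas_ge_le_lintegral₀ (μ := volume.restrict (ball z r)) (f := fun y => ‖f y - m‖ₑ)
    ((hf.sub_const m).enorm.restrict) s'
  rw [Measure.restrict_apply' measurableSet_ball] at h2
  have h3 : bmoNorm f ≤ b * s' := by
    calc bmoNorm f = b * (b⁻¹ * bmoNorm f) := by
          rw [← mul_assoc, ENNReal.mul_inv_cancel hb0 hb, one_mul]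
      _ ≤ b * s' := by gcongr
  have h4 : s' * volume {y | y ∈ ball z r ∧ s' < ‖f y - m‖ₑ} ≤ s' * (b * V r) := by
    calc s' * volume {y | y ∈ ball z r ∧ s' < ‖f y - m‖ₑ}
        ≤ s' * volume ({y | s' ≤ ‖f y - m‖ₑ} ∩ ball z r) := by
          gcongr
          rintro y ⟨h5, h6⟩
          exact ⟨h6.le, h5⟩
      _ ≤ bmoNorm f * V r := h2.trans hbmo
      _ ≤ b * s' * V r := by gcongr
      _ = _ := by ring
  exact (ENNReal.mul_le_mul_iff_right hs0 hst).1 h4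

/-- Take the mean of f₁ as the constant and give half of the proportion α to each summand;
Chebyshev's inequality handles f₁. -/
theorem sharpMax_add_le (hV : BallRegular (volume : Measure (Fin 2 → A)) V) {α : ℝ} (hα : 0 < α)
    {f₀ f₁ : (Fin 2 → A) → ℝ} (hf₁ : AEMeasurable f₁) (x : Fin 2 → A) :
    sharpMax α (f₀ + f₁) x ≤ localMax (ENNReal.ofReal (α / 2)) (fun y => ‖f₀ y‖ₑ) x +
      (ENNReal.ofReal (α / 2))⁻¹ * bmoNorm f₁ := by
  set b := ENNReal.ofReal (α / 2) with hb
  have hb0 : b ≠ 0 := by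
    rw [hb, Ne, ENNReal.ofReal_eq_zero, not_le]
    positivity
  refine iSup_le fun z => iSup_le fun r => iSup_le fun hr => iSup_le fun hx => ?_
  refine (iInf_le _ (⨍ w in ball z r, f₁ w)).trans ?_
  have hsplit : ENNReal.ofReal α * volume (cube z r) = b * volume (cube z r) + b * volume (cube z r) := by
    rw [← add_mul, hb, ← ENNReal.ofReal_add (by positivity) (by positivity), add_halves]
  rw [hsplit]
  refine (rearrangement_add_le (g := (cube z r).indicator fun y => ‖f₀ y‖ₑ)
    (h := (cube z r).indicator fun y => ‖f₁ y - ⨍ w in ball z r, f₁ w‖ₑ) ?_ _ _).trans ?_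
  · intro y
    by_cases hy : y ∈ cube z r
    · simp only [hy, indicator_of_mem, Pi.add_apply]
      rw [add_sub_assoc]
      exact enorm_add_le _ _
    · simp [hy]
  · refine add_le_add ?_ ?_
    · exact le_iSup_of_le z (le_iSup_of_le r (le_iSup_of_le hr (le_iSup_of_le hx le_rfl)))
    · rw [cube_eq_ball z hr]
      exact rearrangement_sub_average_le hV hb0 ENNReal.ofReal_ne_top hf₁ z hr

theorem exists_le_peetreK (hV : BallRegular (volume : Measure (Fin 2 → A)) V)
    {α : ℝ} (hα : 0 < α) {p : ℝ} (hp : 1 ≤ p) :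
    ∃ C : ℝ≥0, ∀ f : (Fin 2 → A) → ℝ, ∀ t : ℝ, 0 < t →
      rearrIntegral (fun x => sharpMax α f x ^ p) t ^ (1 / p) ≤ C * peetreK p (t ^ (1 / p)) f := by
  have hsf := hV.sigmaFinite
  have hp0 : 0 < p := by linarith
  have hp1' : 0 ≤ 1 / p := by positivity
  set b := ENNReal.ofReal (α / 2) with hb
  have hb0 : b ≠ 0 := by
    rw [hb, Ne, ENNReal.ofReal_eq_zero, not_le]
    positivity
  have hbt : b ≠ ∞ := ENNReal.ofReal_ne_top
  set K : ℝ≥0∞ := 2 ^ (p - 1) * (b⁻¹ * 64 + b⁻¹ ^ p) with hK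
  have hKt : K ≠ ∞ := by
    refine ENNReal.mul_ne_top (ENNReal.rpow_ne_top_of_nonneg (by linarith) (by simp)) ?_
    refine ENNReal.add_ne_top.2 ⟨ENNReal.mul_ne_top (by simpa using hb0) (by simp), ?_⟩
    exact ENNReal.rpow_ne_top_of_nonneg hp0.le (by simpa using hb0)
  have hKp : K ^ (1 / p) ≠ ∞ := ENNReal.rpow_ne_top_of_nonneg hp1' hKt
  refine ⟨(K ^ (1 / p)).toNNReal, fun f t ht => ?_⟩
  rw [ENNReal.coe_toNNReal hKp]
  have key : ∀ f₀ f₁ : (Fin 2 → A) → ℝ, MemLp f₀ (ENNReal.ofReal p) → MemBMO f₁ →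
      f =ᵐ[volume] f₀ + f₁ → rearrIntegral (fun x => sharpMax α f x ^ p) t ^ (1 / p) ≤
      K ^ (1 / p) *
        (eLpNorm f₀ (ENNReal.ofReal p) volume + ENNReal.ofReal (t ^ (1 / p)) * bmoNorm f₁) := by
    intro f₀ f₁ hf₀ hf₁ hfe
    obtain ⟨g, hg, hfg⟩ := hf₀.1.aemeasurable
    have hf₁m : AEMeasurable f₁ := hf₁.1.aestronglyMeasurable.aemeasurable
    have hfe' : f =ᵐ[volume] g + f₁ := hfe.trans (hfg.add (ae_eq_refl f₁))
    rw [sharpMax_congr_ae hfe', eLpNorm_congr_ae hfg, eLpNorm_ofReal hp0,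
      ← ENNReal.ofReal_rpow_of_pos ht]
    set G := localMax b (fun y => ‖g y‖ₑ) with hG
    set N := bmoNorm f₁ with hN
    have hGm : Measurable G := measurable_localMax _ _
    have hle : ∀ x, sharpMax α (g + f₁) x ^ p ≤
        2 ^ (p - 1) * G x ^ p + 2 ^ (p - 1) * (b⁻¹ * N) ^ p := by
      intro x
      rw [← mul_add]
      exact (ENNReal.rpow_le_rpow (sharpMax_add_le hV hα hf₁m x) hp0.le).trans
        (ENNReal.rpow_add_le_mul_rpow_add_rpow _ _ hp)
    have h1 := rearrIntegral_le_add ((hGm.pow_const p).const_mul _) hle t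
    have h2 : ∫⁻ x, G x ^ p ≤ b⁻¹ * (64 * ∫⁻ x, ‖g x‖ₑ ^ p) := by
      calc ∫⁻ x, G x ^ p = b⁻¹ * (b * ∫⁻ x, G x ^ p) := by
            rw [← mul_assoc, ENNReal.inv_mul_cancel hb0 hbt, one_mul]
        _ ≤ _ := by
            refine mul_le_mul_right ?_ _
            exact mul_lintegral_localMax_rpow_le hV b hbt hg.enorm hp0
    set a := ∫⁻ x, ‖g x‖ₑ ^ p with ha
    have h3 : rearrIntegral (fun x => sharpMax α (g + f₁) x ^ p) t ≤
        K * (a + ENNReal.ofReal t * N ^ p) := by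
      rw [lintegral_const_mul _ (hGm.pow_const p)] at h1
      calc _ ≤ 2 ^ (p - 1) * (∫⁻ x, G x ^ p) + ENNReal.ofReal t * (2 ^ (p - 1) * (b⁻¹ * N) ^ p) := h1
        _ ≤ 2 ^ (p - 1) * (b⁻¹ * (64 * a)) +
            ENNReal.ofReal t * (2 ^ (p - 1) * (b⁻¹ * N) ^ p) := by gcongr
        _ = 2 ^ (p - 1) * ((b⁻¹ * 64) * a + b⁻¹ ^ p * (ENNReal.ofReal t * N ^ p)) := by
            rw [ENNReal.mul_rpow_of_nonneg _ _ hp0.le]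
            ring
        _ ≤ 2 ^ (p - 1) * ((b⁻¹ * 64 + b⁻¹ ^ p) * a +
            (b⁻¹ * 64 + b⁻¹ ^ p) * (ENNReal.ofReal t * N ^ p)) := by
            gcongr
            · exact le_self_add
            · exact le_add_self
        _ = _ := by rw [hK]; ring
    have h4 : a + ENNReal.ofReal t * N ^ p ≤ (a ^ (1 / p) + ENNReal.ofReal t ^ (1 / p) * N) ^ p := by
      have := ENNReal.add_rpow_le_rpow_add (a ^ (1 / p)) (ENNReal.ofReal t ^ (1 / p) * N) hp
      rwa [ENNReal.mul_rpow_of_nonneg _ _ hp0.le, ← ENNReal.rpow_mul, ← ENNReal.rpow_mul,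
        one_div_mul_cancel hp0.ne', ENNReal.rpow_one, ENNReal.rpow_one] at this
    calc _ ≤ (K * (a ^ (1 / p) + ENNReal.ofReal t ^ (1 / p) * N) ^ p) ^ (1 / p) :=
          ENNReal.rpow_le_rpow (h3.trans (by gcongr)) hp1'
      _ = _ := by
          rw [ENNReal.mul_rpow_of_nonneg _ _ hp1', ← ENNReal.rpow_mul, mul_one_div_cancel hp0.ne',
            ENNReal.rpow_one]
  by_cases hK0 : K ^ (1 / p) = 0
  · have hKpos : K ≠ 0 := by
      refine mul_ne_zero ?_ ?_
      · exact (ENNReal.rpow_pos (by norm_num) (by simp)).ne'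
      · have : b⁻¹ * 64 ≠ 0 := mul_ne_zero (ENNReal.inv_ne_zero.2 hbt) (by norm_num)
        intro h
        exact this (add_eq_zero.1 h).1
    exact absurd hK0 (ENNReal.rpow_pos (pos_iff_ne_zero.2 hKpos) hKt).ne'
  · rw [mul_comm, ← ENNReal.div_le_iff_le_mul (Or.inl hK0) (Or.inl hKp)]
    unfold peetreK
    refine le_iInf₂ fun f₀ f₁ => le_iInf₂ fun hf₀ hf₁ => le_iInf fun hfe => ?_
    rw [ENNReal.div_le_iff_le_mul (Or.inl hK0) (Or.inl hKp), mul_comm]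
    exact key f₀ f₁ hf₀ hf₁ hfe

end LowerBound

/-! ### The plane and the torus -/

section Instances

theorem ballRegular_plane :
    BallRegular (volume : Measure (Fin 2 → ℝ)) fun r => ENNReal.ofReal ((2 * r) ^ 2) := by
  refine ⟨fun x r hr => ?_, fun r hr => ?_, fun r s hr hrs => ?_, fun r hr => ?_, fun r hr => ?_,
    Or.inr fun M hM => ?_⟩
  · rw [Real.volume_pi_ball x hr, Fintype.card_fin]
  · rw [← ENNReal.ofReal_ofNat 4, ← ENNReal.ofReal_mul (by norm_num)]
    exact ENNReal.ofReal_le_ofReal (by ring_nf; rfl)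
  · exact ENNReal.ofReal_le_ofReal (by gcongr)
  · rw [Ne, ENNReal.ofReal_eq_zero, not_le]
    positivity
  · exact ENNReal.ofReal_ne_top
  · refine ⟨M.toReal + 1, by positivity, ?_⟩
    rw [ENNReal.lt_ofReal_iff_toReal_lt hM]
    have : 0 ≤ M.toReal := ENNReal.toReal_nonneg
    nlinarith

theorem ballRegular_torus :
    BallRegular (volume : Measure (Fin 2 → UnitAddCircle))
      fun r => ENNReal.ofReal (min 1 (2 * r)) ^ 2 := by
  refine ⟨fun x r hr => ?_, fun r hr => ?_, fun r s hr hrs => ?_, fun r hr => ?_, fun r hr => ?_,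
    Or.inl ⟨1, one_pos, fun x => ?_⟩⟩
  · rw [volume_pi_ball x hr]
    have : ∀ i, volume (ball (x i) r) = ENNReal.ofReal (min 1 (2 * r)) := fun i => by
      rw [← AddCircle.volume_closedBall, measure_congr AddCircle.closedBall_ae_eq_ball]
    simp [this]
  · have h1 : ENNReal.ofReal (min 1 (2 * (2 * r))) ≤ 2 * ENNReal.ofReal (min 1 (2 * r)) := by
      rw [← ENNReal.ofReal_ofNat 2, ← ENNReal.ofReal_mul (by norm_num)]
      refine ENNReal.ofReal_le_ofReal ?_
      rw [mul_min_of_nonneg _ _ (by norm_num)]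
      exact min_le_min (by norm_num) le_rfl
    calc _ ≤ (2 * ENNReal.ofReal (min 1 (2 * r))) ^ 2 := by gcongr
      _ = _ := by rw [mul_pow]; norm_num
  · gcongr
  · have : 0 < min 1 (2 * r) := lt_min one_pos (by linarith)
    simpa using this
  · exact ENNReal.pow_ne_top ENNReal.ofReal_ne_top
  · ext y
    simp only [mem_univ, iff_true]
    rw [mem_ball, dist_pi_lt_iff one_pos]
    intro i
    rw [dist_eq_norm]
    have := AddCircle.norm_le_half_period (p := (1 : ℝ)) (x := y i - x i) one_ne_zero
    rw [abs_one] at this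
    linarith

end Instances

/-! ### Growth functions and the Yudovich function -/

section Growth

variable {Θ : ℝ → ℝ} {D : ℝ}

namespace IsGrowthFunction

theorem one_le (h : IsGrowthFunction Θ D) : 1 ≤ D := by
  have h1 := h.pos 2 one_lt_two
  have h2 := h.mono 2 4 one_lt_two (by norm_num)
  have h3 := h.doubling 2 one_lt_two
  norm_num at h3
  by_contra! hc
  nlinarith

theorem pow_doubling (h : IsGrowthFunction Θ D) {p : ℝ} (hp : 1 < p) (k : ℕ) :
    Θ (2 ^ k * p) ≤ D ^ k * Θ p := by
  induction k with
  | zero => simp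
  | succ k ih =>
    have h2 : (1 : ℝ) ≤ 2 ^ k := one_le_pow₀ one_le_two
    have h3 := h.doubling (2 ^ k * p) (by nlinarith)
    have h4 := h.one_le
    calc Θ (2 ^ (k + 1) * p) = Θ (2 * (2 ^ k * p)) := by ring_nf
      _ ≤ D * (D ^ k * Θ p) := h3.trans (by gcongr)
      _ = _ := by ring

/-- Doubling also keeps Θ away from zero as p tends to 1. -/
theorem lower_bound (h : IsGrowthFunction Θ D) {p : ℝ} (hp : 1 < p) : Θ 2 / D ≤ Θ p := by
  have h1 := h.one_le
  rw [div_le_iff₀ (by linarith), mul_comm]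
  exact (h.mono 2 (2 * p) one_lt_two (by linarith)).trans (h.doubling p hp)

theorem lower_bound_pos (h : IsGrowthFunction Θ D) : 0 < Θ 2 / D :=
  div_pos (h.pos 2 one_lt_two) (by linarith [h.one_le])

/-- A doubling function grows at most exponentially, uniformly at all scales. -/
theorem exists_le_mul_exp (h : IsGrowthFunction Θ D) :
    ∃ C : ℝ, 0 < C ∧ ∀ w p : ℝ, 1 < w → 1 < p → Θ w ≤ C * (Θ p * Real.exp (w / p)) := by
  -- With D < 2^n, doubling makes Θ(w) / Θ(p) at most a multiple of (w / p)^n, and x^n ≤ n! e^x.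
  obtain ⟨n, hn⟩ := pow_unbounded_of_one_lt D one_lt_two
  have hC : (1 : ℝ) ≤ 2 ^ n * n.factorial := by
    have h1 : (1 : ℝ) ≤ 2 ^ n := one_le_pow₀ one_le_two
    have h2 : (1 : ℝ) ≤ n.factorial := by exact_mod_cast n.factorial_pos
    nlinarith
  refine ⟨2 ^ n * n.factorial, by positivity, fun w p hw hp => ?_⟩
  have hp0 : 0 < p := by linarith
  have hΘ := h.pos p hp
  rcases le_total w p with hwp | hwp
  · have h1 : 1 ≤ Real.exp (w / p) := Real.one_le_exp (by positivity)
    calc Θ w ≤ Θ p := h.mono w p hw hwp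
      _ ≤ Θ p * Real.exp (w / p) := le_mul_of_one_le_right hΘ.le h1
      _ ≤ _ := le_mul_of_one_le_left (by positivity) hC
  · set x := w / p with hx
    have hx1 : 1 ≤ x := by rw [hx, le_div_iff₀ hp0]; linarith
    obtain ⟨k, hk1, hk2⟩ := exists_nat_pow_near hx1 (one_lt_two : (1 : ℝ) < 2)
    have hwk : w ≤ 2 ^ (k + 1) * p := by
      rw [hx, div_lt_iff₀ hp0] at hk2
      exact hk2.le
    have hD := h.one_le
    have hDk : D ^ (k + 1) ≤ 2 ^ n * x ^ n := by
      calc D ^ (k + 1) ≤ (2 ^ n) ^ (k + 1) := by gcongr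
        _ = (2 * 2 ^ k) ^ n := by rw [← pow_mul, ← pow_succ', ← pow_mul, mul_comm]
        _ ≤ (2 * x) ^ n := by gcongr
        _ = _ := mul_pow _ _ _
    have hexp := Real.pow_div_factorial_le_exp x (by linarith) n
    rw [div_le_iff₀ (by positivity)] at hexp
    calc Θ w ≤ Θ (2 ^ (k + 1) * p) := h.mono _ _ hw hwk
      _ ≤ D ^ (k + 1) * Θ p := h.pow_doubling hp _
      _ ≤ (2 ^ n * (Real.exp x * n.factorial)) * Θ p := by
        gcongr
        exact hDk.trans (by gcongr)
      _ = _ := by ring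

end IsGrowthFunction

variable {p₀ : ℝ}

theorem yudovichFun_le (h : IsGrowthFunction Θ D) (hp₀ : 1 ≤ p₀) {p r : ℝ} (hp : p₀ < p)
    (hr : 0 ≤ r) : yudovichFun p₀ Θ r ≤ Θ p * r ^ (1 / p) := by
  refine ciInf_le (f := fun p : Ioi p₀ => Θ p * r ^ (1 / (p : ℝ))) ⟨0, ?_⟩ ⟨p, hp⟩
  rintro _ ⟨q, rfl⟩
  have hq : p₀ < q := q.2
  have := h.pos q (by linarith)
  positivity

theorem le_yudovichFun {r b : ℝ} (h : ∀ p, p₀ < p → b ≤ Θ p * r ^ (1 / p)) :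
    b ≤ yudovichFun p₀ Θ r := by
  have : Nonempty (Ioi p₀) := ⟨⟨p₀ + 1, by simp⟩⟩
  exact le_ciInf fun p => h p p.2

theorem lower_bound_le_yudovichFun (h : IsGrowthFunction Θ D) (hp₀ : 1 ≤ p₀) {r : ℝ} (hr : 0 < r) :
    Θ 2 / D * min 1 (r ^ (1 / p₀)) ≤ yudovichFun p₀ Θ r := by
  refine le_yudovichFun fun p hp => ?_
  have hθ := h.lower_bound_pos
  refine mul_le_mul (h.lower_bound (by linarith)) ?_ (by positivity) (h.pos p (by linarith)).le
  rcases le_total 1 r with h1 | h1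
  · refine (min_le_left _ _).trans (Real.one_le_rpow h1 (by
      have : 0 < p := by linarith
      positivity))
  · refine (min_le_right _ _).trans (Real.rpow_le_rpow_of_exponent_ge hr h1 ?_)
    exact one_div_le_one_div_of_le (by linarith) hp.le

theorem yudovichFun_pos (h : IsGrowthFunction Θ D) (hp₀ : 1 ≤ p₀) {r : ℝ} (hr : 0 < r) :
    0 < yudovichFun p₀ Θ r := by
  refine lt_of_lt_of_le ?_ (lower_bound_le_yudovichFun h hp₀ hr)
  exact mul_pos h.lower_bound_pos (lt_min one_pos (by positivity))

theorem exists_le_two_mul_yudovichFun (h : IsGrowthFunction Θ D) (hp₀ : 1 ≤ p₀) {r : ℝ}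
    (hr : 0 < r) : ∃ p, p₀ < p ∧ Θ p * r ^ (1 / p) ≤ 2 * yudovichFun p₀ Θ r := by
  have : Nonempty (Ioi p₀) := ⟨⟨p₀ + 1, by simp⟩⟩
  have hy := yudovichFun_pos h hp₀ hr
  have hlt : yudovichFun p₀ Θ r < 2 * yudovichFun p₀ Θ r := by linarith
  obtain ⟨p, hp⟩ := exists_lt_of_ciInf_lt hlt
  exact ⟨p, p.2, hp.le⟩

end Growth

/-! ### Extrapolation from averages of rearrangements to L^p norms -/

section Extrapolation

variable {A : Type} [MeasureSpace A] {g : (Fin 2 → A) → ℝ≥0∞} {p₀ : ℝ}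

theorem ofReal_one_div_rpow {t : ℝ} (ht : 0 < t) (a : ℝ) :
    ENNReal.ofReal ((1 / t) ^ a) = ENNReal.ofReal t ^ (-a) := by
  rw [one_div, Real.inv_rpow ht.le, ← Real.rpow_neg ht.le, ENNReal.ofReal_rpow_of_pos ht]

theorem maximalRearrangement_rpow_le [SFinite (volume : Measure (Fin 2 → A))] (hg : Measurable g)
    (hp₀ : 0 < p₀) {p t : ℝ} (hp : p₀ ≤ p) (ht : 0 < t) :
    maximalRearrangement (fun x => g x ^ p₀) t ^ (1 / p₀) ≤
      ENNReal.ofReal ((1 / t) ^ (1 / p)) * (∫⁻ x, g x ^ p) ^ (1 / p) := by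
  have hp' : 0 < p := hp₀.trans_le hp
  set q := p / p₀ with hq
  have hq1 : 1 ≤ q := by rw [hq, le_div_iff₀ hp₀]; linarith
  have hq0 : 0 < q := by linarith
  set b := ENNReal.ofReal t with hb
  have hb0 : b ≠ 0 := by simpa [hb] using ht
  have hbt : b ≠ ∞ := ENNReal.ofReal_ne_top
  have hJ : rearrIntegral (fun x => g x ^ p₀) t ≤
      b ^ (1 - 1 / q) * (∫⁻ x, (g x ^ p₀) ^ q) ^ (1 / q) := by
    rcases hq1.eq_or_lt with h1 | h1
    · rw [← h1]
      simpa using rearrIntegral_le_lintegral (hg.pow_const p₀) t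
    · exact rearrIntegral_le_rpow (hg.pow_const p₀) h1
  have hX : ∀ x, (g x ^ p₀) ^ q = g x ^ p := fun x => by
    rw [← ENNReal.rpow_mul, hq, mul_div_cancel₀ _ hp₀.ne']
  simp_rw [hX] at hJ
  have hq' : 1 / q * (1 / p₀) = 1 / p := by
    rw [hq]; field_simp
  calc maximalRearrangement (fun x => g x ^ p₀) t ^ (1 / p₀)
      ≤ (b ^ (-(1 / q)) * (∫⁻ x, g x ^ p) ^ (1 / q)) ^ (1 / p₀) := by
        refine ENNReal.rpow_le_rpow ?_ (by positivity)
        refine ENNReal.div_le_of_le_mul (hJ.trans (le_of_eq ?_))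
        rw [sub_eq_add_neg, add_comm, ENNReal.rpow_add _ _ hb0 hbt, ENNReal.rpow_one]
        ring
    _ = _ := by
        rw [ENNReal.mul_rpow_of_nonneg _ _ (by positivity), ← ENNReal.rpow_mul, ← ENNReal.rpow_mul,
          hq', neg_mul, hq', ofReal_one_div_rpow ht]

theorem rearrangement_le_maximalRearrangement (hp₀ : 0 < p₀) {s : ℝ} (hs : 0 < s) :
    rearrangement g (ENNReal.ofReal s) ≤
      maximalRearrangement (fun x => g x ^ p₀) s ^ (1 / p₀) := by
  have h1 := mul_rearrangement_le_rearrIntegral (h := fun x => g x ^ p₀) s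
  rw [rearrangement_rpow hp₀, mul_comm] at h1
  have h2 : rearrangement g (ENNReal.ofReal s) ^ p₀ ≤
      maximalRearrangement (fun x => g x ^ p₀) s :=
    (ENNReal.le_div_iff_mul_le (Or.inl (by simpa using hs)) (Or.inl ENNReal.ofReal_ne_top)).2 h1
  calc rearrangement g (ENNReal.ofReal s)
      = (rearrangement g (ENNReal.ofReal s) ^ p₀) ^ (1 / p₀) := by
        rw [← ENNReal.rpow_mul, mul_one_div_cancel hp₀.ne', ENNReal.rpow_one]
    _ ≤ _ := ENNReal.rpow_le_rpow h2 (by positivity)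

theorem rpow_maximalRearrangement (hp₀ : 0 < p₀) {t : ℝ} (ht : 0 < t) :
    maximalRearrangement (fun x => g x ^ p₀) t ^ (1 / p₀) =
      rearrIntegral (fun x => g x ^ p₀) t ^ (1 / p₀) / ENNReal.ofReal (t ^ (1 / p₀)) := by
  rw [← ENNReal.ofReal_rpow_of_pos ht, ← ENNReal.div_rpow_of_nonneg _ _ (by positivity)]
  rfl

theorem lintegral_rpow_le_of_maximalRearrangement [SFinite (volume : Measure (Fin 2 → A))]
    (hg : Measurable g) (hp₀ : 0 < p₀) {M : ℝ≥0∞}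
    (h : ∀ t, 0 < t → maximalRearrangement (fun x => g x ^ p₀) t ^ (1 / p₀) ≤
      M * ENNReal.ofReal ((1 / t) ^ (1 / p₀))) :
    ∫⁻ x, g x ^ p₀ ≤ M ^ p₀ := by
  refine lintegral_le_of_rearrIntegral_le (hg.pow_const p₀) fun t ht => ?_
  have h1 := h t ht
  have ht' : 0 < t ^ (1 / p₀) := Real.rpow_pos_of_pos ht _
  have hb0 : ENNReal.ofReal (t ^ (1 / p₀)) ≠ 0 := by simpa using ht'
  rw [rpow_maximalRearrangement hp₀ ht,
    ENNReal.div_le_iff_le_mul (Or.inl hb0) (Or.inl ENNReal.ofReal_ne_top), mul_assoc,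
    ← ENNReal.ofReal_mul (by positivity), one_div t, Real.inv_rpow ht.le, inv_mul_cancel₀ ht'.ne',
    ENNReal.ofReal_one, mul_one] at h1
  calc rearrIntegral (fun x => g x ^ p₀) t
      = (rearrIntegral (fun x => g x ^ p₀) t ^ (1 / p₀)) ^ p₀ := by
        rw [← ENNReal.rpow_mul, one_div_mul_cancel hp₀.ne', ENNReal.rpow_one]
    _ ≤ _ := ENNReal.rpow_le_rpow h1 hp₀.le

variable {Θ : ℝ → ℝ} {D : ℝ}

/-- The exponent p₀ itself is excluded from the infimum defining y_Θ. Choose p in (p₀, q), depending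
on t, so close to p₀ that t^{-1/p} ≤ 2 t^{-1/p₀}, and use Θ(p) ≤ Θ(q). -/
theorem rpow_lintegral_le_of_yudovichFun [SFinite (volume : Measure (Fin 2 → A))]
    (hΘ : IsGrowthFunction Θ D) (hg : Measurable g) (hp₀ : 1 ≤ p₀) {S : ℝ≥0∞}
    (h : ∀ t, 0 < t → maximalRearrangement (fun x => g x ^ p₀) t ^ (1 / p₀) ≤
      S * ENNReal.ofReal (yudovichFun p₀ Θ (1 / t))) {q : ℝ} (hq : p₀ < q) :
    (∫⁻ x, g x ^ p₀) ^ (1 / p₀) ≤ 2 * S * ENNReal.ofReal (Θ q) := by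
  have hp0 : 0 < p₀ := by linarith
  have hΘq := hΘ.pos q (by linarith)
  have key : ∫⁻ x, g x ^ p₀ ≤ (2 * S * ENNReal.ofReal (Θ q)) ^ p₀ := by
    refine lintegral_rpow_le_of_maximalRearrangement hg hp0 fun t ht => ?_
    have hc : Tendsto (fun p : ℝ => (1 / t) ^ (1 / p)) (𝓝[>] p₀) (𝓝 ((1 / t) ^ (1 / p₀))) := by
      have : ContinuousAt (fun p : ℝ => (1 / t) ^ (1 / p)) p₀ :=
        ContinuousAt.rpow continuousAt_const (continuousAt_const.div continuousAt_id hp0.ne')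
          (Or.inl (by positivity))
      exact this.tendsto.mono_left nhdsWithin_le_nhds
    have ht0 : 0 < (1 / t) ^ (1 / p₀) := by positivity
    obtain ⟨p, hp1, hp2⟩ := ((hc.eventually (gt_mem_nhds (by linarith :
      (1 / t) ^ (1 / p₀) < 2 * (1 / t) ^ (1 / p₀)))).and (Ioo_mem_nhdsGT hq)).exists
    refine (h t ht).trans ?_
    calc S * ENNReal.ofReal (yudovichFun p₀ Θ (1 / t))
        ≤ S * ENNReal.ofReal (Θ q * (2 * (1 / t) ^ (1 / p₀))) := by
          gcongr
          refine (yudovichFun_le hΘ hp₀ hp2.1 (by positivity)).trans ?_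
          exact mul_le_mul (hΘ.mono p q (by linarith [hp2.1]) hp2.2.le) hp1.le (by positivity) hΘq.le
      _ = _ := by
          rw [ENNReal.ofReal_mul hΘq.le, ENNReal.ofReal_mul (by norm_num), ENNReal.ofReal_ofNat]
          ring
  calc _ ≤ ((2 * S * ENNReal.ofReal (Θ q)) ^ p₀) ^ (1 / p₀) :=
        ENNReal.rpow_le_rpow key (by positivity)
    _ = _ := by rw [← ENNReal.rpow_mul, mul_one_div_cancel hp0.ne', ENNReal.rpow_one]

theorem lintegral_Ioc_rpow_neg_half :
    ∫⁻ s in Ioc (0 : ℝ) 1, ENNReal.ofReal ((1 / s) ^ (1 / 2 : ℝ)) = 2 := by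
  have hi : IntervalIntegrable (fun s : ℝ => s ^ (-(1 / 2) : ℝ)) volume 0 1 :=
    intervalIntegral.intervalIntegrable_rpow' (by norm_num)
  have e : ∫⁻ s in Ioc (0 : ℝ) 1, ENNReal.ofReal ((1 / s) ^ (1 / 2 : ℝ)) =
      ∫⁻ s in Ioc (0 : ℝ) 1, ENNReal.ofReal (s ^ (-(1 / 2) : ℝ)) := by
    refine setLIntegral_congr_fun measurableSet_Ioc fun s hs => ?_
    rw [one_div s, Real.inv_rpow hs.1.le, ← Real.rpow_neg hs.1.le]
  rw [e, ← ofReal_integral_eq_lintegral_ofReal, ← intervalIntegral.integral_of_le zero_le_one,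
    integral_rpow (Or.inl (by norm_num))]
  · norm_num
  · exact (intervalIntegrable_iff_integrableOn_Ioc_of_le zero_le_one).1 hi
  · filter_upwards [ae_restrict_mem measurableSet_Ioc] with s hs
    exact Real.rpow_nonneg hs.1.le _

theorem rpow_lintegral_le_of_maximalRearrangement [SFinite (volume : Measure (Fin 2 → A))]
    (hΘ : IsGrowthFunction Θ D) (hg : Measurable g) (hp₀ : 1 ≤ p₀) {S : ℝ≥0∞}
    (h : ∀ t, 0 < t → maximalRearrangement (fun x => g x ^ p₀) t ^ (1 / p₀) ≤
      S * ENNReal.ofReal (yudovichFun p₀ Θ (1 / t))) {p : ℝ} (hp : p₀ < p) :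
    (∫⁻ x, g x ^ p) ^ (1 / p) ≤ ENNReal.ofReal (4 * D) * S * ENNReal.ofReal (Θ p) := by
  have hp0 : 0 < p₀ := by linarith
  have hp' : 0 < p := by linarith
  have hΘp := hΘ.pos p (by linarith)
  have hD := hΘ.one_le
  have hD' : (1 : ℝ≥0∞) ≤ ENNReal.ofReal D := by simpa using hD
  set T := S * ENNReal.ofReal (Θ p) with hT
  set U := ENNReal.ofReal D * T with hU
  have hTU : T ≤ U := le_mul_of_one_le_left zero_le hD'
  have hLp : ∫⁻ x, g x ^ p₀ ≤ (2 * T) ^ p₀ := by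
    have h1 := ENNReal.rpow_le_rpow (rpow_lintegral_le_of_yudovichFun hΘ hg hp₀ h hp) hp0.le
    rwa [← ENNReal.rpow_mul, one_div_mul_cancel hp0.ne', ENNReal.rpow_one, mul_assoc] at h1
  have hr : ∀ s, 0 < s → ∀ q, p₀ < q → rearrangement g (ENNReal.ofReal s) ≤
      S * ENNReal.ofReal (Θ q * (1 / s) ^ (1 / q)) := by
    intro s hs q hq
    refine (rearrangement_le_maximalRearrangement hp0 hs).trans ((h s hs).trans ?_)
    gcongr
    exact yudovichFun_le hΘ hp₀ hq (by positivity)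
  have hIoi : Ioi (0 : ℝ) = Ioc 0 1 ∪ Ioi 1 := (Ioc_union_Ioi_eq_Ioi zero_le_one).symm
  -- The pointwise bound with exponent 2 p, raised to the power p, leaves s^{-1/2}, whose integral
  -- over (0, 1] is 2. Doubling is used only here.
  have hsmall : ∫⁻ s in Ioc (0 : ℝ) 1, rearrangement g (ENNReal.ofReal s) ^ p ≤ 2 * U ^ p := by
    calc ∫⁻ s in Ioc (0 : ℝ) 1, rearrangement g (ENNReal.ofReal s) ^ p
        ≤ ∫⁻ s in Ioc (0 : ℝ) 1, U ^ p * ENNReal.ofReal ((1 / s) ^ (1 / 2 : ℝ)) := by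
          refine setLIntegral_mono' measurableSet_Ioc fun s hs => ?_
          have hs0 : 0 < 1 / s := one_div_pos.2 hs.1
          have h1 : rearrangement g (ENNReal.ofReal s) ≤
              U * ENNReal.ofReal ((1 / s) ^ (1 / (2 * p))) := by
            refine (hr s hs.1 (2 * p) (by linarith)).trans ?_
            calc S * ENNReal.ofReal (Θ (2 * p) * (1 / s) ^ (1 / (2 * p)))
                ≤ S * ENNReal.ofReal (D * Θ p * (1 / s) ^ (1 / (2 * p))) := by
                  gcongr
                  exact hΘ.doubling p (by linarith)
              _ = _ := by
                  rw [ENNReal.ofReal_mul (by positivity), ENNReal.ofReal_mul (by positivity), hU, hT]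
                  ring
          calc rearrangement g (ENNReal.ofReal s) ^ p
              ≤ (U * ENNReal.ofReal ((1 / s) ^ (1 / (2 * p)))) ^ p :=
                ENNReal.rpow_le_rpow h1 hp'.le
            _ = _ := by
                rw [ENNReal.mul_rpow_of_nonneg _ _ hp'.le,
                  ENNReal.ofReal_rpow_of_nonneg (by positivity) hp'.le, ← Real.rpow_mul hs0.le]
                have e : 1 / (2 * p) * p = 1 / 2 := by field_simp
                rw [e]
      _ = U ^ p * 2 := by
          rw [lintegral_const_mul _ (by fun_prop), lintegral_Ioc_rpow_neg_half]
      _ = _ := mul_comm _ _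
  -- For s > 1, g^* ≤ T, so (g^*)^p ≤ T^{p - p₀} (g^*)^{p₀} and the L^{p₀} bound applies.
  have hlarge : ∫⁻ s in Ioi (1 : ℝ), rearrangement g (ENNReal.ofReal s) ^ p ≤ (2 * U) ^ p := by
    have h1 : rearrangement g (ENNReal.ofReal 1) ≤ T := by
      have := hr 1 one_pos p hp
      simpa using this
    calc ∫⁻ s in Ioi (1 : ℝ), rearrangement g (ENNReal.ofReal s) ^ p
        ≤ ∫⁻ s in Ioi (1 : ℝ), T ^ (p - p₀) * rearrangement (fun x => g x ^ p₀) (ENNReal.ofReal s) := by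
          refine setLIntegral_mono' measurableSet_Ioi fun s hs => ?_
          have h2 : rearrangement g (ENNReal.ofReal s) ≤ T :=
            (rearrangement_antitone (ENNReal.ofReal_le_ofReal (le_of_lt hs))).trans h1
          rw [rearrangement_rpow hp0]
          calc rearrangement g (ENNReal.ofReal s) ^ p
              = rearrangement g (ENNReal.ofReal s) ^ (p - p₀) *
                rearrangement g (ENNReal.ofReal s) ^ p₀ := by
                rw [← ENNReal.rpow_add_of_nonneg _ _ (by linarith) hp0.le, sub_add_cancel]
            _ ≤ _ := by gcongr
      _ = T ^ (p - p₀) * ∫⁻ s in Ioi (1 : ℝ), rearrangement (fun x => g x ^ p₀) (ENNReal.ofReal s) :=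
          lintegral_const_mul _ measurable_rearrangement
      _ ≤ T ^ (p - p₀) * (2 * T) ^ p₀ := by
          gcongr
          refine (lintegral_mono_set (Ioi_subset_Ioi zero_le_one)).trans ?_
          rw [lintegral_rearrangement (hg.pow_const p₀)]
          exact hLp
      _ ≤ (2 * U) ^ (p - p₀) * (2 * U) ^ p₀ := by
          refine mul_le_mul' (ENNReal.rpow_le_rpow ?_ (by linarith)) (by gcongr)
          exact hTU.trans (le_mul_of_one_le_left zero_le (by norm_num))
      _ = (2 * U) ^ p := by
          rw [← ENNReal.rpow_add_of_nonneg _ _ (by linarith) hp0.le, sub_add_cancel]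
  have htot : ∫⁻ x, g x ^ p ≤ (4 * U) ^ p := by
    rw [← lintegral_rearrangement (hg.pow_const p), hIoi]
    simp_rw [rearrangement_rpow hp']
    refine (lintegral_union_le _ _ _).trans ?_
    have h2 : (2 : ℝ≥0∞) ≤ 2 ^ p := by
      calc (2 : ℝ≥0∞) = 2 ^ (1 : ℝ) := (ENNReal.rpow_one 2).symm
        _ ≤ 2 ^ p := ENNReal.rpow_le_rpow_of_exponent_le (by norm_num) (by linarith)
    calc _ ≤ 2 * U ^ p + (2 * U) ^ p := add_le_add hsmall hlarge
      _ ≤ 2 ^ p * U ^ p + (2 * U) ^ p := by gcongr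
      _ = 2 * (2 * U) ^ p := by rw [← ENNReal.mul_rpow_of_nonneg _ _ hp'.le, two_mul ((2 * U) ^ p)]
      _ ≤ 2 ^ p * (2 * U) ^ p := by gcongr
      _ = _ := by
          rw [← ENNReal.mul_rpow_of_nonneg _ _ hp'.le, ← mul_assoc]
          norm_num
  calc (∫⁻ x, g x ^ p) ^ (1 / p) ≤ ((4 * U) ^ p) ^ (1 / p) :=
        ENNReal.rpow_le_rpow htot (by positivity)
    _ = 4 * U := by rw [← ENNReal.rpow_mul, mul_one_div_cancel hp'.ne', ENNReal.rpow_one]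
    _ = _ := by
        rw [hU, hT, ENNReal.ofReal_mul (by norm_num), ENNReal.ofReal_ofNat]
        ring

end Extrapolation

/-! ### Yudovich norms against the power-type and logarithmic suprema -/

section YudovichComparison

variable {A : Type} [MeasureSpace A] {p₀ : ℝ} {Θ : ℝ → ℝ} {D : ℝ}

/-- The function `([g^{p₀}]^{**}(t))^{1/p₀}`. -/
noncomputable def maxAverage (p₀ : ℝ) (g : (Fin 2 → A) → ℝ≥0∞) (t : ℝ) : ℝ≥0∞ :=
  maximalRearrangement (fun x => g x ^ p₀) t ^ (1 / p₀)

/-- The Yudovich norm of a nonnegative function. -/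
noncomputable def yudovichNorm (p₀ : ℝ) (Θ : ℝ → ℝ) (g : (Fin 2 → A) → ℝ≥0∞) : ℝ≥0∞ :=
  ⨆ p ∈ Ioi p₀, (∫⁻ x, g x ^ p) ^ (1 / p) / ENNReal.ofReal (Θ p)

theorem div_ofReal_mul {x : ℝ} (hx : 0 ≤ x) (y : ℝ) (a : ℝ≥0∞) :
    a / ENNReal.ofReal (x * y) = a / ENNReal.ofReal x / ENNReal.ofReal y := by
  rw [ENNReal.ofReal_mul hx, div_eq_mul_inv, div_eq_mul_inv, div_eq_mul_inv,
    ENNReal.mul_inv (Or.inr ENNReal.ofReal_ne_top) (Or.inl ENNReal.ofReal_ne_top), mul_assoc]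

theorem iSup₂_div_le_mul {ι : Type*} {s : Set ι} {W H a : ι → ℝ≥0∞} {C : ℝ≥0∞}
    (h : ∀ t ∈ s, W t ≤ C * H t) : ⨆ t ∈ s, W t / a t ≤ C * ⨆ t ∈ s, H t / a t := by
  refine iSup₂_le fun t ht => ?_
  calc W t / a t ≤ C * H t / a t := ENNReal.div_le_div_right (h t ht) _
    _ = C * (H t / a t) := mul_div_assoc _ _ _
    _ ≤ _ := by
        gcongr
        exact le_iSup₂ (f := fun t (_ : t ∈ s) => H t / a t) t ht

theorem le_iSup₂_div_mul {ι : Type*} {s : Set ι} {H : ι → ℝ≥0∞} {a : ι → ℝ} {t : ι} (ht : t ∈ s)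
    (ha : 0 < a t) : H t ≤ (⨆ t ∈ s, H t / ENNReal.ofReal (a t)) * ENNReal.ofReal (a t) := by
  rw [← ENNReal.div_le_iff_le_mul (Or.inl (by simpa using ha)) (Or.inl ENNReal.ofReal_ne_top)]
  exact le_iSup₂ (f := fun t (_ : t ∈ s) => H t / ENNReal.ofReal (a t)) t ht

theorem iSup₂_div_le {ι : Type*} {s : Set ι} {H : ι → ℝ≥0∞} {a : ι → ℝ} {M : ℝ≥0∞}
    (ha : ∀ t ∈ s, 0 < a t) (h : ∀ t ∈ s, H t ≤ M * ENNReal.ofReal (a t)) :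
    ⨆ t ∈ s, H t / ENNReal.ofReal (a t) ≤ M := by
  refine iSup₂_le fun t ht => ?_
  rw [ENNReal.div_le_iff_le_mul (Or.inl (by simpa using ha t ht)) (Or.inl ENNReal.ofReal_ne_top)]
  exact h t ht

variable {g : (Fin 2 → A) → ℝ≥0∞}

theorem lpNorm_le_yudovichNorm (hΘ : IsGrowthFunction Θ D) (hp₀ : 1 ≤ p₀) {p : ℝ} (hp : p₀ < p) :
    (∫⁻ x, g x ^ p) ^ (1 / p) ≤ yudovichNorm p₀ Θ g * ENNReal.ofReal (Θ p) :=
  le_iSup₂_div_mul (s := Ioi p₀) (H := fun p => (∫⁻ x, g x ^ p) ^ (1 / p)) hp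
    (hΘ.pos p (by linarith))

variable [SFinite (volume : Measure (Fin 2 → A))]

theorem maxAverage_le_yudovichNorm (hΘ : IsGrowthFunction Θ D) (hg : Measurable g) (hp₀ : 1 ≤ p₀)
    {p t : ℝ} (hp : p₀ < p) (ht : 0 < t) :
    maxAverage p₀ g t ≤ yudovichNorm p₀ Θ g * ENNReal.ofReal (Θ p * (1 / t) ^ (1 / p)) := by
  have hp0 : 0 < p₀ := by linarith
  refine (maximalRearrangement_rpow_le hg hp0 hp.le ht).trans ?_
  rw [ENNReal.ofReal_mul (hΘ.pos p (by linarith)).le, ← mul_assoc, mul_comm]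
  gcongr
  exact lpNorm_le_yudovichNorm hΘ hp₀ hp

theorem maxAverage_le_yudovichFun (hΘ : IsGrowthFunction Θ D) (hg : Measurable g) (hp₀ : 1 ≤ p₀)
    {t : ℝ} (ht : 0 < t) :
    maxAverage p₀ g t ≤ 2 * yudovichNorm p₀ Θ g * ENNReal.ofReal (yudovichFun p₀ Θ (1 / t)) := by
  obtain ⟨p, hp, hle⟩ := exists_le_two_mul_yudovichFun hΘ hp₀ (one_div_pos.2 ht)
  calc maxAverage p₀ g t ≤ _ := maxAverage_le_yudovichNorm hΘ hg hp₀ hp ht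
    _ ≤ yudovichNorm p₀ Θ g * ENNReal.ofReal (2 * yudovichFun p₀ Θ (1 / t)) := by gcongr
    _ = _ := by
      rw [ENNReal.ofReal_mul (by norm_num), ENNReal.ofReal_ofNat]
      ring

theorem yudovichNorm_le_of_maxAverage_le (hΘ : IsGrowthFunction Θ D) (hg : Measurable g)
    (hp₀ : 1 ≤ p₀) {S : ℝ≥0∞}
    (h : ∀ t, 0 < t → maxAverage p₀ g t ≤ S * ENNReal.ofReal (yudovichFun p₀ Θ (1 / t))) :
    yudovichNorm p₀ Θ g ≤ ENNReal.ofReal (4 * D) * S :=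
  iSup₂_div_le (s := Ioi p₀) (H := fun p => (∫⁻ x, g x ^ p) ^ (1 / p))
    (fun p hp => hΘ.pos p (by linarith [show p₀ < p from hp]))
    fun _ hp => rpow_lintegral_le_of_maximalRearrangement hΘ hg hp₀ h hp

theorem yudovichNorm_le_iSup (hΘ : IsGrowthFunction Θ D) (hg : Measurable g) (hp₀ : 1 ≤ p₀) :
    yudovichNorm p₀ Θ g ≤ ENNReal.ofReal (4 * D) *
      ⨆ t ∈ Ioi (0 : ℝ), maxAverage p₀ g t / ENNReal.ofReal (yudovichFun p₀ Θ (1 / t)) :=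
  yudovichNorm_le_of_maxAverage_le hΘ hg hp₀ fun _ ht =>
    le_iSup₂_div_mul (s := Ioi (0 : ℝ)) (H := maxAverage p₀ g)
      (a := fun t => yudovichFun p₀ Θ (1 / t)) ht (yudovichFun_pos hΘ hp₀ (one_div_pos.2 ht))

theorem iSup_le_yudovichNorm (hΘ : IsGrowthFunction Θ D) (hg : Measurable g) (hp₀ : 1 ≤ p₀) :
    ⨆ t ∈ Ioi (0 : ℝ), maxAverage p₀ g t / ENNReal.ofReal (yudovichFun p₀ Θ (1 / t)) ≤
      2 * yudovichNorm p₀ Θ g :=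
  iSup₂_div_le (s := Ioi (0 : ℝ)) (a := fun t => yudovichFun p₀ Θ (1 / t))
    (fun _ ht => yudovichFun_pos hΘ hp₀ (one_div_pos.2 ht))
    fun _ ht => maxAverage_le_yudovichFun hΘ hg hp₀ ht

theorem one_div_rpow_eq_exp {t : ℝ} (ht : 0 < t) (a : ℝ) :
    (1 / t) ^ a = Real.exp (-Real.log t * a) := by
  rw [Real.rpow_def_of_pos (one_div_pos.2 ht), one_div, Real.log_inv]

/-- With u = -log t, the exponent p = max u (p₀ + 1) makes (1 / t^m)^{1/p} at most e^m. The
parameter m serves two scales: m = 1 for the rearrangement, and m = p₀ for the K-functional. -/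
theorem exists_logarithmic_le_yudovichNorm (hΘ : IsGrowthFunction Θ D) (hp₀ : 1 ≤ p₀) {m : ℝ}
    (hm : 0 ≤ m) :
    ∃ C : ℝ≥0, ∀ g : (Fin 2 → A) → ℝ≥0∞, Measurable g →
      (∫⁻ x, g x ^ p₀) ^ (1 / p₀) + ⨆ t ∈ Ioo (0 : ℝ) (Real.exp (-1)),
        maxAverage p₀ g (t ^ m) / ENNReal.ofReal (Θ (-Real.log t)) ≤
      C * yudovichNorm p₀ Θ g := by
  have hθ := hΘ.lower_bound_pos
  have hΘ1 := hΘ.pos (p₀ + 1) (by linarith)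
  -- For u below p₀ + 1 the value Θ(p₀ + 1) is compared with Θ(u) through the lower bound for Θ; the
  -- constant therefore depends on Θ.
  set B : ℝ := 1 + Θ (p₀ + 1) / (Θ 2 / D) with hB
  have hB1 : 1 ≤ B := by
    rw [hB]
    have : 0 ≤ Θ (p₀ + 1) / (Θ 2 / D) := by positivity
    linarith
  refine ⟨(4 * Θ (p₀ + 1)).toNNReal + (B * Real.exp m).toNNReal, fun g hg => ?_⟩
  rw [ENNReal.coe_add, add_mul]
  set N := yudovichNorm p₀ Θ g with hN
  refine add_le_add ?_ ?_
  · calc (∫⁻ x, g x ^ p₀) ^ (1 / p₀) ≤ 2 * (2 * N) * ENNReal.ofReal (Θ (p₀ + 1)) :=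
          rpow_lintegral_le_of_yudovichFun hΘ hg hp₀
            (fun t ht => maxAverage_le_yudovichFun hΘ hg hp₀ ht) (by linarith)
      _ = ENNReal.ofReal (4 * Θ (p₀ + 1)) * N := by
          rw [ENNReal.ofReal_mul (by norm_num), ENNReal.ofReal_ofNat, ← mul_assoc]
          norm_num
          ring
      _ = _ := rfl
  · have hu : ∀ t ∈ Ioo (0 : ℝ) (Real.exp (-1)), 1 < -Real.log t := by
      intro t ht
      have := Real.log_lt_log ht.1 ht.2
      rw [Real.log_exp] at this
      linarith
    refine iSup₂_div_le (H := fun t => maxAverage p₀ g (t ^ m)) (a := fun t => Θ (-Real.log t))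
      (fun t ht => hΘ.pos _ (hu t ht)) fun t ht => ?_
    have hu1 := hu t ht
    set u := -Real.log t with hudef
    have hΘu := hΘ.pos u hu1
    have hτ : 0 < t ^ m := Real.rpow_pos_of_pos ht.1 _
    have hpp : p₀ < max u (p₀ + 1) := lt_max_of_lt_right (by linarith)
    refine (maxAverage_le_yudovichNorm hΘ hg hp₀ hpp hτ).trans ?_
    have h1 : (1 / t ^ m) ^ (1 / max u (p₀ + 1)) ≤ Real.exp m := by
      rw [one_div_rpow_eq_exp hτ, Real.log_rpow ht.1, Real.exp_le_exp, mul_one_div,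
        div_le_iff₀ (by linarith)]
      have : u ≤ max u (p₀ + 1) := le_max_left _ _
      calc -(m * Real.log t) = m * u := by rw [hudef]; ring
        _ ≤ _ := by gcongr
    have h2 : Θ (max u (p₀ + 1)) ≤ B * Θ u := by
      rcases le_total u (p₀ + 1) with h | h
      · rw [max_eq_right h, hB, add_mul, one_mul]
        have h3 := hΘ.lower_bound hu1
        have h4 : Θ (p₀ + 1) ≤ Θ (p₀ + 1) / (Θ 2 / D) * Θ u := by
          rw [div_mul_eq_mul_div, le_div_iff₀ hθ]
          gcongr
        linarith
      · rw [max_eq_left h]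
        exact le_mul_of_one_le_left hΘu.le hB1
    calc N * ENNReal.ofReal (Θ (max u (p₀ + 1)) * (1 / t ^ m) ^ (1 / max u (p₀ + 1)))
        ≤ N * ENNReal.ofReal ((B * Θ u) * Real.exp m) := by
          gcongr
      _ = ENNReal.ofReal (B * Real.exp m) * N * ENNReal.ofReal (Θ u) := by
          rw [show B * Θ u * Real.exp m = B * Real.exp m * Θ u by ring,
            ENNReal.ofReal_mul (by positivity)]
          ring
      _ = _ := rfl

/-- For τ < e^{-m} put t^m = τ: then Θ(-log t) ≤ Θ(-log τ), because m ≥ 1, and this is at most a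
multiple of Θ(p) τ^{-1/p} for every p, hence of y_Θ(1/τ). For τ ≥ e^{-m} the L^{p₀} norm controls
the average, since y_Θ(1/τ) is bounded below by a multiple of τ^{-1/p₀} there. -/
theorem exists_yudovichNorm_le_logarithmic (hΘ : IsGrowthFunction Θ D) (hp₀ : 1 ≤ p₀) {m : ℝ}
    (hm : 1 ≤ m) :
    ∃ C : ℝ≥0, ∀ g : (Fin 2 → A) → ℝ≥0∞, Measurable g →
      yudovichNorm p₀ Θ g ≤ C * ((∫⁻ x, g x ^ p₀) ^ (1 / p₀) +
        ⨆ t ∈ Ioo (0 : ℝ) (Real.exp (-1)),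
          maxAverage p₀ g (t ^ m) / ENNReal.ofReal (Θ (-Real.log t))) := by
  have hθ := hΘ.lower_bound_pos
  have hp0 : 0 < p₀ := by linarith
  have hm0 : 0 < m := by linarith
  have hD := hΘ.one_le
  obtain ⟨G, hG0, hG⟩ := hΘ.exists_le_mul_exp
  set B : ℝ := Real.exp (m / p₀) / (Θ 2 / D) with hB
  have hB0 : 0 < B := by positivity
  refine ⟨(4 * D * (G + B)).toNNReal, fun g hg => ?_⟩
  set L := (∫⁻ x, g x ^ p₀) ^ (1 / p₀) with hL
  set S := ⨆ t ∈ Ioo (0 : ℝ) (Real.exp (-1)),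
          maxAverage p₀ g (t ^ m) / ENNReal.ofReal (Θ (-Real.log t)) with hS
  have key : ∀ t, 0 < t → maxAverage p₀ g t ≤
      (ENNReal.ofReal (G + B) * (L + S)) * ENNReal.ofReal (yudovichFun p₀ Θ (1 / t)) := by
    intro τ hτ
    have hy := yudovichFun_pos hΘ hp₀ (one_div_pos.2 hτ)
    rcases lt_or_ge τ (Real.exp (-m)) with hlt | hge
    · set t := τ ^ (1 / m) with ht
      have ht0 : 0 < t := Real.rpow_pos_of_pos hτ _
      have htm : t ^ m = τ := by
        rw [ht, ← Real.rpow_mul hτ.le, one_div_mul_cancel hm0.ne', Real.rpow_one]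
      have hlog : Real.log τ = m * Real.log t := by rw [← htm, Real.log_rpow ht0]
      have hw : Real.log τ < -m := by
        have := Real.log_lt_log hτ hlt
        rwa [Real.log_exp] at this
      have hlt1 : Real.log t < -1 := by
        rw [hlog] at hw
        nlinarith
      have hmem : t ∈ Ioo (0 : ℝ) (Real.exp (-1)) := by
        refine ⟨ht0, ?_⟩
        rwa [← Real.log_lt_iff_lt_exp ht0]
      have h1 := le_iSup₂_div_mul (s := Ioo (0 : ℝ) (Real.exp (-1)))
        (H := fun t => maxAverage p₀ g (t ^ m)) (a := fun t => Θ (-Real.log t)) hmem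
        (hΘ.pos _ (by linarith))
      simp only [htm] at h1
      have h2 : Θ (-Real.log t) ≤ G * yudovichFun p₀ Θ (1 / τ) := by
        rw [← div_le_iff₀' hG0]
        refine le_yudovichFun fun p hp => ?_
        rw [div_le_iff₀' hG0, one_div_rpow_eq_exp hτ, mul_one_div]
        refine le_trans (hΘ.mono _ (-Real.log τ) (by linarith) ?_)
          (hG (-Real.log τ) p (by linarith) (by linarith))
        rw [hlog]
        nlinarith
      calc maxAverage p₀ g τ ≤ S * ENNReal.ofReal (Θ (-Real.log t)) := h1
        _ ≤ (L + S) * ENNReal.ofReal ((G + B) * yudovichFun p₀ Θ (1 / τ)) := by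
          gcongr
          · exact le_add_self
          · refine h2.trans ?_
            gcongr
            linarith
        _ = _ := by
          rw [ENNReal.ofReal_mul (by positivity)]
          ring
    · have h1 := maximalRearrangement_rpow_le hg hp0 le_rfl hτ
      have h2 : (1 / τ) ^ (1 / p₀) ≤ B * yudovichFun p₀ Θ (1 / τ) := by
        have h3 := lower_bound_le_yudovichFun hΘ hp₀ (one_div_pos.2 hτ)
        have hx0 : 0 < (1 / τ) ^ (1 / p₀) := by positivity
        have hlog : -m ≤ Real.log τ := (Real.le_log_iff_exp_le hτ).2 hge
        have hx : (1 / τ) ^ (1 / p₀) ≤ Real.exp (m / p₀) := by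
          rw [one_div_rpow_eq_exp hτ, Real.exp_le_exp, mul_one_div]
          gcongr
          linarith
        have he : 1 ≤ Real.exp (m / p₀) := Real.one_le_exp (by positivity)
        have h4 : (1 / τ) ^ (1 / p₀) ≤ Real.exp (m / p₀) * min 1 ((1 / τ) ^ (1 / p₀)) := by
          rcases le_total 1 ((1 / τ) ^ (1 / p₀)) with h | h
          · rw [min_eq_left h, mul_one]
            exact hx
          · rw [min_eq_right h]
            exact le_mul_of_one_le_left hx0.le he
        calc (1 / τ) ^ (1 / p₀) ≤ Real.exp (m / p₀) * min 1 ((1 / τ) ^ (1 / p₀)) := h4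
          _ = B * (Θ 2 / D * min 1 ((1 / τ) ^ (1 / p₀))) := by
              rw [hB, ← mul_assoc, div_mul_cancel₀ _ hθ.ne']
          _ ≤ _ := by gcongr
      calc maxAverage p₀ g τ ≤ ENNReal.ofReal ((1 / τ) ^ (1 / p₀)) * L := h1
        _ ≤ ENNReal.ofReal ((G + B) * yudovichFun p₀ Θ (1 / τ)) * (L + S) := by
          gcongr
          · refine h2.trans ?_
            gcongr
            linarith
          · exact le_self_add
        _ = _ := by
          rw [ENNReal.ofReal_mul (by positivity)]
          ring
  refine (yudovichNorm_le_of_maxAverage_le hΘ hg hp₀ key).trans (le_of_eq ?_)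
  rw [← mul_assoc, ← ENNReal.ofReal_mul (by positivity)]
  rfl

end YudovichComparison

/-! ### Assembling the equivalences -/

section Main

variable {A : Type} [PseudoMetricSpace A] [MeasureSpace A] {V : ℝ → ℝ≥0∞} {α p₀ : ℝ}

theorem peetreK_congr_ae {p t : ℝ} {f g : (Fin 2 → A) → ℝ} (h : f =ᵐ[volume] g) :
    peetreK p t f = peetreK p t g := by
  have : ∀ k : (Fin 2 → A) → ℝ, f =ᵐ[volume] k ↔ g =ᵐ[volume] k := fun k =>
    ⟨fun h' => h.symm.trans h', fun h' => h.trans h'⟩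
  unfold peetreK
  simp_rw [this]

variable [BorelSpace A] [SecondCountableTopology A] [Nonempty A]

theorem exists_peetreK_comparable (hV : BallRegular (volume : Measure (Fin 2 → A)) V)
    (hα : 0 < α) (hα' : 2 ^ 40 * α ≤ 1) (hp₀ : 1 ≤ p₀) :
    ∃ C : ℝ≥0, ∀ f : (Fin 2 → A) → ℝ, AEMeasurable f → ∀ t : ℝ, 0 < t →
      peetreK p₀ (t ^ (1 / p₀)) f / ENNReal.ofReal (t ^ (1 / p₀)) ≤
        C * maxAverage p₀ (sharpMax α f) t ∧
      maxAverage p₀ (sharpMax α f) t ≤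
        C * (peetreK p₀ (t ^ (1 / p₀)) f / ENNReal.ofReal (t ^ (1 / p₀))) := by
  obtain ⟨C₁, hC₁⟩ := exists_peetreK_le hV hα hα' hp₀
  obtain ⟨C₂, hC₂⟩ := exists_le_peetreK hV hα hp₀
  refine ⟨C₁ + C₂, fun f hf t ht => ?_⟩
  -- Both sides depend only on the almost everywhere class of `f`, so a measurable representative
  -- may be used.
  have h1 := hC₁ _ hf.measurable_mk t ht
  rw [peetreK_congr_ae hf.ae_eq_mk.symm, sharpMax_congr_ae hf.ae_eq_mk.symm] at h1
  have h2 := hC₂ f t ht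
  have e : maxAverage p₀ (sharpMax α f) t = _ :=
    rpow_maximalRearrangement (by linarith : 0 < p₀) ht
  rw [e, ← mul_div_assoc, ← mul_div_assoc]
  refine ⟨ENNReal.div_le_div_right (h1.trans ?_) _, ENNReal.div_le_div_right (h2.trans ?_) _⟩
  · gcongr
    simp
  · gcongr
    simp

theorem exists_comparable_uniform (hV : BallRegular (volume : Measure (Fin 2 → A)) V)
    (hα : 0 < α) (hα' : 2 ^ 40 * α ≤ 1) (hp₀ : 1 ≤ p₀) (D : ℝ) :
    ∃ C : ℝ≥0, ∀ Θ : ℝ → ℝ, IsGrowthFunction Θ D → ∀ f : (Fin 2 → A) → ℝ, AEMeasurable f →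
      Comparable C
        (sharpYudovichNorm α p₀ Θ f)
        (⨆ t ∈ Ioi (0 : ℝ), peetreK p₀ (t ^ (1 / p₀)) f /
          ENNReal.ofReal (t ^ (1 / p₀) * yudovichFun p₀ Θ (1 / t))) ∧
      Comparable C
        (sharpYudovichNorm α p₀ Θ f)
        (⨆ t ∈ Ioi (0 : ℝ),
          maximalRearrangement (fun x => sharpMax α f x ^ p₀) t ^ (1 / p₀) /
          ENNReal.ofReal (yudovichFun p₀ Θ (1 / t))) := by
  have hsf := hV.sigmaFinite
  obtain ⟨C, hC⟩ := exists_peetreK_comparable hV hα hα' hp₀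
  set K : ℝ≥0 := (4 * D).toNNReal + 2 with hK
  have hDK : ENNReal.ofReal (4 * D) ≤ (K : ℝ≥0∞) := by
    rw [hK, ENNReal.coe_add]
    exact le_self_add
  have h2K : (2 : ℝ≥0∞) ≤ (K : ℝ≥0∞) := by
    rw [hK, ENNReal.coe_add]
    exact le_add_self
  have hKC : (K : ℝ≥0∞) ≤ ((K * (1 + C) : ℝ≥0) : ℝ≥0∞) := by
    rw [ENNReal.coe_le_coe]
    exact le_mul_of_one_le_right zero_le le_self_add
  have hKC' : (K : ℝ≥0∞) * C ≤ ((K * (1 + C) : ℝ≥0) : ℝ≥0∞) := by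
    rw [← ENNReal.coe_mul, ENNReal.coe_le_coe]
    gcongr
    exact le_add_self
  refine ⟨K * (1 + C), fun Θ hΘ f hf => ?_⟩
  have hg := measurable_sharpMax α f
  set N := sharpYudovichNorm α p₀ Θ f with hN
  set S := ⨆ t ∈ Ioi (0 : ℝ), maximalRearrangement (fun x => sharpMax α f x ^ p₀) t ^ (1 / p₀) /
          ENNReal.ofReal (yudovichFun p₀ Θ (1 / t)) with hS
  have hNS : N ≤ K * S := (yudovichNorm_le_iSup hΘ hg hp₀).trans (by gcongr; exact le_rfl)
  have hSN : S ≤ K * N := (iSup_le_yudovichNorm hΘ hg hp₀).trans (by gcongr; exact le_rfl)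
  have e : (⨆ t ∈ Ioi (0 : ℝ), peetreK p₀ (t ^ (1 / p₀)) f /
          ENNReal.ofReal (t ^ (1 / p₀) * yudovichFun p₀ Θ (1 / t))) =
      ⨆ t ∈ Ioi (0 : ℝ), peetreK p₀ (t ^ (1 / p₀)) f / ENNReal.ofReal (t ^ (1 / p₀)) /
          ENNReal.ofReal (yudovichFun p₀ Θ (1 / t)) := by
    refine iSup_congr fun t => iSup_congr fun ht => ?_
    exact div_ofReal_mul (Real.rpow_nonneg (le_of_lt ht) _) _ _
  rw [e]
  have h1 := iSup₂_div_le_mul (s := Ioi (0 : ℝ))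
    (a := fun t => ENNReal.ofReal (yudovichFun p₀ Θ (1 / t))) fun t ht => (hC f hf t ht).1
  have h2 := iSup₂_div_le_mul (s := Ioi (0 : ℝ))
    (a := fun t => ENNReal.ofReal (yudovichFun p₀ Θ (1 / t))) fun t ht => (hC f hf t ht).2
  refine ⟨⟨?_, ?_⟩, ⟨hNS.trans (by gcongr), hSN.trans (by gcongr)⟩⟩
  · refine hNS.trans ?_
    calc (K : ℝ≥0∞) * S ≤ K * (C * _) := mul_le_mul_right h2 _
      _ ≤ _ := by
        rw [← mul_assoc]
        gcongr
  · refine h1.trans ?_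
    calc (C : ℝ≥0∞) * S ≤ C * (K * N) := by gcongr
      _ ≤ _ := by
        rw [← mul_assoc, mul_comm (C : ℝ≥0∞)]
        gcongr

theorem exists_comparable_logarithmic (hV : BallRegular (volume : Measure (Fin 2 → A)) V)
    (hα : 0 < α) (hα' : 2 ^ 40 * α ≤ 1) (hp₀ : 1 ≤ p₀) {D : ℝ} {Θ : ℝ → ℝ}
    (hΘ : IsGrowthFunction Θ D) :
    ∃ C : ℝ≥0, ∀ f : (Fin 2 → A) → ℝ, AEMeasurable f →
      Comparable C
        (sharpYudovichNorm α p₀ Θ f)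
        (sharpLpNorm α p₀ f +
          ⨆ t ∈ Ioo (0 : ℝ) (Real.exp (-1)), peetreK p₀ t f /
            ENNReal.ofReal (t * Θ (-Real.log t))) ∧
      Comparable C
        (sharpYudovichNorm α p₀ Θ f)
        (sharpLpNorm α p₀ f +
          ⨆ t ∈ Ioo (0 : ℝ) (Real.exp (-1)),
            maximalRearrangement (fun x => sharpMax α f x ^ p₀) t ^ (1 / p₀) /
            ENNReal.ofReal (Θ (-Real.log t))) := by
  have hsf := hV.sigmaFinite
  have hp0 : 0 < p₀ := by linarith
  obtain ⟨C, hC⟩ := exists_peetreK_comparable hV hα hα' hp₀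
  obtain ⟨C₁, hC₁⟩ := exists_logarithmic_le_yudovichNorm (A := A) hΘ hp₀ (m := 1) zero_le_one
  obtain ⟨C₂, hC₂⟩ := exists_yudovichNorm_le_logarithmic (A := A) hΘ hp₀ (m := 1) le_rfl
  -- K(t, f) corresponds to the average over (0, t^{p₀}), hence the scale m = p₀.
  obtain ⟨C₃, hC₃⟩ := exists_logarithmic_le_yudovichNorm (A := A) hΘ hp₀ hp0.le
  obtain ⟨C₄, hC₄⟩ := exists_yudovichNorm_le_logarithmic (A := A) hΘ hp₀ hp₀
  set K : ℝ≥0 := C₁ + C₂ + (C₃ + C₄) * (1 + C) with hK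
  have hK1 : C₁ ≤ K := by rw [hK, add_assoc]; exact le_self_add
  have hK2 : C₂ ≤ K := by
    rw [hK]; exact le_add_self.trans le_self_add
  have hK3 : (1 + C) * C₃ ≤ K := by
    rw [hK, mul_comm]
    refine le_trans ?_ le_add_self
    gcongr
    exact le_self_add
  have hK4 : C₄ * (1 + C) ≤ K := by
    rw [hK]
    refine le_trans ?_ le_add_self
    gcongr
    exact le_add_self
  refine ⟨K, fun f hf => ?_⟩
  have hg := measurable_sharpMax α f
  set L := sharpLpNorm α p₀ f with hL
  set N := sharpYudovichNorm α p₀ Θ f with hN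
  refine ⟨?_, ?_⟩
  · have e : (⨆ t ∈ Ioo (0 : ℝ) (Real.exp (-1)), peetreK p₀ t f /
          ENNReal.ofReal (t * Θ (-Real.log t))) =
        ⨆ t ∈ Ioo (0 : ℝ) (Real.exp (-1)),
          peetreK p₀ ((t ^ p₀) ^ (1 / p₀)) f / ENNReal.ofReal ((t ^ p₀) ^ (1 / p₀)) /
            ENNReal.ofReal (Θ (-Real.log t)) := by
      refine iSup_congr fun t => iSup_congr fun ht => ?_
      rw [← Real.rpow_mul ht.1.le, mul_one_div_cancel hp0.ne', Real.rpow_one,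
        div_ofReal_mul ht.1.le]
    rw [e]
    have h1 := iSup₂_div_le_mul (s := Ioo (0 : ℝ) (Real.exp (-1)))
      (a := fun t => ENNReal.ofReal (Θ (-Real.log t)))
      fun t ht => (hC f hf (t ^ p₀) (Real.rpow_pos_of_pos ht.1 _)).1
    have h2 := iSup₂_div_le_mul (s := Ioo (0 : ℝ) (Real.exp (-1)))
      (a := fun t => ENNReal.ofReal (Θ (-Real.log t)))
      fun t ht => (hC f hf (t ^ p₀) (Real.rpow_pos_of_pos ht.1 _)).2
    have h3 := hC₃ _ hg
    have h4 := hC₄ _ hg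
    set S := ⨆ t ∈ Ioo (0 : ℝ) (Real.exp (-1)),
          maxAverage p₀ (sharpMax α f) (t ^ p₀) / ENNReal.ofReal (Θ (-Real.log t)) with hS
    set W := ⨆ t ∈ Ioo (0 : ℝ) (Real.exp (-1)),
          peetreK p₀ ((t ^ p₀) ^ (1 / p₀)) f / ENNReal.ofReal ((t ^ p₀) ^ (1 / p₀)) /
            ENNReal.ofReal (Θ (-Real.log t)) with hW
    have hadd : ∀ X Y : ℝ≥0∞, X ≤ C * Y → L + X ≤ ((1 + C : ℝ≥0) : ℝ≥0∞) * (L + Y) := by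
      intro X Y hXY
      push_cast
      calc L + X ≤ L + C * Y := by gcongr
        _ ≤ (L + Y) + C * (L + Y) := by
          gcongr
          · exact le_self_add
          · exact le_add_self
        _ = _ := by ring
    constructor
    · calc N ≤ C₄ * (L + S) := h4
        _ ≤ C₄ * (((1 + C : ℝ≥0) : ℝ≥0∞) * (L + W)) := by
          gcongr
          exact hadd S W h2
        _ = ((C₄ * (1 + C) : ℝ≥0) : ℝ≥0∞) * (L + W) := by rw [ENNReal.coe_mul, mul_assoc]
        _ ≤ _ := by gcongr
    · calc L + W ≤ ((1 + C : ℝ≥0) : ℝ≥0∞) * (L + S) := hadd W S h1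
        _ ≤ ((1 + C : ℝ≥0) : ℝ≥0∞) * (C₃ * N) := mul_le_mul_right h3 _
        _ = (((1 + C) * C₃ : ℝ≥0) : ℝ≥0∞) * N := by rw [ENNReal.coe_mul, mul_assoc]
        _ ≤ _ := by gcongr
  · have h1 := hC₁ _ hg
    have h2 := hC₂ _ hg
    simp only [Real.rpow_one] at h1 h2
    exact ⟨h2.trans (mul_le_mul_left (by exact_mod_cast hK2) _),
      h1.trans (mul_le_mul_left (by exact_mod_cast hK1) _)⟩

theorem Comparable.mono {C C' : ℝ≥0} {a b : ℝ≥0∞} (h : Comparable C a b) (hC : C ≤ C') :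
    Comparable C' a b :=
  ⟨h.1.trans (by gcongr), h.2.trans (by gcongr)⟩

end Main

end SharpYudovich

theorem theorem2p2 :
    ∃ α₀ : ℝ, 0 < α₀ ∧ ∀ α : ℝ, 0 < α → α < α₀ → ∀ p₀ : ℝ, 1 ≤ p₀ →
      -- Part (i): the constant depends only on `α`, `p₀` and the doubling constant `D`.
      (∀ D : ℝ, ∃ C : ℝ≥0, ∀ Θ : ℝ → ℝ, IsGrowthFunction Θ D →
        (∀ f : Plane → ℝ, AEMeasurable f →
          Comparable C
            (sharpYudovichNorm α p₀ Θ f)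
            (⨆ t ∈ Ioi (0 : ℝ), peetreK p₀ (t ^ (1 / p₀)) f /
              ENNReal.ofReal (t ^ (1 / p₀) * yudovichFun p₀ Θ (1 / t))) ∧
          Comparable C
            (sharpYudovichNorm α p₀ Θ f)
            (⨆ t ∈ Ioi (0 : ℝ),
              maximalRearrangement
                (fun x => sharpMax α f x ^ p₀) t ^ (1 / p₀) /
              ENNReal.ofReal (yudovichFun p₀ Θ (1 / t)))) ∧
        (∀ f : Torus → ℝ, AEMeasurable f →
          Comparable C
            (sharpYudovichNorm α p₀ Θ f)
            (⨆ t ∈ Ioi (0 : ℝ), peetreK p₀ (t ^ (1 / p₀)) f /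
              ENNReal.ofReal (t ^ (1 / p₀) * yudovichFun p₀ Θ (1 / t))) ∧
          Comparable C
            (sharpYudovichNorm α p₀ Θ f)
            (⨆ t ∈ Ioi (0 : ℝ),
              maximalRearrangement
                (fun x => sharpMax α f x ^ p₀) t ^ (1 / p₀) /
              ENNReal.ofReal (yudovichFun p₀ Θ (1 / t))))) ∧
      -- Part (ii): the constant may also depend on `Θ`.
      (∀ (D : ℝ) (Θ : ℝ → ℝ), IsGrowthFunction Θ D → ∃ C : ℝ≥0,
        (∀ f : Plane → ℝ, AEMeasurable f →
          Comparable C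
            (sharpYudovichNorm α p₀ Θ f)
            (sharpLpNorm α p₀ f +
              ⨆ t ∈ Ioo (0 : ℝ) (Real.exp (-1)), peetreK p₀ t f /
                ENNReal.ofReal (t * Θ (-Real.log t))) ∧
          Comparable C
            (sharpYudovichNorm α p₀ Θ f)
            (sharpLpNorm α p₀ f +
              ⨆ t ∈ Ioo (0 : ℝ) (Real.exp (-1)),
                maximalRearrangement
                  (fun x => sharpMax α f x ^ p₀) t ^ (1 / p₀) /
                ENNReal.ofReal (Θ (-Real.log t)))) ∧
        (∀ f : Torus → ℝ, AEMeasurable f →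
          Comparable C
            (sharpYudovichNorm α p₀ Θ f)
            (sharpLpNorm α p₀ f +
              ⨆ t ∈ Ioo (0 : ℝ) (Real.exp (-1)), peetreK p₀ t f /
                ENNReal.ofReal (t * Θ (-Real.log t))) ∧
          Comparable C
            (sharpYudovichNorm α p₀ Θ f)
            (sharpLpNorm α p₀ f +
              ⨆ t ∈ Ioo (0 : ℝ) (Real.exp (-1)),
                maximalRearrangement
                  (fun x => sharpMax α f x ^ p₀) t ^ (1 / p₀) /
                ENNReal.ofReal (Θ (-Real.log t))))) := by
  -- The most demanding use is the John-Strömberg inequality for the extension f₁, whose exceptional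
  -- proportion is 2^20 α: it needs 2^19 * 2^20 α ≤ 1.
  refine ⟨(2 ^ 40)⁻¹, by norm_num, fun α hα hα₀ p₀ hp₀ => ?_⟩
  have hα' : 2 ^ 40 * α ≤ 1 := by
    rw [lt_inv_comm₀ hα (by norm_num)] at hα₀
    rw [← le_div_iff₀ hα, one_div]
    exact hα₀.le
  refine ⟨fun D => ?_, fun D Θ hΘ => ?_⟩
  · obtain ⟨C₁, hC₁⟩ := exists_comparable_uniform ballRegular_plane hα hα' hp₀ D
    obtain ⟨C₂, hC₂⟩ := exists_comparable_uniform ballRegular_torus hα hα' hp₀ D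
    exact ⟨max C₁ C₂, fun Θ hΘ =>
      ⟨fun f hf => ⟨(hC₁ Θ hΘ f hf).1.mono (le_max_left _ _),
        (hC₁ Θ hΘ f hf).2.mono (le_max_left _ _)⟩,
      fun f hf => ⟨(hC₂ Θ hΘ f hf).1.mono (le_max_right _ _),
        (hC₂ Θ hΘ f hf).2.mono (le_max_right _ _)⟩⟩⟩
  · obtain ⟨C₁, hC₁⟩ := exists_comparable_logarithmic ballRegular_plane hα hα' hp₀ hΘ
    obtain ⟨C₂, hC₂⟩ := exists_comparable_logarithmic ballRegular_torus hα hα' hp₀ hΘ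
    exact ⟨max C₁ C₂,
      fun f hf => ⟨(hC₁ f hf).1.mono (le_max_left _ _), (hC₁ f hf).2.mono (le_max_left _ _)⟩,
      fun f hf => ⟨(hC₂ f hf).1.mono (le_max_right _ _), (hC₂ f hf).2.mono (le_max_right _ _)⟩⟩
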